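/- **Theorem 1 (Threshold).** Let $2\le k\le d-1$. *Lattices.* A $d$-dimensional lattice $\mathcal L$ on a torus $\mathbb R^d/\Lambda$ ($\Lambda$ a full-rank discrete group of translations) is a $\Lambda$-periodic triangulation $\tilde{\mathcal L}$ of $\mathbb R^d$, with finitely many simplices modulo $\Lambda$ and every simplex contained in a $d$-simplex; $\Delta_i(\mathcal L)$ is the set of $i$-simplices modulo $\Lambda$, $C_i$ the $\mathbb F_2$-vector space with basis $\Delta_i(\mathcal L)$, and $\partial_i:C_i\to C_{i-1}$ the boundary operator. The distance $d(u,v)$ of vertices is the length of a shortest edge path, and the linear size $L$ of $\mathcal L$ is the length of a shortest non-contractible closed edge path of $\mathcal L$. A sweep direction is a unit vector $\vec t\in\mathbb R^d$ not perpendicular to any edge; a causal path is an edge path along all of whose edges $\vec t$ increases, and $u\preceq v$ means that there is a causal path from $u$ to $v$ (order, paths and distances being taken in the universal cover $\tilde{\mathcal L}$). The future ${\uparrow}v$ (past ${\downarrow}v$) of a vertex consists of the simplices all of whose vertices succeed (precede) $v$; the causal diamond of a vertex set $V$ is $\Diamond V={\uparrow}(\inf V)\cap{\downarrow}(\sup V)$,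 and the diamond of a set of simplices is that of its set of vertices. $B_v(r)$ is the set of simplices having a vertex at distance less than $r$ from $v$, $\sigma|_v$ is the set of simplices of $\sigma$ containing $v$, and $\mathrm{St}_k(v)$ is the set of $k$-simplices containing $v$. *Assumptions.* Let $\mathcal L$ range over a sequence of such lattices with $L\to\infty$, each with a sweep direction, and let $\theta>0$, $c_B,c_D,c_P$, and $s\in\mathbb N$ be constants independent of $\mathcal L$. Call a non-empty finite set $V$ of vertices of $\tilde{\mathcal L}$ local if $\operatorname{diam}V\le\theta L$. Assume, for every $\mathcal L$ in the sequence: (i) every local $V$ has an infimum and a supremum with respect to $\preceq$; (ii) if $\sigma\in\operatorname{im}\partial_k$ and $\emptyset\ne\sigma|_v\subset{\uparrow}v$, there is $\varphi\subseteq\mathrm{St}_k(v)\cap{\uparrow}v$ with $(\partial_k\varphi)|_v=\sigma|_v$ and $\Diamond\varphi=\Diamond(\sigma|_v)$; (iii) for $0<r<R\le\theta L$, every ball $B_v(R)$ is covered by at most $c_B(R/r)^d$ balls of radius $r$; (iv) $\operatorname{diam}\Diamond V\le c_D\operatorname{diam}V$ for every local $V$; (v) if $d(u,v)\le\theta L$,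 every causal path from $u$ to $v$ has length at most $c_P\,d(u,v)$; moreover $|\mathrm{St}_k(v)|\le s$ for every vertex $v$, and $|\Delta_0(\mathcal L)|\le C L^a$ with constants $C$, $a\in\mathbb N$. *Code and decoder.* Place a qubit on every $k$-simplex of $\mathcal L$ (toric code of type $k$); a set $\epsilon\subseteq\Delta_k(\mathcal L)$ of phase flips has syndrome $\partial_k\epsilon$ and is trivial iff it lies in $\operatorname{im}\partial_{k+1}$. A vertex $v$ is trailing for $\sigma\in\operatorname{im}\partial_k$ if $\emptyset\ne\sigma|_v\subset{\uparrow}v$. A Sweep Rule chooses, for every trailing vertex $v$, as a function of $v$ and $\sigma|_v$, a set $\varphi(v)\subseteq\mathrm{St}_k(v)\cap{\uparrow}v$ with $(\partial_k\varphi(v))|_v=\sigma|_v$ and $\Diamond(\partial_k\varphi(v))=\Diamond(\sigma|_v)$. The Sweep Decoder, on input $\sigma^{(1)}=\partial_k\epsilon$, computes $\rho^{(T)}=\sum_{v\text{ trailing for }\sigma^{(T)}}\varphi(v)$ and $\sigma^{(T+1)}=\sigma^{(T)}+\partial_k\rho^{(T)}$ until $\sigma^{(T)}=0$, and returns $\rho=\sum_{i<T}\rho^{(i)}$;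 it fails if $\sigma^{(T)}\ne0$ for all $T\le T_{\max}$, or if $\rho+\epsilon\notin\operatorname{im}\partial_{k+1}$. *Claim.* Put $$Q=6c_Dc_P,\qquad \lambda=(2Q)^dc_B,\qquad \beta=\log_Q2,\qquad p^*_{\rm th}=\bigl(\lambda^2 s\bigr)^{-1}.$$ Then $p^*_{\rm th}>0$ and $\beta>0$, and there is a constant $\alpha>0$ depending only on $d,k,\theta,c_B,c_D,c_P,s$ such that the following holds for every choice of Sweep Rules and every running time $T_{\max}\ge c_Dc_PQ^{m^*-1}+1$, $m^*=\lceil\log_Q(L/c_D)\rceil$ (a bound of order $L$). If every qubit independently suffers a phase flip with probability $p$, $0\le p<p^*_{\rm th}$, and the syndrome is extracted perfectly, then for every lattice in the sequence $$\Pr(\text{the Sweep Decoder fails})\le\lambda^{-2}\,C L^a\left(\frac{p}{p^*_{\rm th}}\right)^{\alpha L^\beta},$$ and the failure probability tends to zero as $L\to\infty$. -/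

import Mathlib

open scoped Topology

noncomputable section

namespace Sweep

/-- Euclidean space `ℝ^d`. -/
abbrev Euc (d : ℕ) : Type := EuclideanSpace ℝ (Fin d)

/-- The translate `s + a` of a finite set of points. -/
def translate {d : ℕ} (a : Euc d) (s : Finset (Euc d)) : Finset (Euc d) :=
  s.map (addRightEmbedding a)

/-- A `d`-dimensional lattice built of simplices on the torus `ℝ^d / Λ`, given by its universal
cover: a triangulation of `ℝ^d` all of whose simplices are faces of `d`-simplices, which is invariant
under the full-rank discrete group `Λ` of translations and has finitely many simplices modulo `Λ`.
A simplex is given by the finite set of its vertices. -/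
structure TorusLattice (d : ℕ) where
  /-- the triangulation of the universal cover `ℝ^d` -/
  cover : Geometry.SimplicialComplex ℝ (Euc d)
  /-- the group `Λ` of periods of the torus -/
  period : Submodule ℤ (Euc d)
  discrete : DiscreteTopology period
  isZLattice : IsZLattice ℝ period
  space_eq : cover.space = Set.univ
  pure : ∀ s ∈ cover.faces, ∃ s' ∈ cover.faces, s ⊆ s' ∧ s'.card = d + 1
  periodic : ∀ a ∈ period, ∀ s ∈ cover.faces, translate a s ∈ cover.faces
  finite_mod : ∃ F : Finset (Finset (Euc d)), ∀ s ∈ cover.faces,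
    ∃ s' ∈ F, ∃ a ∈ period, s = translate a s'

namespace TorusLattice

variable {d : ℕ} (X : TorusLattice d)

/-! ### Simplices of the cover and of the torus -/

/-- The `k`-simplices of the universal cover. -/
def CoverCell (k : ℕ) : Type := {s : Finset (Euc d) // s ∈ X.cover.faces ∧ s.card = k + 1}

/-- Two simplices of the cover lie over the same simplex of the torus iff they differ by a period. -/
def cellSetoid (k : ℕ) : Setoid (X.CoverCell k) where
  r s s' := ∃ a ∈ X.period, s'.1 = translate a s.1
  iseqv := by
    refine ⟨fun s => ⟨0, X.period.zero_mem, ?_⟩, ?_, ?_⟩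
    · ext x; simp [translate]
    · rintro s s' ⟨a, ha, h⟩
      refine ⟨-a, X.period.neg_mem ha, ?_⟩
      rw [h]; ext x; simp [translate]
    · rintro s s' s'' ⟨a, ha, h⟩ ⟨b, hb, h'⟩
      refine ⟨a + b, X.period.add_mem ha hb, ?_⟩
      rw [h', h]; ext x; simp [translate, add_assoc]

/-- The set `Δ_k` of `k`-simplices of the lattice on the torus. -/
def Cell (k : ℕ) : Type := Quotient (X.cellSetoid k)

/-- The simplex of the torus below a simplex of the cover. -/
def proj {k : ℕ} (s : X.CoverCell k) : X.Cell k := Quotient.mk (X.cellSetoid k) s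

/-- A lift of a simplex of the torus to the cover. All lifts differ by periods, and nothing below
depends on which of them is taken. -/
def lift {k : ℕ} (c : X.Cell k) : X.CoverCell k := Quotient.out c

instance finite_cell (k : ℕ) : Finite (X.Cell k) := by
  classical
  obtain ⟨F, hF⟩ := X.finite_mod
  choose f hf g hg h using fun c : X.Cell k => hF (X.lift c).1 (X.lift c).2.1
  refine Finite.of_injective (fun c => (⟨f c, hf c⟩ : F)) fun c c' hcc => ?_
  have hcc : f c = f c' := congrArg Subtype.val hcc
  have hr : (X.cellSetoid k).r (X.lift c) (X.lift c') := by
    refine ⟨g c' - g c, X.period.sub_mem (hg c') (hg c), ?_⟩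
    rw [h c', h c, hcc]; ext x; simp [translate]
  have hq : Quotient.mk (X.cellSetoid k) (X.lift c) = Quotient.mk (X.cellSetoid k) (X.lift c') :=
    Quotient.sound hr
  exact (Quotient.out_eq (s := X.cellSetoid k) c).symm.trans
    (hq.trans (Quotient.out_eq (s := X.cellSetoid k) c'))

instance fintype_cell (k : ℕ) : Fintype (X.Cell k) := Fintype.ofFinite _

/-- The vertex of a `0`-simplex. -/
def point (s : X.CoverCell 0) : Euc d := (Finset.card_eq_one.mp s.2.2).choose

/-! ### Chains -/

/-- The `𝔽₂`-vector space `C_k` with basis `Δ_k`. -/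
abbrev Chain (k : ℕ) : Type := X.Cell k →₀ ZMod 2

/-- An `l`-simplex contained in the simplex `κ`: a subset of `l + 1` of its vertices. -/
def subface {k l : ℕ} (κ : X.CoverCell k) (ν : {ν // ν ∈ κ.1.powersetCard (l + 1)}) :
    X.CoverCell l :=
  ⟨ν.1, X.cover.down_closed κ.2.1 (Finset.mem_powersetCard.mp ν.2).1
    (Finset.card_pos.mp (by rw [(Finset.mem_powersetCard.mp ν.2).2]; omega)),
    (Finset.mem_powersetCard.mp ν.2).2⟩

/-- The linear map `C_k → C_l` that sends `κ` to the sum of the `l`-simplices contained in `κ`.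
The boundary operator is `∂_k = bdry k (k - 1)`. -/
def bdry (k l : ℕ) : X.Chain k →ₗ[ZMod 2] X.Chain l :=
  Finsupp.linearCombination (ZMod 2) fun κ : X.Cell k =>
    ∑ ν ∈ ((X.lift κ).1.powersetCard (l + 1)).attach,
      Finsupp.single (X.proj (X.subface (X.lift κ) ν)) 1

/-- The chain of a set of simplices. -/
def chainOf {k : ℕ} (ε : Finset (X.Cell k)) : X.Chain k := ∑ κ ∈ ε, Finsupp.single κ 1

/-! ### Distances -/

/-- The graph of vertices and edges of the cover. -/
def skeleton : SimpleGraph (Euc d) where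
  Adj x y := x ≠ y ∧ ∃ s ∈ X.cover.faces, s.card = 2 ∧ x ∈ s ∧ y ∈ s
  symm := ⟨by
    rintro x y ⟨h, s, hs, h2, hx, hy⟩
    exact ⟨h.symm, s, hs, h2, hy, hx⟩⟩
  loopless := ⟨fun _ h => h.1 rfl⟩

/-- The length of a shortest path between two vertices. -/
def vdist (x y : Euc d) : ℕ := X.skeleton.dist x y

/-- The diameter of a finite set of vertices. -/
def diam (V : Finset (Euc d)) : ℕ := (V ×ˢ V).sup fun q => X.vdist q.1 q.2

/-- The linear size `L`: the length of a shortest non-contractible closed path in the lattice on the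
torus, that is, of a shortest path in the cover from a vertex to one of its translates by a non-zero
period. -/
def linearSize : ℕ :=
  sInf {n | ∃ x ∈ X.cover.vertices, ∃ a ∈ X.period, a ≠ 0 ∧
    ∃ w : X.skeleton.Walk x (x + a), w.length = n}

/-- `V` is a non-empty finite set of vertices in a local region: its diameter is at most the fraction
`θ` of the linear size. -/
def IsLocal (θ : ℝ) (V : Finset (Euc d)) : Prop :=
  V.Nonempty ∧ (V : Set (Euc d)) ⊆ X.cover.vertices ∧ (X.diam V : ℝ) ≤ θ * X.linearSize

/-! ### Causal structure -/

/-- `t` is a sweep direction: a unit vector that is not perpendicular to any edge. -/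
def IsSweepDirection (t : Euc d) : Prop :=
  ‖t‖ = 1 ∧ ∀ x y, X.skeleton.Adj x y → inner ℝ t (y - x) ≠ 0

/-- There is a causal path of length `n` from `x` up to `y`: every edge of it has positive inner
product with the sweep direction `t`. -/
inductive CausalPath (t : Euc d) : Euc d → Euc d → ℕ → Prop
  | nil (x : Euc d) (hx : x ∈ X.cover.vertices) : CausalPath t x x 0
  | cons (x y z : Euc d) (n : ℕ) (hxy : X.skeleton.Adj x y) (ht : 0 < inner ℝ t (y - x))
      (h : CausalPath t y z n) : CausalPath t x z (n + 1)

/-- `x ⪯ y` -/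
def Prec (t x y : Euc d) : Prop := ∃ n, X.CausalPath t x y n

/-- `a` is the infimum of `V` in the set of vertices ordered by `⪯`. -/
def IsInf (t : Euc d) (V : Set (Euc d)) (a : Euc d) : Prop :=
  a ∈ X.cover.vertices ∧ (∀ v ∈ V, X.Prec t a v) ∧
    ∀ w ∈ X.cover.vertices, (∀ v ∈ V, X.Prec t w v) → X.Prec t w a

/-- `b` is the supremum of `V` in the set of vertices ordered by `⪯`. -/
def IsSup (t : Euc d) (V : Set (Euc d)) (b : Euc d) : Prop :=
  b ∈ X.cover.vertices ∧ (∀ v ∈ V, X.Prec t v b) ∧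
    ∀ w ∈ X.cover.vertices, (∀ v ∈ V, X.Prec t v w) → X.Prec t b w

/-- The future of a vertex. -/
def future (t x : Euc d) : Set (Finset (Euc d)) :=
  {s | s ∈ X.cover.faces ∧ ∀ y ∈ s, X.Prec t x y}

/-- The past of a vertex. -/
def past (t x : Euc d) : Set (Finset (Euc d)) :=
  {s | s ∈ X.cover.faces ∧ ∀ y ∈ s, X.Prec t y x}

/-- The causal diamond `◇V`: the intersection of the future of `inf V` and the past of `sup V`. -/
def diamond (t : Euc d) (V : Set (Euc d)) : Set (Finset (Euc d)) :=
  {s | ∃ a b, X.IsInf t V a ∧ X.IsSup t V b ∧ s ∈ X.future t a ∩ X.past t b}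

/-! ### Domain walls near a vertex of the cover -/

/-- The vertices of a set of simplices. -/
def verts {k : ℕ} (S : Set (X.CoverCell k)) : Set (Euc d) := {x | ∃ s ∈ S, x ∈ s.1}

/-- The restriction `σ|_x` of a chain on the torus to the simplices that contain `x`, as a set of
simplices of the cover. -/
def restr {l : ℕ} (σ : X.Chain l) (x : Euc d) : Set (X.CoverCell l) :=
  {ν | x ∈ ν.1 ∧ σ (X.proj ν) ≠ 0}

/-- The boundary (mod 2) of a finite set of simplices of the cover, as a set of `l`-simplices; here
`φ` consists of `k`-simplices with `k = l + 1`. -/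
def coverBdry {k : ℕ} (l : ℕ) (φ : Finset (X.CoverCell k)) : Set (X.CoverCell l) :=
  {ν | Odd {κ : X.CoverCell k | κ ∈ φ ∧ ν.1 ⊆ κ.1}.ncard}

/-- `x` is trailing for the domain wall `σ`: `σ|_x` is non-empty and in the future of `x`. -/
def Trailing (t : Euc d) {l : ℕ} (σ : X.Chain l) (x : Euc d) : Prop :=
  (X.restr σ x).Nonempty ∧ ∀ ν ∈ X.restr σ x, ν.1 ∈ X.future t x

/-! ### Causal, locally Euclidean lattices -/

/-- The conditions on a causal, locally Euclidean lattice with sweep direction `t`, for domain walls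
of dimension `k - 1`, where local regions have diameter at most `θ L`. -/
structure IsCausal (t : Euc d) (k : ℕ) (θ cB cD cP : ℝ) : Prop where
  sweep : X.IsSweepDirection t
  /-- sets of vertices in a local region have a causal diamond -/
  exists_diamond : ∀ V : Finset (Euc d), X.IsLocal θ V →
    (∃ a, X.IsInf t V a) ∧ ∃ b, X.IsSup t V b
  /-- domain walls can be pushed away from a trailing vertex -/
  exists_push : ∀ x ∈ X.cover.vertices, ∀ σ ∈ LinearMap.range (X.bdry k (k - 1)),
    X.Trailing t σ x → ∃ φ : Finset (X.CoverCell k),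
      (∀ κ ∈ φ, x ∈ κ.1 ∧ κ.1 ∈ X.future t x) ∧
      {ν ∈ X.coverBdry (k - 1) φ | x ∈ ν.1} = X.restr σ x ∧
      X.diamond t (X.verts (φ : Set (X.CoverCell k))) = X.diamond t (X.verts (X.restr σ x))
  /-- a ball of radius `R` is covered by `cB (R / r) ^ d` balls of radius `r` -/
  ball_cover : ∀ v ∈ X.cover.vertices, ∀ r R : ℝ, 0 < r → r < R → R ≤ θ * X.linearSize →
    ∃ U : Finset (Euc d), (U : Set (Euc d)) ⊆ X.cover.vertices ∧ (U.card : ℝ) ≤ cB * (R / r) ^ d ∧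
      ∀ s ∈ X.cover.faces, (∃ y ∈ s, (X.vdist v y : ℝ) < R) →
        ∃ u ∈ U, ∃ y ∈ s, (X.vdist u y : ℝ) < r
  /-- `diam ◇V ≤ cD diam V` -/
  diam_diamond : ∀ V : Finset (Euc d), X.IsLocal θ V →
    ∀ s ∈ X.diamond t V, ∀ s' ∈ X.diamond t V, ∀ y ∈ s, ∀ y' ∈ s',
      (X.vdist y y' : ℝ) ≤ cD * X.diam V
  /-- causal paths between two vertices are not longer than `cP` times their distance -/
  path_length : ∀ x y, (X.vdist x y : ℝ) ≤ θ * X.linearSize →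
    ∀ n, X.CausalPath t x y n → (n : ℝ) ≤ cP * X.vdist x y

/-! ### The Sweep Rule and the Sweep Decoder -/

/-- A Sweep Rule of type `k`: a choice, for every vertex `v` of the torus and every restriction
`σ|_v` of a domain wall for which `v` is trailing, of a set `φ(v)` of `k`-simplices in the star and the
future of `v` such that `(∂φ(v))|_v = σ|_v` and `◇(∂φ(v)) = ◇(σ|_v)`. The neighbourhood of `v` is
described in the cover, at the lift of `v`. -/
structure SweepRule (t : Euc d) (k : ℕ) where
  φ : X.Cell 0 → Set (X.CoverCell (k - 1)) → Finset (X.CoverCell k)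
  star : ∀ σ ∈ LinearMap.range (X.bdry k (k - 1)), ∀ v : X.Cell 0,
    X.Trailing t σ (X.point (X.lift v)) →
      ∀ κ ∈ φ v (X.restr σ (X.point (X.lift v))),
        X.point (X.lift v) ∈ κ.1 ∧ κ.1 ∈ X.future t (X.point (X.lift v))
  bdry_eq : ∀ σ ∈ LinearMap.range (X.bdry k (k - 1)), ∀ v : X.Cell 0,
    X.Trailing t σ (X.point (X.lift v)) →
      {ν ∈ X.coverBdry (k - 1) (φ v (X.restr σ (X.point (X.lift v)))) |
        X.point (X.lift v) ∈ ν.1} = X.restr σ (X.point (X.lift v))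
  diamond_eq : ∀ σ ∈ LinearMap.range (X.bdry k (k - 1)), ∀ v : X.Cell 0,
    X.Trailing t σ (X.point (X.lift v)) →
      X.diamond t (X.verts (X.coverBdry (k - 1) (φ v (X.restr σ (X.point (X.lift v)))))) =
        X.diamond t (X.verts (X.restr σ (X.point (X.lift v))))

variable {X} {t : Euc d} {k : ℕ}

open Classical in
/-- One simultaneous application of the rule to all vertices: the sum of `φ(v)` over all trailing
vertices `v`. -/
def SweepRule.step (S : X.SweepRule t k) (σ : X.Chain (k - 1)) : X.Chain k :=
  ∑ v : X.Cell 0, if X.Trailing t σ (X.point (X.lift v)) then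
    ∑ κ ∈ S.φ v (X.restr σ (X.point (X.lift v))), Finsupp.single (X.proj κ) 1 else 0

open Classical in
/-- The loop of the Sweep Decoder. The first argument is the number `Tmax + 1 - T` of time steps that
are left, then come the current domain wall `σ^(T)` and the sum of `ρ^(i)` over `i < T`. The value
`none` means that the decoder did not terminate in time. -/
def SweepRule.loop (S : X.SweepRule t k) : ℕ → X.Chain (k - 1) → X.Chain k → Option (X.Chain k)
  | 0, _, _ => none
  | n + 1, σ, ρ =>
    if σ = 0 then some ρ else S.loop n (σ + X.bdry k (k - 1) (S.step σ)) (ρ + S.step σ)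

/-- The Sweep Decoder: the correction computed from the syndrome `σ`. -/
def SweepRule.decode (S : X.SweepRule t k) (Tmax : ℕ) (σ : X.Chain (k - 1)) :
    Option (X.Chain k) :=
  S.loop Tmax σ 0

/-- The decoder corrects the error `ε`: it terminates in time and the correction combined with the
error is a stabilizer, i.e. an element of `im ∂_{k+1}`. -/
def SweepRule.Succeeds (S : X.SweepRule t k) (Tmax : ℕ) (ε : Finset (X.Cell k)) : Prop :=
  ∃ ρ, S.decode Tmax (X.bdry k (k - 1) (X.chainOf ε)) = some ρ ∧
    ρ + X.chainOf ε ∈ LinearMap.range (X.bdry (k + 1) k)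

open Classical in
/-- The failure probability of the Sweep Decoder if every qubit (every `k`-simplex) is independently
affected by a phase flip with probability `p`. -/
def SweepRule.failProb (S : X.SweepRule t k) (Tmax : ℕ) (p : ℝ) : ℝ :=
  ∑ ε : Finset (X.Cell k), if S.Succeeds Tmax ε then 0 else
    p ^ ε.card * (1 - p) ^ (Fintype.card (X.Cell k) - ε.card)

end TorusLattice

/-! ### Constants -/

/-- `Q = 6 cD cP` -/
def Q (cD cP : ℝ) : ℝ := 6 * cD * cP

/-- `λ = (2 Q) ^ d cB` -/
def lam (d : ℕ) (cB cD cP : ℝ) : ℝ := (2 * Q cD cP) ^ d * cB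

/-- The lower bound on the threshold, where `s` bounds the number of `k`-simplices at a vertex. -/
def pth (d : ℕ) (cB cD cP : ℝ) (s : ℕ) : ℝ := (lam d cB cD cP ^ 2 * s)⁻¹

/-- `β = log_Q 2` -/
def beta (cD cP : ℝ) : ℝ := Real.logb (Q cD cP) 2

/-- The running time `cD cP Q ^ (m - 1) + 1` with `m = ⌈log_Q (L / cD)⌉`; it is of order `L`. -/
def runTime (cD cP : ℝ) (L : ℕ) : ℝ :=
  cD * cP * Q cD cP ^ (⌈Real.logb (Q cD cP) (L / cD)⌉ - 1) + 1

end Sweep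

end

noncomputable section

namespace Sweep

/-! ### Translates of finite sets of points -/

namespace TorusLattice

variable {d : ℕ} (X : TorusLattice d)

/-! The noise is handled by renormalisation, the decoder by a light-cone argument.

Noise. Sort the flipped simplices by scale: one is isolated at scale `n` if the surviving ones near
it form a set of diameter about `Q ^ n` with a gap of order `Q ^ (n + 1)` around it. Remove isolated
simplices scale by scale. A simplex surviving scale `n` sees two disjoint chunks of level `n`, so by
induction it is close to a chunk of level `n + 1`, a binary tree of `2 ^ (n + 1)` flips
(`exists_chunk_of_mem_stage`). Hence an error without chunks of level `m` splits into clusters of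
levels below `m`, each far, on its own scale, from those of the same or a higher level
(`exists_clusters`).

One cluster. A push creates nothing outside the diamond of what it removes (`SweepRule.between`), so
the wall stays in translates of the diamond of the cluster. After `n` steps each wall vertex ends a
causal path of length at least `n` from the infimum: it lies strictly after a swept vertex or has a
predecessor in the old wall (`Region.Confined.next`). Such paths are bounded by the diamond, so the
wall dies (`Region.Confined.time_le`). Correction plus error is then a cycle in a part of the torus
that lifts injectively to `ℝ^d`, hence a boundary (`mem_range_bdry_of_local`). Acyclicity of the
cover (`exists_filling`) comes from comparing simplicial chains with small tuples of points in a
ball, which is convex.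

Many clusters. Walls spread by one edge per step and die in time proportional to their diamond, so
the gaps keep them apart and they evolve independently (`SweepRule.wall_corr_sum`,
`SweepRule.succeeds_of_clusters`).

Probability. Failure forces a chunk of level `m`, where `Q ^ m` is of order `L`. Covering a ball by
`λ` smaller ones gives at most `λ⁻² (λ² s) ^ (2 ^ m)` chunks per vertex (`card_chunks_meeting_le`),
each present with probability `p ^ (2 ^ m)`. The union bound gives `(p / pth) ^ (2 ^ m)`, and `2 ^
m` is of order `L ^ β` since `Q ^ β = 2` (`exists_level`). -/

theorem mem_translate {a x : Euc d} {s : Finset (Euc d)} :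
    x ∈ translate a s ↔ x - a ∈ s := by
  simp only [translate, Finset.mem_map, addRightEmbedding_apply]
  constructor
  · rintro ⟨y, hy, rfl⟩; simpa using hy
  · intro h; exact ⟨x - a, h, by simp⟩

theorem add_mem_translate {a x : Euc d} {s : Finset (Euc d)} (h : x ∈ s) :
    x + a ∈ translate a s := by
  rw [mem_translate]; simpa using h

theorem card_translate (a : Euc d) (s : Finset (Euc d)) : (translate a s).card = s.card :=
  Finset.card_map _

theorem translate_zero (s : Finset (Euc d)) : translate 0 s = s := by
  ext x; simp [mem_translate]

theorem translate_translate (a b : Euc d) (s : Finset (Euc d)) :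
    translate a (translate b s) = translate (b + a) s := by
  ext x; simp only [mem_translate]; rw [show x - a - b = x - (b + a) by abel]

theorem translate_subset {a : Euc d} {s s' : Finset (Euc d)} (h : s ⊆ s') :
    translate a s ⊆ translate a s' := fun x hx => by
  rw [mem_translate] at *; exact h hx

/-! ### Local finiteness of the triangulation -/

open scoped Pointwise in
/-- Only finitely many simplices meet a bounded set. -/
theorem finite_faces_meeting {B : Set (Euc d)} (hB : Bornology.IsBounded B) :
    {s ∈ X.cover.faces | (convexHull ℝ (s : Set (Euc d)) ∩ B).Nonempty}.Finite := by
  obtain ⟨F, hF⟩ := X.finite_mod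
  have hC : Bornology.IsBounded (⋃ s ∈ F, convexHull ℝ (s : Set (Euc d))) :=
    (Bornology.isBounded_biUnion F.finite_toSet).2 fun s _ =>
      isBounded_convexHull.2 s.finite_toSet.isBounded
  have := X.discrete
  -- If the translate of a simplex of `F` by `a` meets `B`, then `a` is a difference of a point of
  -- `B` and a point of that simplex. A discrete subgroup is closed, so a bounded set contains
  -- finitely many such periods.
  have hP : ((X.period : Set (Euc d)) ∩ (B - ⋃ s ∈ F, convexHull ℝ (s : Set (Euc d)))).Finite := by
    rw [Set.inter_comm]
    refine Metric.finite_isBounded_inter_isClosed DiscreteTopology.isDiscrete (hB.sub hC) ?_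
    exact AddSubgroup.isClosed_of_discrete (H := X.period.toAddSubgroup)
  refine ((hP.prod F.finite_toSet).image fun q => translate q.1 q.2).subset ?_
  rintro s ⟨hs, y, hy, hyB⟩
  obtain ⟨s', hs', a, ha, rfl⟩ := hF s hs
  refine ⟨(a, s'), ⟨⟨ha, ?_⟩, hs'⟩, rfl⟩
  have himg : ((translate a s' : Finset (Euc d)) : Set (Euc d)) = {a} + (s' : Set (Euc d)) := by
    ext x
    rw [Finset.mem_coe, mem_translate, Set.singleton_add]
    constructor
    · intro h; exact ⟨x - a, h, by simp⟩
    · rintro ⟨z, hz, rfl⟩; simpa using hz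
  rw [himg, convexHull_add, convexHull_singleton, Set.singleton_add] at hy
  obtain ⟨c, hc, rfl⟩ := hy
  exact ⟨a + c, hyB, c, Set.mem_biUnion hs' hc, by simp⟩

/-- The simplices that contain a point sufficiently close to `x` contain `x`. -/
theorem exists_local_radius (x : Euc d) : ∃ ε > 0, ∀ y, dist y x < ε → ∀ s ∈ X.cover.faces,
    y ∈ convexHull ℝ (s : Set (Euc d)) → x ∈ convexHull ℝ (s : Set (Euc d)) := by
  have hfin := X.finite_faces_meeting (B := Metric.ball x 1) Metric.isBounded_ball
  have hfin' := hfin.subset (Set.sep_subset {s ∈ X.cover.faces |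
    (convexHull ℝ (s : Set (Euc d)) ∩ Metric.ball x 1).Nonempty}
    fun s => x ∉ convexHull ℝ (s : Set (Euc d)))
  -- Finitely many closed hulls near `x` miss `x`, so a whole neighbourhood of `x` misses them.
  have hev : ∀ᶠ y in 𝓝 x, ∀ s ∈ {s ∈ {s ∈ X.cover.faces |
      (convexHull ℝ (s : Set (Euc d)) ∩ Metric.ball x 1).Nonempty} |
      x ∉ convexHull ℝ (s : Set (Euc d))}, y ∉ convexHull ℝ (s : Set (Euc d)) := by
    rw [Filter.eventually_all_finite hfin']
    intro s hs
    have hc : IsClosed (convexHull ℝ (s : Set (Euc d))) :=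
      (s.finite_toSet.isCompact_convexHull (𝕜 := ℝ)).isClosed
    exact hc.isOpen_compl.mem_nhds hs.2
  obtain ⟨ε, hε, h⟩ := Metric.eventually_nhds_iff.1 hev
  refine ⟨min ε 1, lt_min hε one_pos, fun y hy s hs hys => ?_⟩
  by_contra hx
  exact h (hy.trans_le (min_le_left _ _)) s
    ⟨⟨hs, y, hys, Metric.mem_ball.2 (hy.trans_le (min_le_right _ _))⟩, hx⟩ hys

/-- The carrier of a point has a vertex, which is a vertex of all simplices containing the point. -/
theorem exists_carrier_vertex (x : Euc d) : ∃ v ∈ X.cover.vertices, ∀ s ∈ X.cover.faces,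
    x ∈ convexHull ℝ (s : Set (Euc d)) → v ∈ s := by
  classical
  have hx : x ∈ X.cover.space := by rw [X.space_eq]; trivial
  obtain ⟨s₀, hs₀, hx₀⟩ := Geometry.SimplicialComplex.mem_space_iff.1 hx
  have hne : {n | ∃ s ∈ X.cover.faces, x ∈ convexHull ℝ (s : Set (Euc d)) ∧ s.card = n}.Nonempty :=
    ⟨_, s₀, hs₀, hx₀, rfl⟩
  -- Take a simplex containing `x` with the fewest vertices. Two simplices meet in the hull of their
  -- common vertices, so minimality puts this one inside every other simplex containing `x`.
  obtain ⟨s, hs, hxs, hcard⟩ := Nat.sInf_mem hne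
  obtain ⟨v, hv⟩ := X.cover.nonempty_of_mem_faces hs
  refine ⟨v, X.cover.down_closed hs (Finset.singleton_subset_iff.2 hv) (by simp), ?_⟩
  intro s' hs' hxs'
  have h := X.cover.inter_subset_convexHull hs hs' ⟨hxs, hxs'⟩
  rw [← Finset.coe_inter] at h
  have hne' : (s ∩ s').Nonempty := by
    rw [Finset.nonempty_iff_ne_empty]; rintro h0; rw [h0] at h; simp at h
  have hle : s.card ≤ (s ∩ s').card := by
    rw [hcard]
    exact Nat.sInf_le ⟨_, X.cover.down_closed hs Finset.inter_subset_left hne', h, rfl⟩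
  have heq := Finset.eq_of_subset_of_card_le Finset.inter_subset_left hle
  rw [← heq] at hv
  exact (Finset.mem_inter.1 hv).2

/-- A simplicial approximation of the identity on a compact set: points are sent to vertices, and
the image of a point is a vertex of all simplices that meet a small neighbourhood of the point. -/
theorem exists_approx {B : Set (Euc d)} (hB : IsCompact B) :
    ∃ δ > 0, ∃ φ : Euc d → Euc d, ∀ x ∈ B, ∀ y, dist y x < δ → ∀ s ∈ X.cover.faces,
      y ∈ convexHull ℝ (s : Set (Euc d)) → φ x ∈ s := by
  choose ε hε h using X.exists_local_radius
  choose v _ hv using X.exists_carrier_vertex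
  -- The radii of `exists_local_radius` are not uniform. The Lebesgue number makes them so, at the
  -- price of using the carrier vertex of a nearby centre `c x` instead of that of `x`.
  obtain ⟨δ, hδ, hl⟩ := lebesgue_number_lemma_of_metric (c := fun x => Metric.ball x (ε x)) hB
    (fun x => Metric.isOpen_ball)
    (fun x _ => Set.mem_iUnion.2 ⟨x, Metric.mem_ball_self (hε x)⟩)
  choose! c hc using hl
  refine ⟨δ, hδ, fun x => v (c x), fun x hx y hy s hs hys => hv _ s hs ?_⟩
  exact h (c x) y (Metric.mem_ball.1 (hc x hx (Metric.mem_ball.2 hy))) s hs hys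

/-! ### Connectedness of the skeleton -/

theorem mem_vertices_of_mem {s : Finset (Euc d)} (hs : s ∈ X.cover.faces) {x : Euc d}
    (hx : x ∈ s) : x ∈ X.cover.vertices :=
  X.cover.down_closed hs (Finset.singleton_subset_iff.2 hx) (by simp)

theorem adj_of_mem {s : Finset (Euc d)} (hs : s ∈ X.cover.faces) {x y : Euc d} (hx : x ∈ s)
    (hy : y ∈ s) (hxy : x ≠ y) : X.skeleton.Adj x y := by
  classical
  refine ⟨hxy, {x, y}, X.cover.down_closed hs ?_ (by simp), Finset.card_pair hxy, by simp, by simp⟩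
  intro z hz
  simp only [Finset.mem_insert, Finset.mem_singleton] at hz
  rcases hz with rfl | rfl <;> assumption

theorem reachable_of_mem {s : Finset (Euc d)} (hs : s ∈ X.cover.faces) {x y : Euc d} (hx : x ∈ s)
    (hy : y ∈ s) : X.skeleton.Reachable x y := by
  by_cases h : x = y
  · rw [h]
  · exact (X.adj_of_mem hs hx hy h).reachable

/-- The component of the carrier vertex of a point is locally constant in the point, and `ℝ^d` is
connected. -/
theorem reachable {x y : Euc d} (hx : x ∈ X.cover.vertices) (hy : y ∈ X.cover.vertices) :
    X.skeleton.Reachable x y := by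
  choose v hv hvs using X.exists_carrier_vertex
  have hloc : IsLocallyConstant fun z => X.skeleton.connectedComponentMk (v z) := by
    rw [IsLocallyConstant.iff_eventually_eq]
    intro z
    obtain ⟨ε, hε, h⟩ := X.exists_local_radius z
    refine Metric.eventually_nhds_iff.2 ⟨ε, hε, fun z' hz' => ?_⟩
    obtain ⟨s, hs, hzs⟩ := Geometry.SimplicialComplex.mem_space_iff.1
      (show z' ∈ X.cover.space by rw [X.space_eq]; trivial)
    exact SimpleGraph.ConnectedComponent.sound
      (X.reachable_of_mem hs (hvs z' s hs hzs) (hvs z s hs (h z' hz' s hs hzs)))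
  have hvx : ∀ x ∈ X.cover.vertices, v x = x := fun x hx => by
    have := hvs x {x} hx (subset_convexHull ℝ _ (by simp))
    simpa using this
  have := hloc.apply_eq_of_preconnectedSpace x y
  simp only [hvx x hx, hvx y hy] at this
  exact SimpleGraph.ConnectedComponent.exact this

end TorusLattice

/-! ### Chains of ordered tuples and of finite sets, mod 2 -/

section Chains

variable {P P' : Type*}

theorem add_self_zmod_two {M : Type*} [AddCommGroup M] [Module (ZMod 2) M] (x : M) : x + x = 0 := by
  rw [← two_smul (ZMod 2) x, show (2 : ZMod 2) = 0 from rfl, zero_smul]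

/-- Linear extension of a function on the basis. -/
abbrev ext2 {ι M : Type*} [AddCommGroup M] [Module (ZMod 2) M] (f : ι → M) :
    (ι →₀ ZMod 2) →ₗ[ZMod 2] M := Finsupp.linearCombination (ZMod 2) f

theorem ext2_single {ι M : Type*} [AddCommGroup M] [Module (ZMod 2) M] (f : ι → M) (i : ι) :
    ext2 f (Finsupp.single i 1) = f i := by
  simp [ext2]

theorem linearMap_ext2 {ι M : Type*} [AddCommGroup M] [Module (ZMod 2) M]
    {f g : (ι →₀ ZMod 2) →ₗ[ZMod 2] M}
    (h : ∀ i, f (Finsupp.single i 1) = g (Finsupp.single i 1)) : f = g :=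
  Finsupp.lhom_ext' fun i => LinearMap.ext_ring (h i)

/-- A linear map sends chains supported in `A` to a submodule if it does so on the basis. -/
theorem map_mem_of_supported {ι M : Type*} [AddCommGroup M] [Module (ZMod 2) M] {A : Set ι}
    (f : (ι →₀ ZMod 2) →ₗ[ZMod 2] M) {N : Submodule (ZMod 2) M}
    (h : ∀ i ∈ A, f (Finsupp.single i 1) ∈ N) {c : ι →₀ ZMod 2}
    (hc : c ∈ Finsupp.supported (ZMod 2) (ZMod 2) A) : f c ∈ N := by
  rw [Finsupp.supported_eq_span_single] at hc
  have : Submodule.span (ZMod 2) ((fun i => Finsupp.single i (1 : ZMod 2)) '' A) ≤ N.comap f := by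
    rw [Submodule.span_le]; rintro _ ⟨i, hi, rfl⟩; exact h i hi
  exact this hc

theorem single_mem_supported {ι : Type*} {A : Set ι} {i : ι} (hi : i ∈ A) :
    Finsupp.single i (1 : ZMod 2) ∈ Finsupp.supported (ZMod 2) (ZMod 2) A :=
  Finsupp.single_mem_supported _ _ hi

/-- Linear maps that agree on the basis elements of `A` agree on the chains supported in `A`. -/
theorem eq_of_supported {ι M : Type*} [AddCommGroup M] [Module (ZMod 2) M] {A : Set ι}
    (f g : (ι →₀ ZMod 2) →ₗ[ZMod 2] M)
    (h : ∀ i ∈ A, f (Finsupp.single i 1) = g (Finsupp.single i 1)) {c : ι →₀ ZMod 2}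
    (hc : c ∈ Finsupp.supported (ZMod 2) (ZMod 2) A) : f c = g c := by
  have := map_mem_of_supported (N := ⊥) (f - g) (fun i hi => by simp [h i hi]) hc
  simpa [sub_eq_zero] using this

/-- Chains of tuples of points. -/
abbrev TupleChain (P : Type*) : Type _ := List P →₀ ZMod 2

/-- The cone with apex `v`. -/
def cone (v : P) : TupleChain P →ₗ[ZMod 2] TupleChain P := Finsupp.lmapDomain _ _ (List.cons v)

theorem cone_single (v : P) (l : List P) :
    cone v (Finsupp.single l 1) = Finsupp.single (v :: l) 1 := by
  simp [cone, Finsupp.mapDomain_single]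

/-- The (augmented) boundary of a tuple. -/
def tupleBdryAux : List P → TupleChain P
  | [] => 0
  | v :: l => Finsupp.single l 1 + cone v (tupleBdryAux l)

/-- The (augmented) boundary of a chain of tuples. -/
def tupleBdry : TupleChain P →ₗ[ZMod 2] TupleChain P := ext2 tupleBdryAux

theorem tupleBdry_nil : tupleBdry (Finsupp.single ([] : List P) 1) = 0 := by
  rw [tupleBdry, ext2_single]; rfl

theorem tupleBdry_cons (v : P) (l : List P) : tupleBdry (Finsupp.single (v :: l) 1) =
    Finsupp.single l 1 + cone v (tupleBdry (Finsupp.single l 1)) := by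
  rw [tupleBdry, ext2_single, ext2_single]; rfl

/-- Coning is a contracting homotopy. The empty tuple belongs to the complex, so the formula needs
no exception in lowest degree. -/
theorem tupleBdry_cone (v : P) (c : TupleChain P) :
    tupleBdry (cone v c) = c + cone v (tupleBdry c) := by
  have : tupleBdry ∘ₗ cone v = LinearMap.id + cone v ∘ₗ tupleBdry :=
    linearMap_ext2 fun l => by simp [cone_single, tupleBdry_cons]
  exact LinearMap.congr_fun this c

/-- The map of tuple chains induced by a map of points. -/
def tupleMap (f : P → P') : TupleChain P →ₗ[ZMod 2] TupleChain P' :=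
  Finsupp.lmapDomain _ _ (List.map f)

theorem tupleMap_single (f : P → P') (l : List P) :
    tupleMap f (Finsupp.single l 1) = Finsupp.single (l.map f) 1 := by
  simp [tupleMap, Finsupp.mapDomain_single]

theorem tupleMap_cone (f : P → P') (v : P) (c : TupleChain P) :
    tupleMap f (cone v c) = cone (f v) (tupleMap f c) := by
  have : tupleMap f ∘ₗ cone v = cone (f v) ∘ₗ tupleMap f :=
    linearMap_ext2 fun l => by simp [cone_single, tupleMap_single]
  exact LinearMap.congr_fun this c

theorem tupleBdry_tupleMap (f : P → P') (c : TupleChain P) :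
    tupleBdry (tupleMap f c) = tupleMap f (tupleBdry c) := by
  have : tupleBdry ∘ₗ tupleMap f = tupleMap f ∘ₗ tupleBdry := linearMap_ext2 fun l => by
    simp only [LinearMap.comp_apply]
    induction l with
    | nil => simp [tupleMap_single, tupleBdry_nil]
    | cons v l ih =>
      rw [tupleMap_single] at ih
      rw [tupleMap_single, List.map_cons, tupleBdry_cons, tupleBdry_cons, map_add, tupleMap_single,
        tupleMap_cone, ih]
  exact LinearMap.congr_fun this c

/-- The prism over a tuple, between its images under two maps. -/
def prismAux (f g : P → P') : List P → TupleChain P'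
  | [] => 0
  | v :: l => Finsupp.single (f v :: g v :: l.map g) 1 + cone (f v) (prismAux f g l)

/-- The prism operator between two maps. -/
def prism (f g : P → P') : TupleChain P →ₗ[ZMod 2] TupleChain P' := ext2 (prismAux f g)

theorem prism_cons (f g : P → P') (v : P) (l : List P) : prism f g (Finsupp.single (v :: l) 1) =
    Finsupp.single (f v :: g v :: l.map g) 1 + cone (f v) (prism f g (Finsupp.single l 1)) := by
  rw [prism, ext2_single, ext2_single]; rfl

theorem prism_cone (f g : P → P') (v : P) (c : TupleChain P) : prism f g (cone v c) =
    cone (f v) (cone (g v) (tupleMap g c)) + cone (f v) (prism f g c) := by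
  have : prism f g ∘ₗ cone v =
      cone (f v) ∘ₗ cone (g v) ∘ₗ tupleMap g + cone (f v) ∘ₗ prism f g :=
    linearMap_ext2 fun l => by simp [cone_single, prism_cons, tupleMap_single]
  exact LinearMap.congr_fun this c

/-- The prism is a chain homotopy between the maps induced by `f` and `g`: mod 2, the inner faces
occur twice and cancel. -/
theorem tupleBdry_prism (f g : P → P') (c : TupleChain P) :
    tupleBdry (prism f g c) + prism f g (tupleBdry c) = tupleMap f c + tupleMap g c := by
  have : tupleBdry ∘ₗ prism f g + prism f g ∘ₗ tupleBdry = tupleMap f + tupleMap g :=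
    linearMap_ext2 fun l => by
      simp only [LinearMap.comp_apply, LinearMap.add_apply]
      induction l with
      | nil =>
        rw [tupleBdry_nil, map_zero, add_zero, prism, ext2_single, prismAux, map_zero,
          tupleMap_single, tupleMap_single, List.map_nil, List.map_nil, add_self_zmod_two]
      | cons v l ih =>
        have h1 : Finsupp.single (f v :: g v :: l.map g) (1 : ZMod 2) =
            cone (f v) (cone (g v) (tupleMap g (Finsupp.single l 1))) := by
          rw [tupleMap_single, cone_single, cone_single]
        have h2 : Finsupp.single (f v :: l.map f) (1 : ZMod 2) =
          cone (f v) (tupleMap f (Finsupp.single l 1)) := by rw [tupleMap_single, cone_single]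
        have h3 : Finsupp.single (g v :: l.map g) (1 : ZMod 2) =
          cone (g v) (tupleMap g (Finsupp.single l 1)) := by rw [tupleMap_single, cone_single]
        rw [prism_cons, tupleBdry_cons, map_add, map_add, prism_cone, h1, tupleBdry_cone,
          tupleBdry_cone, tupleBdry_cone, tupleMap_single f (v :: l), tupleMap_single g (v :: l),
          List.map_cons, List.map_cons, h2, h3, map_add, tupleBdry_tupleMap]
        have ih' := congrArg (cone (f v)) ih
        simp only [map_add] at ih'
        generalize cone (f v) (cone (g v) ((tupleMap g) (tupleBdry (Finsupp.single l 1)))) = A at *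
        generalize prism f g (Finsupp.single l 1) = B at *
        generalize cone (f v) (tupleMap g (Finsupp.single l 1)) = C at *
        generalize cone (f v) (tupleMap f (Finsupp.single l 1)) = D at *
        generalize cone (g v) (tupleMap g (Finsupp.single l 1)) = E at *
        generalize cone (f v) (prism f g (tupleBdry (Finsupp.single l 1))) = F at *
        have : E + (C + A) + (B + cone (f v) (tupleBdry B)) + (B + (A + F)) =
          (A + A) + (B + B) + E + C + (cone (f v) (tupleBdry B) + F) := by abel
        rw [this, ih', add_self_zmod_two, add_self_zmod_two]
        have : 0 + 0 + E + C + (D + C) = (C + C) + (D + E) := by abel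
        rw [this, add_self_zmod_two, zero_add]
  exact LinearMap.congr_fun this c

/-- The prism over a tuple consists of tuples of images of its points. -/
theorem prism_mem {f g : P → P'} {A : Set (List P')} {l : List P}
    (h : ∀ l' : List P', (∀ x ∈ l', ∃ v ∈ l, x = f v ∨ x = g v) → l' ∈ A) :
    prism f g (Finsupp.single l 1) ∈ Finsupp.supported (ZMod 2) (ZMod 2) A := by
  induction l generalizing A with
  | nil => rw [prism, ext2_single]; exact Submodule.zero_mem _
  | cons v l ih =>
    rw [prism_cons]
    refine Submodule.add_mem _ (single_mem_supported (h _ ?_)) ?_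
    · intro x hx
      simp only [List.mem_cons, List.mem_map] at hx ⊢
      rcases hx with rfl | rfl | ⟨w, hw, rfl⟩
      · exact ⟨v, Or.inl rfl, Or.inl rfl⟩
      · exact ⟨v, Or.inl rfl, Or.inr rfl⟩
      · exact ⟨w, Or.inr hw, Or.inr rfl⟩
    · refine map_mem_of_supported (A := {l' | f v :: l' ∈ A}) (cone (f v)) (fun l' hl' => ?_) (ih ?_)
      · rw [cone_single]; exact single_mem_supported hl'
      · intro l' hl'
        refine h _ fun x hx => ?_
        rcases List.mem_cons.1 hx with rfl | hx
        · exact ⟨v, by simp, Or.inl rfl⟩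
        · obtain ⟨w, hw, h'⟩ := hl' x hx
          exact ⟨w, by simp [hw], h'⟩

/-! ### Small tuples in a convex set -/

/-- Tuples of points of `S` of diameter less than `δ`. -/
def smallTuples {E : Type*} [PseudoMetricSpace E] (δ : ℝ) (S : Set E) : Set (List E) :=
  {l | ∀ x ∈ l, x ∈ S ∧ ∀ y ∈ l, dist x y < δ}

/-- The (augmented) complex of small tuples of points of a non-empty convex set is acyclic. -/
theorem exists_small_filling {E : Type*} [NormedAddCommGroup E] [NormedSpace ℝ E] {S : Set E}
    (hS : Convex ℝ S) (hne : S.Nonempty) {δ : ℝ} (hδ : 0 < δ) {c : TupleChain E}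
    (hc : c ∈ Finsupp.supported (ZMod 2) (ZMod 2) (smallTuples δ S)) (h0 : tupleBdry c = 0) :
    ∃ b ∈ Finsupp.supported (ZMod 2) (ZMod 2) (smallTuples δ S), tupleBdry b = c := by
  classical
  obtain ⟨p, hp⟩ := hne
  have hsub : ∀ l ∈ c.support, l ∈ smallTuples δ S := fun l hl =>
    (Finsupp.mem_supported _ _).1 hc hl
  let pts : Finset E := c.support.biUnion List.toFinset
  have hpts : ∀ l ∈ c.support, ∀ x ∈ l, x ∈ pts := fun l hl x hx =>
    Finset.mem_biUnion.2 ⟨l, hl, List.mem_toFinset.2 hx⟩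
  obtain ⟨M, hM⟩ : ∃ M : ℝ, ∀ x ∈ pts, ‖x - p‖ ≤ M :=
    ⟨∑ x ∈ pts, ‖x - p‖, fun x hx =>
      Finset.single_le_sum (f := fun x => ‖x - p‖) (fun _ _ => norm_nonneg _) hx⟩
  -- The finitely many distances inside tuples of `c` are all below `δ`, so their maximum `η` leaves
  -- room `δ - η`. Inserting `0` covers the case without points.
  obtain ⟨η, hη0, hη, hdist⟩ : ∃ η, 0 ≤ η ∧ η < δ ∧ ∀ l ∈ c.support, ∀ x ∈ l, ∀ y ∈ l,
      dist x y ≤ η := by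
    let D : Finset ℝ := ((pts ×ˢ pts).image fun q => dist q.1 q.2).filter (· < δ)
    have hD : (insert 0 D).Nonempty := Finset.insert_nonempty _ _
    refine ⟨(insert 0 D).max' hD, Finset.le_max' _ _ (by simp), ?_, ?_⟩
    · rcases Finset.mem_insert.1 (Finset.max'_mem _ hD) with h | h
      · rw [h]; exact hδ
      · exact (Finset.mem_filter.1 h).2
    · intro l hl x hx y hy
      refine Finset.le_max' _ _ (Finset.mem_insert_of_mem (Finset.mem_filter.2
        ⟨Finset.mem_image_of_mem (fun q : E × E => dist q.1 q.2)
          (Finset.mem_product.2 ⟨hpts l hl x hx, hpts l hl y hy⟩ : (x, y) ∈ pts ×ˢ pts),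
          ((hsub l hl) x hx).2 y hy⟩))
  -- Contract to `p` in `N + 1` equal steps, each moving a point by less than `δ - η`; then the
  -- prisms between consecutive steps still consist of small tuples.
  obtain ⟨N, hN⟩ := exists_nat_gt (M / (δ - η))
  have hηδ : 0 < δ - η := by linarith
  have hN1 : M < (N + 1 : ℝ) * (δ - η) := by
    rw [div_lt_iff₀ hηδ] at hN; nlinarith
  let r : ℕ → ℝ := fun j => j / (N + 1 : ℝ)
  have hNpos : (0 : ℝ) < N + 1 := by positivity
  let h : ℕ → E → E := fun j x => p + r j • (x - p)
  have hmem : ∀ j ≤ N + 1, ∀ x ∈ S, h j x ∈ S := fun j hj x hx =>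
    hS.add_smul_sub_mem hp hx ⟨by positivity, by
      rw [div_le_one hNpos]; exact_mod_cast hj⟩
  have hr : ∀ j ≤ N + 1, 0 ≤ r j ∧ r j ≤ 1 := fun j hj =>
    ⟨by positivity, by rw [div_le_one hNpos]; exact_mod_cast hj⟩
  have hd1 : ∀ j ≤ N + 1, ∀ x y, dist (h j x) (h j y) ≤ dist x y := by
    intro j hj x y
    rw [dist_eq_norm, dist_eq_norm, show h j x - h j y = r j • (x - y) by
      simp only [h, add_sub_add_left_eq_sub, ← smul_sub]; congr 1; abel, norm_smul,
      Real.norm_of_nonneg (hr j hj).1]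
    exact mul_le_of_le_one_left (norm_nonneg _) (hr j hj).2
  have hd2 : ∀ j, ∀ x ∈ pts, dist (h j x) (h (j + 1) x) < δ - η := by
    intro j x hx
    rw [dist_eq_norm, show h j x - h (j + 1) x = (r j - r (j + 1)) • (x - p) by
      simp only [h, add_sub_add_left_eq_sub, ← sub_smul], norm_smul,
      show r j - r (j + 1) = -(1 / (N + 1 : ℝ)) by simp only [r]; push_cast; ring, norm_neg,
      Real.norm_of_nonneg (by positivity), one_div_mul_eq_div, div_lt_iff₀ hNpos]
    exact (hM x hx).trans_lt (by linarith)
  have key : ∀ j ≤ N + 1, ∃ b ∈ Finsupp.supported (ZMod 2) (ZMod 2) (smallTuples δ S),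
      tupleBdry b = tupleMap (h 0) c + tupleMap (h j) c := by
    intro j
    induction j with
    | zero => exact fun _ => ⟨0, Submodule.zero_mem _, by rw [map_zero, add_self_zmod_two]⟩
    | succ j ih =>
      intro hj
      obtain ⟨b, hb, hb'⟩ := ih (by omega)
      have hP := tupleBdry_prism (h j) (h (j + 1)) c
      rw [h0, map_zero, add_zero] at hP
      refine ⟨b + prism (h j) (h (j + 1)) c, Submodule.add_mem _ hb ?_, ?_⟩
      · refine map_mem_of_supported (A := (c.support : Set (List E))) _ (fun l hl => ?_)
          (Finsupp.mem_supported_support _ _)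
        have hl : l ∈ c.support := hl
        refine prism_mem fun l' hl' x hx => ?_
        obtain ⟨v, hv, hxv⟩ := hl' x hx
        constructor
        · rcases hxv with rfl | rfl
          · exact hmem j (by omega) v ((hsub l hl) v hv).1
          · exact hmem (j + 1) hj v ((hsub l hl) v hv).1
        · intro y hy
          obtain ⟨w, hw, hyw⟩ := hl' y hy
          have h1 := hd1 j (by omega) v w
          have h2 := hd1 (j + 1) hj v w
          have h3 := hd2 j v (hpts l hl v hv)
          have h4 := hd2 j w (hpts l hl w hw)
          have h5 := hdist l hl v hv w hw
          rcases hxv with rfl | rfl <;> rcases hyw with rfl | rfl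
          · linarith
          · have := dist_triangle (h j v) (h j w) (h (j + 1) w); linarith
          · have := dist_triangle (h (j + 1) v) (h j v) (h j w)
            rw [dist_comm (h (j + 1) v) (h j v)] at this; linarith
          · linarith
      · rw [map_add, hb', hP]
        generalize tupleMap (h j) c = B
        rw [add_assoc, ← add_assoc B, add_self_zmod_two, zero_add]
  obtain ⟨b, hb, hb'⟩ := key (N + 1) le_rfl
  have hid : h (N + 1) = id := by
    funext x
    simp only [h, r, id]
    rw [show ((N + 1 : ℕ) : ℝ) / (N + 1 : ℝ) = 1 by push_cast; exact div_self hNpos.ne', one_smul]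
    abel
  have hconst : ∀ x, h 0 x = p := fun x => by simp [h, r]
  have hcm : tupleMap (h (N + 1)) c = c := by
    rw [hid, tupleMap, List.map_id_fun]; simp
  -- The prisms connect `c` with a chain of constant tuples at `p`, and the cone with apex `p` fills
  -- that chain.
  refine ⟨b + cone p (tupleMap (h 0) c), Submodule.add_mem _ hb ?_, ?_⟩
  · refine map_mem_of_supported (A := (c.support : Set (List E))) (cone p ∘ₗ tupleMap (h 0))
      (fun l hl => ?_) (Finsupp.mem_supported_support _ _)
    rw [LinearMap.comp_apply, tupleMap_single, cone_single]
    have hall : ∀ x ∈ p :: l.map (h 0), x = p := by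
      intro x hx
      simp only [List.mem_cons, List.mem_map] at hx
      rcases hx with rfl | ⟨w, _, rfl⟩
      · rfl
      · exact hconst w
    refine single_mem_supported fun x hx => ?_
    rw [hall x hx]
    exact ⟨hp, fun y hy => by rw [hall y hy, dist_self]; exact hδ⟩
  · rw [map_add, hb', tupleBdry_cone, tupleBdry_tupleMap, h0, map_zero, map_zero, add_zero, hcm]
    generalize tupleMap (h 0) c = B
    rw [add_comm B c, add_assoc, add_self_zmod_two, add_zero]

/-! ### Chains of finite sets -/

variable [DecidableEq P]

/-- The (augmented) boundary of a chain of finite sets. -/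
def setBdry : (Finset P →₀ ZMod 2) →ₗ[ZMod 2] (Finset P →₀ ZMod 2) :=
  ext2 fun s => ∑ x ∈ s, Finsupp.single (s.erase x) 1

theorem setBdry_single (s : Finset P) :
    setBdry (Finsupp.single s 1) = ∑ x ∈ s, Finsupp.single (s.erase x) 1 := by
  rw [setBdry, ext2_single]

/-- The join with a vertex; it is zero on the simplices that contain the vertex. -/
def join (v : P) : (Finset P →₀ ZMod 2) →ₗ[ZMod 2] (Finset P →₀ ZMod 2) :=
  ext2 fun s => if v ∈ s then 0 else Finsupp.single (insert v s) 1

theorem join_single_of_mem {v : P} {s : Finset P} (h : v ∈ s) :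
    join v (Finsupp.single s 1) = 0 := by rw [join, ext2_single, if_pos h]

theorem join_single_of_notMem {v : P} {s : Finset P} (h : v ∉ s) :
    join v (Finsupp.single s 1) = Finsupp.single (insert v s) 1 := by
  rw [join, ext2_single, if_neg h]

/-- If `v ∈ s`, the join vanishes and the only face without `v` rejoins to `s`, which cancels the
first term. Otherwise it is the formula for a cone. -/
theorem setBdry_join (v : P) (c : Finset P →₀ ZMod 2) :
    setBdry (join v c) = c + join v (setBdry c) := by
  have : setBdry ∘ₗ join v = LinearMap.id + join v ∘ₗ setBdry := linearMap_ext2 fun s => by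
    simp only [LinearMap.comp_apply, LinearMap.add_apply, LinearMap.id_apply, setBdry_single,
      map_sum]
    by_cases h : v ∈ s
    · rw [join_single_of_mem h, map_zero, ← Finset.add_sum_erase _ _ h,
        join_single_of_notMem (Finset.notMem_erase v s), Finset.insert_erase h,
        Finset.sum_eq_zero, add_zero, add_self_zmod_two]
      intro x hx
      exact join_single_of_mem (Finset.mem_erase.2 ⟨(Finset.ne_of_mem_erase hx).symm, h⟩)
    · rw [join_single_of_notMem h, setBdry_single, Finset.sum_insert h, Finset.erase_insert h]
      congr 1
      refine Finset.sum_congr rfl fun x hx => ?_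
      rw [join_single_of_notMem fun h' => h (Finset.mem_of_mem_erase h'),
        Finset.erase_insert_of_ne (by rintro rfl; exact h hx)]
  exact LinearMap.congr_fun this c

theorem setBdry_setBdry (c : Finset P →₀ ZMod 2) : setBdry (setBdry c) = 0 := by
  have : setBdry ∘ₗ setBdry = (0 : (Finset P →₀ ZMod 2) →ₗ[ZMod 2] _) := linearMap_ext2 fun s => by
    simp only [LinearMap.comp_apply, LinearMap.zero_apply]
    induction s using Finset.induction_on with
    | empty => rw [setBdry_single, Finset.sum_empty, map_zero]
    | insert v s h ih =>
      rw [← join_single_of_notMem h, setBdry_join, map_add, setBdry_join, ih, map_zero, add_zero,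
        add_self_zmod_two]
  exact LinearMap.congr_fun this c

/-- The chain of finite sets underlying a tuple; it is zero if the tuple has a repetition. -/
def toSetAux : List P → (Finset P →₀ ZMod 2)
  | [] => Finsupp.single ∅ 1
  | v :: l => join v (toSetAux l)

/-- The chain of finite sets underlying a chain of tuples. -/
def toSet : TupleChain P →ₗ[ZMod 2] (Finset P →₀ ZMod 2) := ext2 toSetAux

theorem toSet_nil : toSet (Finsupp.single ([] : List P) 1) = Finsupp.single ∅ 1 := by
  rw [toSet, ext2_single]; rfl

theorem toSet_cons (v : P) (l : List P) :
    toSet (Finsupp.single (v :: l) 1) = join v (toSet (Finsupp.single l 1)) := by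
  rw [toSet, ext2_single, ext2_single]; rfl

theorem toSet_cone (v : P) (c : TupleChain P) : toSet (cone v c) = join v (toSet c) := by
  have : toSet ∘ₗ cone v = join v ∘ₗ toSet :=
    linearMap_ext2 fun l => by simp [cone_single, toSet_cons]
  exact LinearMap.congr_fun this c

/-- Forgetting the order and dropping tuples with repetitions is a chain map because `cone` and
`join` obey the same boundary formula. -/
theorem setBdry_toSet (c : TupleChain P) : setBdry (toSet c) = toSet (tupleBdry c) := by
  have : setBdry ∘ₗ toSet = toSet ∘ₗ (tupleBdry (P := P)) := linearMap_ext2 fun l => by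
    simp only [LinearMap.comp_apply]
    induction l with
    | nil => simp [toSet_nil, tupleBdry_nil, setBdry_single]
    | cons v l ih => rw [toSet_cons, setBdry_join, tupleBdry_cons, map_add, toSet_cone, ih]
  exact LinearMap.congr_fun this c

theorem join_mem {v : P} {s : Finset P} (hv : v ∈ s) {c : Finset P →₀ ZMod 2}
    (hc : c ∈ Finsupp.supported (ZMod 2) (ZMod 2) {s' | s' ⊆ s}) :
    join v c ∈ Finsupp.supported (ZMod 2) (ZMod 2) {s' | s' ⊆ s} := by
  refine map_mem_of_supported _ (fun s' hs' => ?_) hc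
  by_cases h : v ∈ s'
  · rw [join_single_of_mem h]; exact Submodule.zero_mem _
  · rw [join_single_of_notMem h]
    exact single_mem_supported (Finset.insert_subset hv hs')

theorem toSet_mem {s : Finset P} {l : List P} (h : ∀ x ∈ l, x ∈ s) :
    toSet (Finsupp.single l 1) ∈ Finsupp.supported (ZMod 2) (ZMod 2) {s' | s' ⊆ s} := by
  induction l with
  | nil => rw [toSet_nil]; exact single_mem_supported (Finset.empty_subset s)
  | cons v l ih =>
    rw [toSet_cons]
    exact join_mem (h v (by simp)) (ih fun x hx => h x (by simp [hx]))

/-- Acyclic carriers: a chain map `G` that is carried by an acyclic carrier `C` on a set `Φ` of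
finite sets is chain homotopic to zero there, with prescribed value of the homotopy at `∅`. -/
theorem exists_carried {M : Type*} [AddCommGroup M] [Module (ZMod 2) M] (D : M →ₗ[ZMod 2] M)
    (Φ : Set (Finset P)) (hΦ : ∀ s ∈ Φ, ∀ x ∈ s, s.erase x ∈ Φ) (C : Finset P → Submodule (ZMod 2) M)
    (hmono : ∀ s s', s ⊆ s' → C s ≤ C s')
    (hac : ∀ s ∈ Φ, s.Nonempty → ∀ c ∈ C s, D c = 0 → ∃ b ∈ C s, D b = c)
    (G : (Finset P →₀ ZMod 2) →ₗ[ZMod 2] M)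
    (hG : ∀ s ∈ Φ, D (G (Finsupp.single s 1)) = G (setBdry (Finsupp.single s 1)))
    (hGC : ∀ s ∈ Φ, G (Finsupp.single s 1) ∈ C s) (m : M) (hm : m ∈ C ∅)
    (hDm : D m = G (Finsupp.single ∅ 1)) :
    ∃ H : (Finset P →₀ ZMod 2) →ₗ[ZMod 2] M, H (Finsupp.single ∅ 1) = m ∧
      ∀ s ∈ Φ, H (Finsupp.single s 1) ∈ C s ∧
        D (H (Finsupp.single s 1)) = G (Finsupp.single s 1) + H (setBdry (Finsupp.single s 1)) := by
  -- Induction on cardinality. An extension keeps all earlier values, so the successive choices fit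
  -- together.
  have hstep : ∀ n : ℕ, ∀ H : Finset P → M, (H ∅ = m ∧ ∀ s ∈ Φ, s.card ≤ n →
    H s ∈ C s ∧ D (H s) = G (Finsupp.single s 1) + ∑ x ∈ s, H (s.erase x)) →
    ∃ H' : Finset P → M, (H' ∅ = m ∧ ∀ s ∈ Φ, s.card ≤ n + 1 →
    H' s ∈ C s ∧ D (H' s) = G (Finsupp.single s 1) + ∑ x ∈ s, H' (s.erase x)) ∧
      ∀ s, s.card ≤ n → H' s = H s := by
    rintro n H ⟨H0, hH⟩
    have hex : ∀ s : Finset P, ∃ b : M, s ∈ Φ → s.card = n + 1 → b ∈ C s ∧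
        D b = G (Finsupp.single s 1) + ∑ x ∈ s, H (s.erase x) := by
      intro s
      by_cases hs : s ∈ Φ ∧ s.card = n + 1
      swap
      · exact ⟨0, fun h1 h2 => absurd ⟨h1, h2⟩ hs⟩
      obtain ⟨hs, hcard⟩ := hs
      have hcd : ∀ x ∈ s, (s.erase x).card ≤ n := fun x hx => by
        rw [Finset.card_erase_of_mem hx]; omega
      have hw : G (Finsupp.single s 1) + ∑ x ∈ s, H (s.erase x) ∈ C s :=
        Submodule.add_mem _ (hGC s hs) (Submodule.sum_mem _ fun x hx =>
          hmono _ _ (Finset.erase_subset x s) (hH _ (hΦ s hs x hx) (hcd x hx)).1)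
      -- The boundary of the partial homotopy on the faces of `s` is `G` of the boundary of `s` plus
      -- a term that vanishes because the boundary squares to zero; the former cancels `D (G s)`.
      have hcyc : D (G (Finsupp.single s 1) + ∑ x ∈ s, H (s.erase x)) = 0 := by
        have h1 : D (∑ x ∈ s, H (s.erase x)) =
            G (setBdry (Finsupp.single s 1)) +
              ext2 H (setBdry (setBdry (Finsupp.single s 1))) := by
          rw [setBdry_single, map_sum, map_sum, map_sum, map_sum, ← Finset.sum_add_distrib]
          refine Finset.sum_congr rfl fun x hx => ?_
          rw [(hH _ (hΦ s hs x hx) (hcd x hx)).2, setBdry_single, map_sum]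
          simp only [ext2_single]
        rw [map_add, h1, hG s hs, setBdry_setBdry, map_zero, add_zero, add_self_zmod_two]
      obtain ⟨b, hb, hb'⟩ := hac s hs (Finset.card_pos.1 (by omega)) _ hw hcyc
      exact ⟨b, fun _ _ => ⟨hb, hb'⟩⟩
    choose b hb using hex
    have hne : ∀ s : Finset P, s.card ≤ n → (if s.card = n + 1 then b s else H s) = H s :=
      fun s hs => if_neg (by omega)
    refine ⟨fun s => if s.card = n + 1 then b s else H s, ⟨by simpa using H0, ?_⟩, hne⟩
    intro s hs hcard
    have hsum : ∑ x ∈ s, (if (s.erase x).card = n + 1 then b (s.erase x) else H (s.erase x)) =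
        ∑ x ∈ s, H (s.erase x) := Finset.sum_congr rfl fun x hx =>
      hne _ (by rw [Finset.card_erase_of_mem hx]; omega)
    dsimp only
    rw [hsum]
    rcases Nat.lt_or_ge n s.card with hlt | hge
    · have : s.card = n + 1 := by omega
      rw [if_pos this]; exact hb s hs this
    · rw [hne s hge]; exact hH s hs hge
  have hH₀ : ((fun _ => m : Finset P → M) ∅ = m ∧ ∀ s ∈ Φ, s.card ≤ 0 →
      m ∈ C s ∧ D m = G (Finsupp.single s 1) + ∑ x ∈ s, (fun _ => m : Finset P → M) (s.erase x)) := by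
    refine ⟨rfl, fun s _ hs => ?_⟩
    obtain rfl := Finset.card_eq_zero.1 (Nat.le_zero.1 hs)
    exact ⟨hm, by rw [Finset.sum_empty, add_zero, hDm]⟩
  let F : (n : ℕ) → {H : Finset P → M // H ∅ = m ∧ ∀ s ∈ Φ, s.card ≤ n →
      H s ∈ C s ∧ D (H s) = G (Finsupp.single s 1) + ∑ x ∈ s, H (s.erase x)} := fun n =>
    Nat.rec ⟨fun _ => m, hH₀⟩ (fun n H => ⟨(hstep n H.1 H.2).choose, (hstep n H.1 H.2).choose_spec.1⟩) n
  have hF : ∀ n s, s.card ≤ n → (F (n + 1)).1 s = (F n).1 s := fun n s hs =>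
    (hstep n (F n).1 (F n).2).choose_spec.2 s hs
  have hF' : ∀ n s, s.card ≤ n → (F n).1 s = (F s.card).1 s := by
    intro n s hs
    induction n, hs using Nat.le_induction with
    | base => rfl
    | succ n hn ih => rw [hF n s hn, ih]
  -- The value at `s` is final from stage `s.card` on, so it is read off there.
  refine ⟨ext2 fun s => (F s.card).1 s, ?_, fun s hs => ?_⟩
  · rw [ext2_single]; exact (F _).2.1
  · rw [ext2_single, setBdry_single, map_sum]
    have := (F s.card).2.2 s hs le_rfl
    refine ⟨this.1, this.2.trans ?_⟩
    congr 1
    refine Finset.sum_congr rfl fun x hx => ?_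
    rw [ext2_single]
    exact hF' _ _ (Finset.card_le_card (Finset.erase_subset x s))

end Chains

namespace TorusLattice

variable {d : ℕ} (X : TorusLattice d)

/-! ### Acyclicity of the universal cover -/

open scoped Classical in
/-- The (augmented) complex of the triangulation of `ℝ^d` is acyclic. -/
theorem exists_filling {z : Finset (Euc d) →₀ ZMod 2}
    (hz : z ∈ Finsupp.supported (ZMod 2) (ZMod 2) {s | s = ∅ ∨ s ∈ X.cover.faces})
    (h0 : setBdry z = 0) :
    ∃ b ∈ Finsupp.supported (ZMod 2) (ZMod 2) {s | s = ∅ ∨ s ∈ X.cover.faces}, setBdry b = z := by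
  obtain ⟨R, hR0, hR⟩ : ∃ R : ℝ, 0 ≤ R ∧ ∀ s ∈ z.support, ∀ x ∈ s, ‖x‖ ≤ R := by
    refine ⟨∑ s ∈ z.support, ∑ x ∈ s, ‖x‖,
      Finset.sum_nonneg fun _ _ => Finset.sum_nonneg fun _ _ => norm_nonneg _,
      fun s hs x hx => ?_⟩
    exact (Finset.single_le_sum (f := fun x => ‖x‖) (fun _ _ => norm_nonneg _) hx).trans
      (Finset.single_le_sum (f := fun s => ∑ x ∈ s, ‖x‖)
        (fun _ _ => Finset.sum_nonneg fun _ _ => norm_nonneg _) hs)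
  let B : Set (Euc d) := Metric.closedBall 0 R
  have hBc : Convex ℝ B := convex_closedBall _ _
  obtain ⟨δ, hδ, φ, hφ⟩ := X.exists_approx (isCompact_closedBall (0 : Euc d) R)
  let Φ : Set (Finset (Euc d)) := {s | s = ∅ ∨ s ∈ X.cover.faces}
  let ΦB : Set (Finset (Euc d)) := {s | s ∈ Φ ∧ (s : Set (Euc d)) ⊆ B}
  have hdown : ∀ s ∈ Φ, ∀ s' ⊆ s, s' ∈ Φ := by
    rintro s (rfl | hs) s' hs'
    · exact Or.inl (Finset.subset_empty.1 hs')
    · rcases s'.eq_empty_or_nonempty with h | h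
      · exact Or.inl h
      · exact Or.inr (X.cover.down_closed hs hs' h)
  have hΦB : ∀ s ∈ ΦB, ∀ x ∈ s, s.erase x ∈ ΦB := fun s hs x _ =>
    ⟨hdown s hs.1 _ (Finset.erase_subset x s),
      fun y hy => hs.2 (Finset.erase_subset x s hy)⟩
  have hzB : z ∈ Finsupp.supported (ZMod 2) (ZMod 2) ΦB := by
    rw [Finsupp.mem_supported] at hz ⊢
    exact fun s hs => ⟨hz hs, fun x hx => by simpa [B] using hR s hs x hx⟩
  let conv : Finset (Euc d) → Set (Euc d) := fun s => convexHull ℝ (s : Set (Euc d))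
  have hconvB : ∀ s ∈ ΦB, conv s ⊆ B := fun s hs => convexHull_min hs.2 hBc
  let SC : Set (Euc d) → Submodule (ZMod 2) (TupleChain (Euc d)) := fun S =>
    Finsupp.supported (ZMod 2) (ZMod 2) (smallTuples δ S)
  have hSCmono : ∀ S S' : Set (Euc d), S ⊆ S' → SC S ≤ SC S' := fun S S' h =>
    Finsupp.supported_mono fun l hl x hx => ⟨h (hl x hx).1, (hl x hx).2⟩
  -- A homotopy for the zero map is a chain map. Thus `Θ` subdivides each simplex into small tuples
  -- in its hull, starting with the empty tuple at `∅`.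
  obtain ⟨Θ, hΘ0, hΘ⟩ := exists_carried tupleBdry ΦB hΦB (fun s => SC (conv s))
    (fun s s' h => hSCmono _ _ (convexHull_mono (Finset.coe_subset.2 h)))
    (fun s _ hne c hc hc0 => exists_small_filling (convex_convexHull ℝ _)
      (convexHull_nonempty_iff.2 hne) hδ hc hc0) 0
    (fun s _ => by simp) (fun s _ => Submodule.zero_mem _) (Finsupp.single [] 1)
    (single_mem_supported fun x hx => by simp at hx) (by rw [tupleBdry_nil]; rfl)
  simp only [LinearMap.zero_apply, zero_add] at hΘ
  let Ψ : TupleChain (Euc d) →ₗ[ZMod 2] (Finset (Euc d) →₀ ZMod 2) := toSet ∘ₗ tupleMap φ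
  have hΨ : ∀ c, setBdry (Ψ c) = Ψ (tupleBdry c) := fun c => by
    simp only [Ψ, LinearMap.comp_apply, setBdry_toSet, tupleBdry_tupleMap]
  have hΨs : ∀ s ∈ ΦB, ∀ c ∈ SC (conv s),
      Ψ c ∈ Finsupp.supported (ZMod 2) (ZMod 2) {s' | s' ⊆ s} := by
    intro s hs c hc
    refine map_mem_of_supported Ψ (fun l hl => ?_) hc
    simp only [Ψ, LinearMap.comp_apply, tupleMap_single]
    refine toSet_mem fun v hv => ?_
    obtain ⟨x, hx, rfl⟩ := List.mem_map.1 hv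
    have hxs := (hl x hx).1
    rcases hs.1 with rfl | hsf
    · simp [conv] at hxs
    · exact hφ x (hconvB s hs hxs) x (by rw [dist_self]; exact hδ) s hsf hxs
  -- The points of a small tuple may lie in different simplices, but all are within `δ` of its first
  -- point `x`, so any simplex containing `x` contains all their images under `φ`.
  have hΨB : ∀ c ∈ SC B, Ψ c ∈ Finsupp.supported (ZMod 2) (ZMod 2) Φ := by
    intro c hc
    refine map_mem_of_supported Ψ (fun l hl => ?_) hc
    simp only [Ψ, LinearMap.comp_apply, tupleMap_single]
    rcases l with _ | ⟨x, l⟩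
    · rw [List.map_nil, toSet_nil]; exact single_mem_supported (Or.inl rfl)
    · obtain ⟨s, hs, hxs⟩ := Geometry.SimplicialComplex.mem_space_iff.1
        (show x ∈ X.cover.space by rw [X.space_eq]; trivial)
      refine Finsupp.supported_mono (s := {s' | s' ⊆ s}) (fun s' hs' => hdown s (Or.inr hs) s' hs')
        (toSet_mem fun v hv => ?_)
      obtain ⟨y, hy, rfl⟩ := List.mem_map.1 hv
      exact hφ y (hl y hy).1 x ((hl x (by simp)).2 y hy) s hs hxs
  have hΨΘ : ∀ s ∈ ΦB, Ψ (Θ (Finsupp.single s 1)) + Finsupp.single s 1 ∈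
      Finsupp.supported (ZMod 2) (ZMod 2) {s' | s' ⊆ s} := fun s hs =>
    Submodule.add_mem _ (hΨs s hs _ (hΘ s hs).1) (single_mem_supported (Finset.Subset.refl s))
  -- Both `Ψ ∘ Θ` and the identity send a simplex to chains of its own faces, an acyclic complex; so
  -- they are homotopic.
  obtain ⟨H, -, hH⟩ := exists_carried setBdry ΦB hΦB
    (fun s => Finsupp.supported (ZMod 2) (ZMod 2) {s' | s' ⊆ s})
    (fun s s' h => Finsupp.supported_mono fun s'' hs'' => Finset.Subset.trans hs'' h)
    (fun s _ hne c hc hc0 => by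
      obtain ⟨v, hv⟩ := hne
      exact ⟨join v c, join_mem hv hc, by rw [setBdry_join, hc0, map_zero, add_zero]⟩)
    (Ψ ∘ₗ Θ + LinearMap.id)
    (fun s hs => by
      simp only [LinearMap.add_apply, LinearMap.comp_apply, LinearMap.id_apply, map_add, hΨ]
      rw [(hΘ s hs).2])
    hΨΘ 0 (Submodule.zero_mem _) (by
      simp only [LinearMap.add_apply, LinearMap.comp_apply, LinearMap.id_apply, map_zero, hΘ0, Ψ]
      rw [tupleMap_single, List.map_nil, toSet_nil, add_self_zmod_two])
  have hΘz : Θ z ∈ SC B := map_mem_of_supported Θ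
    (fun s hs => hSCmono _ _ (hconvB s hs) (hΘ s hs).1) hzB
  have hΘz0 : tupleBdry (Θ z) = 0 := by
    have := eq_of_supported (tupleBdry ∘ₗ Θ) (Θ ∘ₗ setBdry) (fun s hs => (hΘ s hs).2) hzB
    simpa [h0] using this
  obtain ⟨c, hc, hcz⟩ := exists_small_filling hBc ⟨0, by simpa [B] using hR0⟩ hδ hΘz hΘz0
  have hHz : setBdry (H z) = Ψ (Θ z) + z := by
    have := eq_of_supported (setBdry ∘ₗ H) (Ψ ∘ₗ Θ + LinearMap.id + H ∘ₗ setBdry)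
      (fun s hs => (hH s hs).2) hzB
    simpa [h0] using this
  -- `Ψ c` fills `Ψ (Θ z)`, and `H z` fills `Ψ (Θ z) + z`.
  refine ⟨Ψ c + H z, Submodule.add_mem _ (hΨB c hc) (map_mem_of_supported H (fun s hs =>
    Finsupp.supported_mono (fun s' hs' => hdown s hs.1 s' hs') (hH s hs).1) hzB), ?_⟩
  rw [map_add, hΨ, hcz, hHz, ← add_assoc, add_self_zmod_two, zero_add]

/-! ### Chains of the cover -/

/-- Chains of the universal cover. -/
abbrev CoverChain (k : ℕ) : Type := X.CoverCell k →₀ ZMod 2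

/-- The boundary operator of the universal cover. -/
def bdryCover (k l : ℕ) : X.CoverChain k →ₗ[ZMod 2] X.CoverChain l :=
  ext2 fun κ => ∑ ν ∈ (κ.1.powersetCard (l + 1)).attach, Finsupp.single (X.subface κ ν) 1

/-- The projection of chains of the cover to the torus. -/
def projChain (k : ℕ) : X.CoverChain k →ₗ[ZMod 2] X.Chain k := Finsupp.lmapDomain _ _ X.proj

theorem projChain_single {k : ℕ} (κ : X.CoverCell k) :
    X.projChain k (Finsupp.single κ 1) = Finsupp.single (X.proj κ) 1 := by
  simp [projChain, Finsupp.mapDomain_single]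

theorem bdryCover_single {k l : ℕ} (κ : X.CoverCell k) : X.bdryCover k l (Finsupp.single κ 1) =
    ∑ ν ∈ (κ.1.powersetCard (l + 1)).attach, Finsupp.single (X.subface κ ν) 1 := by
  rw [bdryCover, ext2_single]

theorem proj_eq_iff {k : ℕ} {κ κ' : X.CoverCell k} :
    X.proj κ = X.proj κ' ↔ ∃ a ∈ X.period, κ'.1 = translate a κ.1 :=
  ⟨fun h => Quotient.exact (s := X.cellSetoid k) h, fun h => Quotient.sound (s := X.cellSetoid k) h⟩

theorem proj_lift {k : ℕ} (q : X.Cell k) : X.proj (X.lift q) = q :=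
  Quotient.out_eq (s := X.cellSetoid k) q

/-- The translate of a cell of the cover by a period. -/
def shift {k : ℕ} (a : Euc d) (ha : a ∈ X.period) (κ : X.CoverCell k) : X.CoverCell k :=
  ⟨translate a κ.1, X.periodic a ha _ κ.2.1, by rw [card_translate, κ.2.2]⟩

theorem proj_shift {k : ℕ} (a : Euc d) (ha : a ∈ X.period) (κ : X.CoverCell k) :
    X.proj (X.shift a ha κ) = X.proj κ := (X.proj_eq_iff.2 ⟨a, ha, rfl⟩).symm

theorem exists_shift_of_proj_eq {k : ℕ} {κ κ' : X.CoverCell k} (h : X.proj κ = X.proj κ') :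
    ∃ a, ∃ ha : a ∈ X.period, κ' = X.shift a ha κ := by
  obtain ⟨a, ha, h⟩ := X.proj_eq_iff.1 h
  exact ⟨a, ha, Subtype.ext h⟩

/-- The sum of the projections of the faces of a cell does not change under translation. -/
theorem projChain_bdryCover_single_eq {k l : ℕ} {κ κ' : X.CoverCell k} (h : X.proj κ = X.proj κ') :
    X.projChain l (X.bdryCover k l (Finsupp.single κ 1)) =
      X.projChain l (X.bdryCover k l (Finsupp.single κ' 1)) := by
  obtain ⟨a, ha, rfl⟩ := X.exists_shift_of_proj_eq h
  simp only [bdryCover_single, map_sum, projChain_single]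
  refine Finset.sum_bij (fun ν _ => ⟨translate a ν.1, ?_⟩) ?_ ?_ ?_ ?_
  · have := Finset.mem_powersetCard.1 ν.2
    exact Finset.mem_powersetCard.2 ⟨translate_subset this.1, by rw [card_translate, this.2]⟩
  · intro _ _; exact Finset.mem_attach _ _
  · intro ν _ ν' _ hνν
    have := congrArg (translate (-a)) (congrArg Subtype.val hνν)
    simp only [translate_translate, add_neg_cancel, translate_zero] at this
    exact Subtype.ext this
  · intro ν _
    have := Finset.mem_powersetCard.1 ν.2
    refine ⟨⟨translate (-a) ν.1, Finset.mem_powersetCard.2 ⟨?_, ?_⟩⟩, Finset.mem_attach _ _, ?_⟩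
    · have h := translate_subset (a := -a) this.1
      simpa [shift, translate_translate, translate_zero] using h
    · rw [card_translate, this.2]
    · apply Subtype.ext
      simp [translate_translate, translate_zero]
  · intro ν _
    congr 1
    exact X.proj_eq_iff.2 ⟨a, ha, rfl⟩

/-- Frees the boundary on the torus from the lift used to define it: each computation may use its
own lift. -/
theorem bdry_single {k l : ℕ} (κ : X.CoverCell k) :
    X.bdry k l (Finsupp.single (X.proj κ) 1) =
      X.projChain l (X.bdryCover k l (Finsupp.single κ 1)) := by
  have h : X.bdry k l (Finsupp.single (X.proj κ) 1) =
      X.projChain l (X.bdryCover k l (Finsupp.single (X.lift (X.proj κ)) 1)) := by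
    simp only [bdryCover_single, map_sum, projChain_single]
    rw [bdry, ext2_single]
  rw [h]
  exact X.projChain_bdryCover_single_eq (X.proj_lift _)

theorem bdry_projChain {k l : ℕ} (c : X.CoverChain k) :
    X.bdry k l (X.projChain k c) = X.projChain l (X.bdryCover k l c) := by
  have : X.bdry k l ∘ₗ X.projChain k = X.projChain l ∘ₗ X.bdryCover k l :=
    linearMap_ext2 fun κ => by
      simp only [LinearMap.comp_apply]
      rw [projChain_single, bdry_single]
  exact LinearMap.congr_fun this c

/-- A chain of the cover as a chain of finite sets. -/
def faceChain (k : ℕ) : X.CoverChain k →ₗ[ZMod 2] (Finset (Euc d) →₀ ZMod 2) :=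
  Finsupp.lmapDomain _ _ fun κ => κ.1

theorem faceChain_single {k : ℕ} (κ : X.CoverCell k) :
    X.faceChain k (Finsupp.single κ 1) = Finsupp.single κ.1 1 := by
  rw [faceChain, Finsupp.lmapDomain_apply, Finsupp.mapDomain_single]

theorem faceChain_injective (k : ℕ) : Function.Injective (X.faceChain k) :=
  Finsupp.mapDomain_injective fun _ _ h => Subtype.ext h

open scoped Classical in
theorem setBdry_faceChain {k l : ℕ} (hk : k = l + 1) (c : X.CoverChain k) :
    setBdry (X.faceChain k c) = X.faceChain l (X.bdryCover k l c) := by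
  have : setBdry ∘ₗ X.faceChain k = X.faceChain l ∘ₗ X.bdryCover k l := linearMap_ext2 fun κ => by
    simp only [LinearMap.comp_apply, bdryCover_single, map_sum, faceChain_single, setBdry_single]
    refine Eq.trans ?_ (Finset.sum_attach (κ.1.powersetCard (l + 1))
      fun ν => Finsupp.single ν (1 : ZMod 2)).symm
    have hc := κ.2.2
    refine Finset.sum_bij (fun x _ => κ.1.erase x) ?_ ?_ ?_ fun _ _ => rfl
    · intro x hx
      exact Finset.mem_powersetCard.2 ⟨Finset.erase_subset _ _, by
        rw [Finset.card_erase_of_mem hx]; omega⟩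
    · intro x hx y hy h
      by_contra hxy
      have : x ∈ κ.1.erase y := Finset.mem_erase.2 ⟨hxy, hx⟩
      rw [← h] at this
      exact Finset.notMem_erase x _ this
    · intro ν hν
      obtain ⟨hsub, hcard⟩ := Finset.mem_powersetCard.1 hν
      have hd : (κ.1 \ ν).card = 1 := by rw [Finset.card_sdiff_of_subset hsub]; omega
      obtain ⟨x, hx⟩ := Finset.card_eq_one.1 hd
      have hxm : x ∈ κ.1 \ ν := by rw [hx]; simp
      refine ⟨x, (Finset.mem_sdiff.1 hxm).1, ?_⟩
      rw [← Finset.sdiff_singleton_eq_erase, ← hx, Finset.sdiff_sdiff_eq_self hsub]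
  exact LinearMap.congr_fun this c

open scoped Classical in
/-- The cycles of positive dimension of the triangulation of `ℝ^d` are boundaries. -/
theorem exists_bdryCover_eq {k l : ℕ} (hk : k = l + 1) {z : X.CoverChain k}
    (h0 : X.bdryCover k l z = 0) : ∃ b, X.bdryCover (k + 1) k b = z := by
  have hz : X.faceChain k z ∈ Finsupp.supported (ZMod 2) (ZMod 2)
      {s | s ∈ X.cover.faces ∧ s.card = k + 1} :=
    map_mem_of_supported (A := Set.univ) (X.faceChain k) (fun κ _ => by
      rw [faceChain_single]; exact single_mem_supported κ.2) (by simp)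
  obtain ⟨b, hb, hbz⟩ := X.exists_filling (z := X.faceChain k z)
    (Finsupp.supported_mono (fun s hs => Or.inr hs.1) hz)
    (by rw [X.setBdry_faceChain hk, h0, map_zero])
  -- The filling may have components in every degree. `hom n` keeps the sets of `n` points; it
  -- commutes with the boundary up to a shift, so the component of dimension `k + 1` alone fills
  -- `z`.
  let hom : ℕ → (Finset (Euc d) →₀ ZMod 2) →ₗ[ZMod 2] (Finset (Euc d) →₀ ZMod 2) := fun n =>
    ext2 fun s => if s.card = n then Finsupp.single s 1 else 0
  have hhom : setBdry ∘ₗ hom (k + 2) = hom (k + 1) ∘ₗ setBdry := linearMap_ext2 fun s => by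
    simp only [LinearMap.comp_apply, hom, ext2_single, setBdry_single, map_sum]
    by_cases hs : s.card = k + 2
    · rw [if_pos hs, setBdry_single]
      refine Finset.sum_congr rfl fun x hx => ?_
      rw [if_pos]
      rw [Finset.card_erase_of_mem hx]; omega
    · rw [if_neg hs, map_zero, Finset.sum_eq_zero]
      intro x hx
      rw [if_neg]
      have := Finset.card_pos.2 ⟨x, hx⟩
      rw [Finset.card_erase_of_mem hx]; omega
  have hbk : hom (k + 2) b ∈ LinearMap.range (X.faceChain (k + 1)) := by
    refine map_mem_of_supported (hom (k + 2)) (fun s hs => ?_) hb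
    simp only [hom, ext2_single]
    split_ifs with h
    · rcases hs with rfl | hs
      · simp at h
      · exact ⟨Finsupp.single ⟨s, hs, h⟩ 1, X.faceChain_single _⟩
    · exact Submodule.zero_mem _
  obtain ⟨b', hb'⟩ := hbk
  refine ⟨b', X.faceChain_injective k ?_⟩
  rw [← X.setBdry_faceChain rfl, hb']
  have h1 := LinearMap.congr_fun hhom b
  simp only [LinearMap.comp_apply, hbz] at h1
  rw [h1]
  refine eq_of_supported (hom (k + 1)) LinearMap.id (fun s hs => ?_) hz
  simp only [hom, ext2_single, LinearMap.id_apply]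
  rw [if_pos hs.2]

/-- A cycle on the torus that lifts to a region of the cover without two points that differ by a
period is a boundary. -/
theorem mem_range_bdry_of_local {k l : ℕ} (hk : k = l + 1) {c : X.Chain k} (hc : X.bdry k l c = 0)
    {W : Set (Euc d)} (hW : ∀ x ∈ W, ∀ a ∈ X.period, x + a ∈ W → a = 0)
    (hcW : ∀ κ : X.CoverCell k, c (X.proj κ) ≠ 0 → ∃ a ∈ X.period, ∀ y ∈ κ.1, y - a ∈ W) :
    c ∈ LinearMap.range (X.bdry (k + 1) k) := by
  let A : (j : ℕ) → Set (X.CoverCell j) := fun j => {κ | ∀ y ∈ κ.1, y ∈ W}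
  have hlift : c ∈ (Finsupp.supported (ZMod 2) (ZMod 2) (A k)).map (X.projChain k) := by
    refine map_mem_of_supported (A := (c.support : Set (X.Cell k))) LinearMap.id (fun q hq => ?_)
      (Finsupp.mem_supported_support _ _)
    have hq : c q ≠ 0 := Finsupp.mem_support_iff.1 hq
    rw [← X.proj_lift q] at hq ⊢
    obtain ⟨a, ha, h⟩ := hcW _ hq
    refine ⟨Finsupp.single (X.shift (-a) (X.period.neg_mem ha) (X.lift q)) 1,
      single_mem_supported fun y hy => ?_, ?_⟩
    · have hy : y ∈ translate (-a) (X.lift q).1 := hy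
      rw [mem_translate] at hy
      simpa using h _ hy
    · rw [projChain_single, proj_shift]; rfl
  obtain ⟨z, hz, rfl⟩ := hlift
  rw [bdry_projChain] at hc
  have hbz : X.bdryCover k l z ∈ Finsupp.supported (ZMod 2) (ZMod 2) (A l) := by
    refine map_mem_of_supported _ (fun κ hκ => ?_) hz
    rw [bdryCover_single]
    refine Submodule.sum_mem _ fun ν _ => single_mem_supported fun y hy => hκ y ?_
    exact (Finset.mem_powersetCard.1 ν.2).1 hy
  have hinj : Set.InjOn X.proj (A l) := by
    intro κ hκ κ' hκ' h
    obtain ⟨a, ha, rfl⟩ := X.exists_shift_of_proj_eq h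
    obtain ⟨x, hx⟩ := X.cover.nonempty_of_mem_faces κ.2.1
    have : a = 0 := hW x (hκ x hx) a ha (hκ' _ (add_mem_translate hx))
    subst this
    exact Subtype.ext (translate_zero _).symm
  -- The boundary of the lift is supported where the projection is injective, so it vanishes because
  -- its projection does.
  have hz0 : X.bdryCover k l z = 0 :=
    Finsupp.mapDomain_injOn _ hinj ((Finsupp.mem_supported _ _).1 hbz) (by simp)
      (by rw [Finsupp.mapDomain_zero]; exact hc)
  obtain ⟨b, rfl⟩ := X.exists_bdryCover_eq hk hz0
  exact ⟨X.projChain (k + 1) b, X.bdry_projChain b⟩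

end TorusLattice

namespace TorusLattice

variable {d : ℕ} (X : TorusLattice d)

/-! ### Distances and translations -/

theorem vertices_add {x a : Euc d} (ha : a ∈ X.period) (hx : x ∈ X.cover.vertices) :
    x + a ∈ X.cover.vertices := by
  have := X.periodic a ha _ hx
  rwa [show translate a {x} = {x + a} by
    ext y; simp only [mem_translate, Finset.mem_singleton, sub_eq_iff_eq_add]] at this

theorem adj_add {x y a : Euc d} (ha : a ∈ X.period) (h : X.skeleton.Adj x y) :
    X.skeleton.Adj (x + a) (y + a) := by
  obtain ⟨hne, s, hs, h2, hx, hy⟩ := h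
  exact ⟨fun h => hne (add_right_cancel h), translate a s, X.periodic a ha s hs,
    by rw [card_translate, h2], add_mem_translate hx, add_mem_translate hy⟩

theorem vdist_self (x : Euc d) : X.vdist x x = 0 := SimpleGraph.dist_self

theorem vdist_comm (x y : Euc d) : X.vdist x y = X.vdist y x := SimpleGraph.dist_comm

theorem vdist_triangle {x y : Euc d} (hx : x ∈ X.cover.vertices) (hy : y ∈ X.cover.vertices)
    (z : Euc d) : X.vdist x z ≤ X.vdist x y + X.vdist y z :=
  (X.reachable hx hy).dist_triangle_left z

theorem vdist_add_le {x y a : Euc d} (ha : a ∈ X.period) (hx : x ∈ X.cover.vertices)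
    (hy : y ∈ X.cover.vertices) : X.vdist (x + a) (y + a) ≤ X.vdist x y := by
  obtain ⟨w, hw⟩ := (X.reachable hx hy).exists_walk_length_eq_dist
  let f : X.skeleton →g X.skeleton := ⟨fun x => x + a, fun h => X.adj_add ha h⟩
  have := SimpleGraph.dist_le (w.map f)
  rw [SimpleGraph.Walk.length_map, hw] at this
  exact this

theorem vdist_sub {x y a : Euc d} (ha : a ∈ X.period) (hx : x ∈ X.cover.vertices)
    (hy : y ∈ X.cover.vertices) : X.vdist (x - a) (y - a) = X.vdist x y := by
  have ha' := X.period.neg_mem ha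
  apply le_antisymm
  · simpa [sub_eq_add_neg] using X.vdist_add_le ha' hx hy
  · simpa [sub_eq_add_neg] using
      X.vdist_add_le ha (X.vertices_add ha' hx) (X.vertices_add ha' hy)

theorem vertices_sub {x a : Euc d} (ha : a ∈ X.period) (hx : x ∈ X.cover.vertices) :
    x - a ∈ X.cover.vertices := by
  simpa [sub_eq_add_neg] using X.vertices_add (X.period.neg_mem ha) hx

theorem vdist_le_one_of_adj {x y : Euc d} (h : X.skeleton.Adj x y) : X.vdist x y ≤ 1 :=
  (SimpleGraph.dist_eq_one_iff_adj.2 h).le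

theorem vdist_le_one {s : Finset (Euc d)} (hs : s ∈ X.cover.faces) {x y : Euc d} (hx : x ∈ s)
    (hy : y ∈ s) : X.vdist x y ≤ 1 := by
  by_cases h : x = y
  · rw [h, vdist_self]; exact zero_le_one
  · exact X.vdist_le_one_of_adj (X.adj_of_mem hs hx hy h)

/-- A vertex is far from its translates by non-zero periods. -/
theorem eq_zero_of_vdist_lt {x a : Euc d} (hx : x ∈ X.cover.vertices) (ha : a ∈ X.period)
    (h : X.vdist x (x + a) < X.linearSize) : a = 0 := by
  by_contra h0
  obtain ⟨w, hw⟩ := (X.reachable hx (X.vertices_add ha hx)).exists_walk_length_eq_dist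
  have : X.linearSize ≤ X.vdist x (x + a) := Nat.sInf_le ⟨x, hx, a, ha, h0, w, hw⟩
  omega

theorem vdist_le_diam {V : Finset (Euc d)} {x y : Euc d} (hx : x ∈ V) (hy : y ∈ V) :
    X.vdist x y ≤ X.diam V :=
  Finset.le_sup (f := fun q : Euc d × Euc d => X.vdist q.1 q.2) (b := (x, y))
    (Finset.mem_product.2 ⟨hx, hy⟩)

theorem diam_le {V : Finset (Euc d)} {n : ℕ} (h : ∀ x ∈ V, ∀ y ∈ V, X.vdist x y ≤ n) :
    X.diam V ≤ n :=
  Finset.sup_le fun _ hq => h _ (Finset.mem_product.1 hq).1 _ (Finset.mem_product.1 hq).2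

/-! ### Causal paths -/

variable {X} {t : Euc d}

theorem CausalPath.right_mem {x y : Euc d} {n : ℕ} (h : X.CausalPath t x y n) :
    y ∈ X.cover.vertices := by
  induction h with
  | nil _ hx => exact hx
  | cons _ _ _ _ _ _ _ ih => exact ih

theorem CausalPath.trans {x y z : Euc d} {n m : ℕ} (h : X.CausalPath t x y n)
    (h' : X.CausalPath t y z m) : X.CausalPath t x z (n + m) := by
  induction h with
  | nil _ _ => rwa [zero_add]
  | cons x y _ n hxy ht _ ih =>
    rw [Nat.add_right_comm]
    exact CausalPath.cons _ _ _ _ hxy ht (ih h')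

theorem CausalPath.add {x y a : Euc d} {n : ℕ} (ha : a ∈ X.period) (h : X.CausalPath t x y n) :
    X.CausalPath t (x + a) (y + a) n := by
  induction h with
  | nil _ hx => exact CausalPath.nil _ (X.vertices_add ha hx)
  | cons x y z n hxy ht _ ih =>
    exact CausalPath.cons _ _ _ _ (X.adj_add ha hxy) (by rwa [add_sub_add_right_eq_sub]) ih

theorem CausalPath.sub {x y a : Euc d} {n : ℕ} (ha : a ∈ X.period) (h : X.CausalPath t x y n) :
    X.CausalPath t (x - a) (y - a) n := by
  simpa [sub_eq_add_neg] using h.add (X.period.neg_mem ha)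

theorem CausalPath.edge {x y : Euc d} (hxy : X.skeleton.Adj x y) (ht : 0 < inner ℝ t (y - x)) :
    X.CausalPath t x y 1 := by
  refine CausalPath.cons _ _ _ _ hxy ht (CausalPath.nil _ ?_)
  obtain ⟨_, s, hs, _, _, hy⟩ := hxy
  exact X.mem_vertices_of_mem hs hy

/-- The end points of an edge are comparable. -/
theorem IsSweepDirection.edge_total (ht : X.IsSweepDirection t) {x y : Euc d}
    (hxy : X.skeleton.Adj x y) : X.CausalPath t x y 1 ∨ X.CausalPath t y x 1 := by
  rcases lt_or_gt_of_ne (ht.2 x y hxy) with h | h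
  · right
    refine CausalPath.edge hxy.symm ?_
    rw [← neg_sub, inner_neg_right]; linarith
  · exact Or.inl (CausalPath.edge hxy h)

theorem Prec.refl {x : Euc d} (hx : x ∈ X.cover.vertices) : X.Prec t x x :=
  ⟨0, CausalPath.nil _ hx⟩

theorem Prec.trans {x y z : Euc d} (h : X.Prec t x y) (h' : X.Prec t y z) : X.Prec t x z := by
  obtain ⟨n, hn⟩ := h
  obtain ⟨m, hm⟩ := h'
  exact ⟨_, hn.trans hm⟩

theorem Prec.add {x y a : Euc d} (ha : a ∈ X.period) (h : X.Prec t x y) :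
    X.Prec t (x + a) (y + a) := by
  obtain ⟨n, hn⟩ := h
  exact ⟨n, hn.add ha⟩

theorem Prec.sub {x y a : Euc d} (ha : a ∈ X.period) (h : X.Prec t x y) :
    X.Prec t (x - a) (y - a) := by
  obtain ⟨n, hn⟩ := h
  exact ⟨n, hn.sub ha⟩

theorem Prec.exists_pos {x y : Euc d} (h : X.Prec t x y) (hxy : x ≠ y) :
    ∃ n, 1 ≤ n ∧ X.CausalPath t x y n := by
  obtain ⟨n, hn⟩ := h
  cases hn with
  | nil _ _ => exact absurd rfl hxy
  | cons _ y _ n h1 h2 h3 => exact ⟨n + 1, by omega, CausalPath.cons _ _ _ _ h1 h2 h3⟩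

/-! ### The constants of a causal lattice -/

section Constants

variable {k : ℕ} {θ cB cD cP : ℝ}

variable (X) in
/-- There are `d`-dimensional simplices. -/
theorem exists_face : ∃ s ∈ X.cover.faces, s.card = d + 1 := by
  obtain ⟨s, hs, _⟩ := Geometry.SimplicialComplex.mem_space_iff.1
    (show (0 : Euc d) ∈ X.cover.space by rw [X.space_eq]; trivial)
  obtain ⟨s', hs', _, hc⟩ := X.pure s hs
  exact ⟨s', hs', hc⟩

/-- Orienting the edges of a triangle along `t` gives a tournament on three vertices. It has a
directed path of length two, whose ends are joined by the third edge. -/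
theorem IsSweepDirection.exists_chain (ht : X.IsSweepDirection t) (hd : 2 ≤ d) :
    ∃ x y z, X.CausalPath t x y 1 ∧ X.CausalPath t y z 1 ∧ X.skeleton.Adj x z := by
  obtain ⟨s, hs, hc⟩ := X.exists_face
  obtain ⟨x, y, z, hx, hy, hz, hxy, hxz, hyz⟩ := Finset.two_lt_card_iff.1
    (show 2 < s.card by omega)
  have axy := X.adj_of_mem hs hx hy hxy
  have axz := X.adj_of_mem hs hx hz hxz
  have ayz := X.adj_of_mem hs hy hz hyz
  rcases ht.edge_total axy with h1 | h1 <;> rcases ht.edge_total axz with h2 | h2 <;>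
    rcases ht.edge_total ayz with h3 | h3
  · exact ⟨x, y, z, h1, h3, axz⟩
  · exact ⟨x, z, y, h2, h3, axy⟩
  · exact ⟨x, y, z, h1, h3, axz⟩
  · exact ⟨z, x, y, h2, h1, ayz.symm⟩
  · exact ⟨y, x, z, h1, h2, ayz⟩
  · exact ⟨y, x, z, h1, h2, ayz⟩
  · exact ⟨y, z, x, h3, h2, axy.symm⟩
  · exact ⟨z, y, x, h3, h1, axz.symm⟩

/-- A causal path of length two joins adjacent vertices in some triangle. -/
theorem IsCausal.two_le_cP (h : X.IsCausal t k θ cB cD cP) (hd : 2 ≤ d)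
    (hL : 1 ≤ θ * X.linearSize) : 2 ≤ cP := by
  obtain ⟨x, y, z, h1, h2, h3⟩ := h.sweep.exists_chain hd
  have hv : X.vdist x z = 1 := SimpleGraph.dist_eq_one_iff_adj.2 h3
  have := h.path_length x z (by rw [hv]; simpa using hL) 2 (h1.trans h2)
  rw [hv] at this
  simpa using this

/-- Both ends of an edge lie in the diamond of the edge. -/
theorem IsCausal.one_le_cD (h : X.IsCausal t k θ cB cD cP) (hd : 2 ≤ d)
    (hL : 1 ≤ θ * X.linearSize) : 1 ≤ cD := by
  classical
  obtain ⟨x, y, z, -, -, h3⟩ := h.sweep.exists_chain hd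
  have hv : X.vdist x z = 1 := SimpleGraph.dist_eq_one_iff_adj.2 h3
  obtain ⟨-, s, hs, -, hx, hz⟩ := id h3
  have hxv := X.mem_vertices_of_mem hs hx
  have hzv := X.mem_vertices_of_mem hs hz
  have hdiam : X.diam {x, z} ≤ 1 := X.diam_le fun u hu w hw => by
    simp only [Finset.mem_insert, Finset.mem_singleton] at hu hw
    refine X.vdist_le_one hs ?_ ?_
    · rcases hu with rfl | rfl <;> assumption
    · rcases hw with rfl | rfl <;> assumption
  have hdiam' : X.diam {x, z} = 1 := le_antisymm hdiam
    (hv ▸ X.vdist_le_diam (by simp) (by simp))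
  have hloc : X.IsLocal θ {x, z} := by
    refine ⟨by simp, fun u hu => ?_, by rw [hdiam']; simpa using hL⟩
    simp only [Finset.coe_insert, Finset.coe_singleton, Set.mem_insert_iff,
      Set.mem_singleton_iff] at hu
    rcases hu with rfl | rfl <;> assumption
  obtain ⟨⟨a, ha⟩, b, hb⟩ := h.exists_diamond _ hloc
  have hmem : ∀ u ∈ ({x, z} : Finset (Euc d)), u ∈ X.cover.vertices →
      {u} ∈ X.diamond t ({x, z} : Finset (Euc d)) := fun u hu huv =>
    ⟨a, b, ha, hb, ⟨huv, fun y hy => by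
      rw [Finset.mem_singleton.1 hy]; exact ha.2.1 u (Finset.mem_coe.2 hu)⟩, huv, fun y hy => by
      rw [Finset.mem_singleton.1 hy]; exact hb.2.1 u (Finset.mem_coe.2 hu)⟩
  have := h.diam_diamond _ hloc {x} (hmem x (by simp) hxv) {z} (hmem z (by simp) hzv) x (by simp)
    z (by simp)
  rw [hv, hdiam'] at this
  simpa using this

/-- Covering a ball of radius `1` by balls of radius `1 / 2` takes at least one ball. -/
theorem IsCausal.one_le_cB (h : X.IsCausal t k θ cB cD cP) (hL : 1 ≤ θ * X.linearSize) :
    1 ≤ cB * 2 ^ d := by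
  obtain ⟨s, hs, hc⟩ := X.exists_face
  obtain ⟨v, hv⟩ := X.cover.nonempty_of_mem_faces hs
  have hvv := X.mem_vertices_of_mem hs hv
  obtain ⟨U, -, hU, hcov⟩ := h.ball_cover v hvv (1 / 2) 1 (by norm_num) (by norm_num) hL
  obtain ⟨u, hu, -⟩ := hcov {v} hvv ⟨v, by simp, by simp [vdist_self]⟩
  have h1 : (1 : ℝ) ≤ U.card := by exact_mod_cast Finset.card_pos.2 ⟨u, hu⟩
  norm_num at hU
  linarith

end Constants

/-! ### Nearness of simplices of the torus -/

section Near

variable {k : ℕ}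

variable (X) in
/-- All vertices of the simplex `q` of the torus are within distance `D` of the simplex `q'`. -/
def NearAux (D : ℝ) (q q' : X.Cell k) : Prop :=
  ∀ κ, X.proj κ = q → ∀ x ∈ κ.1, ∃ κ', X.proj κ' = q' ∧ ∃ x' ∈ κ'.1, (X.vdist x x' : ℝ) ≤ D

variable (X) in
/-- The Hausdorff distance of the vertex sets of two simplices of the torus is at most `D`. -/
def Near (D : ℝ) (q q' : X.Cell k) : Prop := X.NearAux D q q' ∧ X.NearAux D q' q

theorem Near.symm {D : ℝ} {q q' : X.Cell k} (h : X.Near D q q') : X.Near D q' q := ⟨h.2, h.1⟩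

theorem Near.refl {D : ℝ} (hD : 0 ≤ D) (q : X.Cell k) : X.Near D q q := by
  have : X.NearAux D q q := fun κ hκ x hx => ⟨κ, hκ, x, hx, by rw [vdist_self]; simpa using hD⟩
  exact ⟨this, this⟩

theorem Near.mono {D D' : ℝ} (hD : D ≤ D') {q q' : X.Cell k} (h : X.Near D q q') :
    X.Near D' q q' := by
  constructor
  · intro κ hκ x hx
    obtain ⟨κ', hκ', x', hx', hd⟩ := h.1 κ hκ x hx
    exact ⟨κ', hκ', x', hx', hd.trans hD⟩
  · intro κ hκ x hx
    obtain ⟨κ', hκ', x', hx', hd⟩ := h.2 κ hκ x hx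
    exact ⟨κ', hκ', x', hx', hd.trans hD⟩

theorem mem_vertices_of_mem_cell (κ : X.CoverCell k) {x : Euc d} (hx : x ∈ κ.1) :
    x ∈ X.cover.vertices := X.mem_vertices_of_mem κ.2.1 hx

/-- The Hausdorff form makes distances add exactly; with the smallest distance between vertices, the
size of the middle simplex would enter. -/
theorem NearAux.trans {D D' : ℝ} {q q' q'' : X.Cell k} (h : X.NearAux D q q')
    (h' : X.NearAux D' q' q'') : X.NearAux (D + D') q q'' := by
  intro κ hκ x hx
  obtain ⟨κ', hκ', x', hx', hd⟩ := h κ hκ x hx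
  obtain ⟨κ'', hκ'', x'', hx'', hd'⟩ := h' κ' hκ' x' hx'
  refine ⟨κ'', hκ'', x'', hx'', ?_⟩
  have : (X.vdist x x'' : ℝ) ≤ X.vdist x x' + X.vdist x' x'' := by
    exact_mod_cast X.vdist_triangle (mem_vertices_of_mem_cell κ hx)
      (mem_vertices_of_mem_cell κ' hx') x''
  linarith

theorem Near.trans {D D' : ℝ} {q q' q'' : X.Cell k} (h : X.Near D q q') (h' : X.Near D' q' q'') :
    X.Near (D + D') q q'' :=
  ⟨h.1.trans h'.1, by rw [add_comm]; exact h'.2.trans h.2⟩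

theorem nearAux_of_vdist_le {D : ℝ} {κ κ' : X.CoverCell k} {x x' : Euc d} (hx : x ∈ κ.1)
    (hx' : x' ∈ κ'.1) (h : (X.vdist x x' : ℝ) ≤ D) : X.NearAux (D + 1) (X.proj κ) (X.proj κ') := by
  intro κ₁ hκ₁ y hy
  obtain ⟨a, ha, rfl⟩ := X.exists_shift_of_proj_eq hκ₁.symm
  refine ⟨X.shift a ha κ', X.proj_shift a ha κ', x' + a, add_mem_translate hx', ?_⟩
  have hxv := mem_vertices_of_mem_cell κ hx
  have hxv' := mem_vertices_of_mem_cell κ' hx'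
  have h1 : (X.vdist y (x + a) : ℝ) ≤ 1 := by
    exact_mod_cast X.vdist_le_one (X.shift a ha κ).2.1 hy (add_mem_translate hx)
  have h2 : (X.vdist (x + a) (x' + a) : ℝ) ≤ X.vdist x x' := by
    exact_mod_cast X.vdist_add_le ha hxv hxv'
  have h3 : (X.vdist y (x' + a) : ℝ) ≤ X.vdist y (x + a) + X.vdist (x + a) (x' + a) := by
    exact_mod_cast X.vdist_triangle (mem_vertices_of_mem_cell _ hy) (X.vertices_add ha hxv) _
  linarith

/-- Simplices with vertices at distance `D` have Hausdorff distance at most `D + 1`. -/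
theorem near_of_vdist_le {D : ℝ} {κ κ' : X.CoverCell k} {x x' : Euc d} (hx : x ∈ κ.1)
    (hx' : x' ∈ κ'.1) (h : (X.vdist x x' : ℝ) ≤ D) : X.Near (D + 1) (X.proj κ) (X.proj κ') :=
  ⟨nearAux_of_vdist_le hx hx' h, nearAux_of_vdist_le hx' hx (by rwa [vdist_comm])⟩

end Near

end TorusLattice

namespace TorusLattice

variable {d : ℕ} {X : TorusLattice d} {t : Euc d} {k : ℕ}

/-! ### Boundaries of sets of simplices of the cover -/

open scoped Classical in
theorem bdryCover_single_apply {k l : ℕ} (κ : X.CoverCell k) (ν : X.CoverCell l) :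
    X.bdryCover k l (Finsupp.single κ 1) ν = if ν.1 ⊆ κ.1 then 1 else 0 := by
  rw [bdryCover_single, Finsupp.finsetSum_apply]
  split_ifs with h
  · have hν : ν.1 ∈ κ.1.powersetCard (l + 1) := Finset.mem_powersetCard.2 ⟨h, ν.2.2⟩
    rw [Finset.sum_eq_single ⟨ν.1, hν⟩]
    · exact Finsupp.single_eq_same
    · intro ν' _ hne
      refine Finsupp.single_eq_of_ne fun h' => hne ?_
      exact Subtype.ext (congrArg Subtype.val h').symm
    · intro h'; exact absurd (Finset.mem_attach _ _) h'
  · refine Finset.sum_eq_zero fun ν' _ => Finsupp.single_eq_of_ne fun h' => h ?_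
    rw [h']; exact (Finset.mem_powersetCard.1 ν'.2).1

/-- Links the parity count in the definition of a Sweep Rule with the linear boundary operator. -/
theorem bdryCover_sum_apply {k l : ℕ} (φ : Finset (X.CoverCell k)) (ν : X.CoverCell l) :
    X.bdryCover k l (∑ κ ∈ φ, Finsupp.single κ 1) ν ≠ 0 ↔ ν ∈ X.coverBdry l φ := by
  classical
  rw [map_sum, Finsupp.finsetSum_apply]
  simp only [bdryCover_single_apply]
  rw [Finset.sum_boole, ZMod.natCast_ne_zero_iff_odd, coverBdry, Set.mem_ofPred_eq]
  rw [← Set.ncard_coe_finset, Finset.coe_filter]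

theorem projChain_apply_ne_zero {k : ℕ} {c : X.CoverChain k} {q : X.Cell k}
    (h : X.projChain k c q ≠ 0) : ∃ κ, X.proj κ = q ∧ c κ ≠ 0 := by
  classical
  have := Finsupp.mapDomain_support (f := X.proj) (s := c) (Finsupp.mem_support_iff.2 h)
  obtain ⟨κ, hκ, rfl⟩ := Finset.mem_image.1 this
  exact ⟨κ, rfl, Finsupp.mem_support_iff.1 hκ⟩

theorem projChain_apply_of_unique {k : ℕ} {c : X.CoverChain k} {κ : X.CoverCell k}
    (h : ∀ κ', X.proj κ' = X.proj κ → c κ' ≠ 0 → κ' = κ) :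
    X.projChain k c (X.proj κ) = c κ := by
  classical
  rw [projChain, Finsupp.lmapDomain_apply, Finsupp.mapDomain, Finsupp.sum, Finsupp.finsetSum_apply,
    Finset.sum_eq_single κ]
  · exact Finsupp.single_eq_same
  · intro κ' hκ' hne
    refine Finsupp.single_eq_of_ne fun h' => hne (h κ' h'.symm (Finsupp.mem_support_iff.1 hκ'))
  · intro hκ
    rw [Finsupp.notMem_support_iff.1 hκ, Finsupp.single_zero]; rfl

theorem exists_subset_of_mem_coverBdry {k l : ℕ} {φ : Finset (X.CoverCell k)} {ν : X.CoverCell l}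
    (h : ν ∈ X.coverBdry l φ) : ∃ κ ∈ φ, ν.1 ⊆ κ.1 := by
  have h : Odd {κ : X.CoverCell k | κ ∈ φ ∧ ν.1 ⊆ κ.1}.ncard := h
  obtain ⟨κ, hκ, hν⟩ := Set.nonempty_of_ncard_ne_zero h.pos.ne'
  exact ⟨κ, hκ, hν⟩

/-! ### Representatives of the vertices of the torus -/

theorem val_eq_point (s : X.CoverCell 0) : s.1 = {X.point s} :=
  (Finset.card_eq_one.mp s.2.2).choose_spec

/-- The vertex of the cover that represents a vertex of the torus. -/
def rep (v : X.Cell 0) : Euc d := X.point (X.lift v)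

theorem rep_mem (v : X.Cell 0) : X.rep v ∈ X.cover.vertices := by
  have := (X.lift v).2.1
  rw [val_eq_point] at this
  exact this

variable (X) in
/-- The vertex of the torus below a vertex of the cover. -/
def vertexCell (y : Euc d) (hy : y ∈ X.cover.vertices) : X.Cell 0 :=
  X.proj ⟨{y}, hy, Finset.card_singleton y⟩

theorem exists_rep_vertexCell {y : Euc d} (hy : y ∈ X.cover.vertices) :
    ∃ a ∈ X.period, X.rep (X.vertexCell y hy) = y + a := by
  obtain ⟨a, ha, h⟩ := X.exists_shift_of_proj_eq (X.proj_lift (X.vertexCell y hy)).symm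
  refine ⟨a, ha, ?_⟩
  have h1 : y + a ∈ (X.lift (X.vertexCell y hy)).1 := by
    rw [h]; exact add_mem_translate (by simp)
  rw [val_eq_point] at h1
  exact (Finset.mem_singleton.1 h1).symm

theorem eq_vertexCell_of_rep_eq {y a : Euc d} (hy : y ∈ X.cover.vertices) (ha : a ∈ X.period)
    {v : X.Cell 0} (h : X.rep v = y + a) : v = X.vertexCell y hy := by
  rw [← X.proj_lift v]
  refine (X.proj_eq_iff.2 ⟨a, ha, ?_⟩).symm
  rw [val_eq_point]
  ext z
  have h : X.point (X.lift v) = y + a := h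
  rw [h]
  simp only [mem_translate, Finset.mem_singleton, sub_eq_iff_eq_add]

/-! ### Restrictions and translations -/

theorem shift_mem_restr {l : ℕ} {σ : X.Chain l} {x a : Euc d} (ha : a ∈ X.period)
    {ν : X.CoverCell l} (h : ν ∈ X.restr σ x) : X.shift a ha ν ∈ X.restr σ (x + a) :=
  ⟨add_mem_translate h.1, by rw [proj_shift]; exact h.2⟩

/-- Walls live on the torus, so being trailing is periodic. The rule is applied only at
representatives; this transfers it to all lifts. -/
theorem Trailing.add {l : ℕ} {σ : X.Chain l} {x a : Euc d} (ha : a ∈ X.period)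
    (h : X.Trailing t σ x) : X.Trailing t σ (x + a) := by
  obtain ⟨⟨ν, hν⟩, h⟩ := h
  refine ⟨⟨_, shift_mem_restr ha hν⟩, fun ν' hν' => ⟨ν'.2.1, fun y hy => ?_⟩⟩
  have h1 := shift_mem_restr (X.period.neg_mem ha) hν'
  rw [add_neg_cancel_right] at h1
  have h2 := (h _ h1).2 (y + -a) (add_mem_translate hy)
  simpa using h2.add ha

/-! ### One step of the sweep rule -/

namespace SweepRule

variable (S : X.SweepRule t k) {σ : X.Chain (k - 1)}

/-- The set of `k`-simplices chosen by the rule at the vertex `v` for the domain wall `σ`. -/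
def push (σ : X.Chain (k - 1)) (v : X.Cell 0) : Finset (X.CoverCell k) :=
  S.φ v (X.restr σ (X.rep v))

/-- The boundary of the chain of the torus chosen by the rule at `v`. -/
def pushBdry (σ : X.Chain (k - 1)) (v : X.Cell 0) : X.Chain (k - 1) :=
  X.projChain (k - 1) (X.bdryCover k (k - 1) (∑ κ ∈ S.push σ v, Finsupp.single κ 1))

open scoped Classical in
theorem bdry_step (σ : X.Chain (k - 1)) : X.bdry k (k - 1) (S.step σ) =
    ∑ v : X.Cell 0, if X.Trailing t σ (X.rep v) then S.pushBdry σ v else 0 := by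
  rw [step, map_sum]
  refine Finset.sum_congr rfl fun v _ => ?_
  rw [apply_ite (X.bdry k (k - 1)), map_zero]
  refine if_congr Iff.rfl ?_ rfl
  have : X.projChain k (∑ κ ∈ S.push σ v, Finsupp.single κ 1) =
      ∑ κ ∈ S.push σ v, Finsupp.single (X.proj κ) 1 := by
    rw [map_sum]
    exact Finset.sum_congr rfl fun κ _ => X.projChain_single κ
  rw [pushBdry, ← bdry_projChain, this]
  rfl

theorem exists_of_pushBdry_ne_zero {v : X.Cell 0} {ν : X.CoverCell (k - 1)}
    (h : S.pushBdry σ v (X.proj ν) ≠ 0) :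
    ∃ a, ∃ ha : a ∈ X.period, X.shift a ha ν ∈ X.coverBdry (k - 1) (S.push σ v) := by
  obtain ⟨ν', hν', h'⟩ := projChain_apply_ne_zero h
  obtain ⟨a, ha, rfl⟩ := X.exists_shift_of_proj_eq hν'.symm
  exact ⟨a, ha, (bdryCover_sum_apply _ _).1 h'⟩

/-- A simplex of the new domain wall is one of the old one or is created by the rule. -/
theorem mem_or_mem_coverBdry {ν : X.CoverCell (k - 1)}
    (h : (σ + X.bdry k (k - 1) (S.step σ)) (X.proj ν) ≠ 0) :
    σ (X.proj ν) ≠ 0 ∨ ∃ v, X.Trailing t σ (X.rep v) ∧ ∃ a, ∃ ha : a ∈ X.period,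
      X.shift a ha ν ∈ X.coverBdry (k - 1) (S.push σ v) := by
  classical
  by_contra! hcon
  obtain ⟨h1, h2⟩ := hcon
  apply h
  rw [Finsupp.add_apply, h1, zero_add, bdry_step, Finsupp.finsetSum_apply]
  refine Finset.sum_eq_zero fun v _ => ?_
  split_ifs with hv
  · by_contra h3
    obtain ⟨a, ha, h4⟩ := S.exists_of_pushBdry_ne_zero h3
    exact h2 v hv a ha h4
  · rfl

theorem eq_of_ne_zero_iff {a b : ZMod 2} (h : a ≠ 0 ↔ b ≠ 0) : a = b := by
  revert a b; decide

/-- A vertex of the new domain wall is a vertex of the old one that is not trailing, or lies in the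
strict future of a trailing vertex, in a simplex chosen there. -/
theorem vertex_cases (hσ : σ ∈ LinearMap.range (X.bdry k (k - 1))) {ν : X.CoverCell (k - 1)}
    (h : (σ + X.bdry k (k - 1) (S.step σ)) (X.proj ν) ≠ 0) {y : Euc d} (hy : y ∈ ν.1) :
    ((X.restr σ y).Nonempty ∧ ¬ X.Trailing t σ y) ∨
      ∃ v, X.Trailing t σ (X.rep v) ∧ ∃ a ∈ X.period, ∃ κ ∈ S.push σ v, y + a ∈ κ.1 ∧
        y + a ≠ X.rep v := by
  classical
  by_contra! hcon
  obtain ⟨h1, h2⟩ := hcon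
  have hyv := mem_vertices_of_mem_cell ν hy
  set v₀ := X.vertexCell y hyv with hv₀
  obtain ⟨a₀, ha₀, hrep⟩ := exists_rep_vertexCell hyv
  rw [← hv₀] at hrep
  -- Under the negated conclusion, a push can produce a translate of `ν` only at the vertex of the
  -- torus below `y`.
  have hkey : ∀ v, X.Trailing t σ (X.rep v) → ∀ a (ha : a ∈ X.period),
      X.shift a ha ν ∈ X.coverBdry (k - 1) (S.push σ v) → y + a = X.rep v := by
    intro v hv a ha hmem
    obtain ⟨κ, hκ, hsub⟩ := exists_subset_of_mem_coverBdry hmem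
    exact h2 v hv a ha κ hκ (hsub (add_mem_translate hy))
  have hzero : ∀ v, v ≠ v₀ →
      (if X.Trailing t σ (X.rep v) then S.pushBdry σ v else 0) (X.proj ν) = 0 := by
    intro v hne
    split_ifs with hv
    · by_contra h3
      obtain ⟨a, ha, h4⟩ := S.exists_of_pushBdry_ne_zero h3
      exact hne (eq_vertexCell_of_rep_eq hyv ha (hkey v hv a ha h4).symm)
    · rfl
  apply h
  rw [Finsupp.add_apply, bdry_step, Finsupp.finsetSum_apply,
    Finset.sum_eq_single v₀ (fun v _ hne => hzero v hne) (fun h => absurd (Finset.mem_univ _) h)]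
  -- If that vertex is trailing, its push has boundary `σ` there and cancels `ν`. If not, `ν` was
  -- absent from `σ` and nothing creates it. Either way its new coefficient is zero.
  by_cases hT : X.Trailing t σ (X.rep v₀)
  · rw [if_pos hT, pushBdry, ← X.proj_shift a₀ ha₀ ν, projChain_apply_of_unique]
    · rw [eq_of_ne_zero_iff (a := σ (X.proj (X.shift a₀ ha₀ ν))), add_self_zmod_two]
      rw [bdryCover_sum_apply]
      have hb : ∀ ν' : X.CoverCell (k - 1), X.rep v₀ ∈ ν'.1 →
          (ν' ∈ X.coverBdry (k - 1) (S.push σ v₀) ↔ ν' ∈ X.restr σ (X.rep v₀)) := by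
        intro ν' hν'
        have := S.bdry_eq σ hσ v₀ hT
        constructor
        · intro h'
          have h'' : ν' ∈ {ν ∈ X.coverBdry (k - 1) (S.φ v₀ (X.restr σ (X.point (X.lift v₀)))) |
            X.point (X.lift v₀) ∈ ν.1} := ⟨h', hν'⟩
          rw [this] at h''
          exact h''
        · intro h'
          have h'' : ν' ∈ X.restr σ (X.point (X.lift v₀)) := h'
          rw [← this] at h''
          exact h''.1
      have hmem : X.rep v₀ ∈ (X.shift a₀ ha₀ ν).1 := by
        rw [hrep]; exact add_mem_translate hy
      rw [hb _ hmem]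
      exact ⟨fun h' => ⟨hmem, h'⟩, fun h' => h'.2⟩
    · intro ν' hν' h'
      obtain ⟨a, ha, rfl⟩ := X.exists_shift_of_proj_eq ((X.proj_shift a₀ ha₀ ν).symm.trans hν'.symm)
      have := hkey v₀ hT a ha ((bdryCover_sum_apply _ _).1 h')
      rw [hrep] at this
      obtain rfl := add_left_cancel this
      rfl
  · rw [if_neg hT]
    have : σ (X.proj ν) = 0 := by
      by_contra h3
      refine hT ?_
      rw [hrep]
      exact (h1 ⟨ν, hy, h3⟩).add ha₀
    rw [this]; rfl

end SweepRule

variable {θ cB cD cP : ℝ}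

theorem finite_cells_of_mem {l : ℕ} (x : Euc d) : {ν : X.CoverCell l | x ∈ ν.1}.Finite := by
  have h := X.finite_faces_meeting (B := {x}) Bornology.isBounded_singleton
  refine Set.Finite.of_finite_image (f := Subtype.val) (h.subset ?_)
    (fun _ _ _ _ h => Subtype.ext h)
  rintro _ ⟨ν, hν, rfl⟩
  exact ⟨ν.2.1, x, subset_convexHull ℝ _ hν, rfl⟩

/-- The simplices created by the rule at a vertex stay between all lower and upper bounds of the
domain wall at this vertex. -/
theorem SweepRule.between (S : X.SweepRule t k) (h : X.IsCausal t k θ cB cD cP)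
    (h2 : 2 ≤ θ * X.linearSize) {σ : X.Chain (k - 1)}
    (hσ : σ ∈ LinearMap.range (X.bdry k (k - 1))) {v : X.Cell 0}
    (hv : X.Trailing t σ (X.rep v)) {a b : Euc d} (ha : a ∈ X.cover.vertices)
    (hb : b ∈ X.cover.vertices)
    (hab : ∀ ν ∈ X.restr σ (X.rep v), ∀ y ∈ ν.1, X.Prec t a y ∧ X.Prec t y b)
    {ν : X.CoverCell (k - 1)} (hν : ν ∈ X.coverBdry (k - 1) (S.push σ v)) {y : Euc d}
    (hy : y ∈ ν.1) : X.Prec t a y ∧ X.Prec t y b := by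
  classical
  have hstar := S.star σ hσ v hv
  have hbdry := S.bdry_eq σ hσ v hv
  -- These vertices lie in a star, so their diameter is at most `2`, and `h2` makes them local.
  let V : Finset (Euc d) := ((S.push σ v).biUnion fun κ => κ.1).filter fun x =>
    x ∈ X.verts (X.coverBdry (k - 1) (S.push σ v))
  have hV : (V : Set (Euc d)) = X.verts (X.coverBdry (k - 1) (S.push σ v)) := by
    ext x
    simp only [V, Finset.coe_filter, Finset.mem_biUnion, Set.mem_ofPred_eq, and_iff_right_iff_imp]
    rintro ⟨ν', hν', hx⟩
    obtain ⟨κ, hκ, hsub⟩ := exists_subset_of_mem_coverBdry hν'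
    exact ⟨κ, hκ, hsub hx⟩
  have hyV : y ∈ V := by rw [← Finset.mem_coe, hV]; exact ⟨ν, hν, hy⟩
  have hclose : ∀ x ∈ V, x ∈ X.cover.vertices ∧ X.vdist (X.rep v) x ≤ 1 := by
    intro x hx
    obtain ⟨κ, hκ, hxκ⟩ := Finset.mem_biUnion.1 (Finset.mem_filter.1 hx).1
    exact ⟨mem_vertices_of_mem_cell κ hxκ, X.vdist_le_one κ.2.1 (hstar κ hκ).1 hxκ⟩
  have hloc : X.IsLocal θ V := by
    refine ⟨⟨y, hyV⟩, fun x hx => (hclose x hx).1, le_trans ?_ h2⟩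
    have : X.diam V ≤ 2 := X.diam_le fun x hx z hz => by
      have h3 := X.vdist_triangle (hclose x hx).1 (X.rep_mem v) z
      have h4 := (hclose x hx).2
      have h5 := (hclose z hz).2
      rw [vdist_comm] at h4
      omega
    exact_mod_cast this
  obtain ⟨⟨a', ha'⟩, b', hb'⟩ := h.exists_diamond V hloc
  have hmem : ν.1 ∈ X.diamond t (X.verts (X.coverBdry (k - 1) (S.push σ v))) := by
    rw [← hV]
    refine ⟨a', b', ha', hb', ⟨ν.2.1, fun z hz => ha'.2.1 z ?_⟩, ν.2.1, fun z hz => hb'.2.1 z ?_⟩ <;>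
    · rw [hV]; exact ⟨ν, hν, hz⟩
  have hd : X.diamond t (X.verts (X.coverBdry (k - 1) (S.push σ v))) =
    X.diamond t (X.verts (X.restr σ (X.rep v))) := S.diamond_eq σ hσ v hv
  rw [hd] at hmem
  -- Membership of `ν` in the common diamond supplies the infimum and supremum of `σ` at the vertex;
  -- `a` and `b` are bounds, hence beyond them.
  obtain ⟨a'', b'', ha'', hb'', hm1, hm2⟩ := hmem
  constructor
  · refine Prec.trans (ha''.2.2 a ha ?_) (hm1.2 y hy)
    rintro x ⟨ν', hν', hx⟩
    exact (hab ν' hν' x hx).1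
  · refine Prec.trans (hm2.2 y hy) (hb''.2.2 b hb ?_)
    rintro x ⟨ν', hν', hx⟩
    exact (hab ν' hν' x hx).2

end TorusLattice

namespace TorusLattice

variable {d : ℕ} {X : TorusLattice d} {t : Euc d} {k : ℕ} {θ cB cD cP : ℝ}

/-! ### The evolution of a domain wall -/

namespace SweepRule

variable (S : X.SweepRule t k)

/-- The domain wall after `n` steps. -/
def wall (σ : X.Chain (k - 1)) : ℕ → X.Chain (k - 1)
  | 0 => σ
  | n + 1 => wall σ n + X.bdry k (k - 1) (S.step (wall σ n))

/-- The accumulated correction after `n` steps. -/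
def corr (σ : X.Chain (k - 1)) : ℕ → X.Chain k
  | 0 => 0
  | n + 1 => corr σ n + S.step (S.wall σ n)

theorem wall_eq (σ : X.Chain (k - 1)) (n : ℕ) :
    S.wall σ n = σ + X.bdry k (k - 1) (S.corr σ n) := by
  induction n with
  | zero => simp [wall, corr]
  | succ n ih => rw [wall, corr, map_add, ← add_assoc, ← ih]

theorem wall_mem {σ : X.Chain (k - 1)} (hσ : σ ∈ LinearMap.range (X.bdry k (k - 1))) (n : ℕ) :
    S.wall σ n ∈ LinearMap.range (X.bdry k (k - 1)) := by
  rw [wall_eq]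
  exact Submodule.add_mem _ hσ ⟨_, rfl⟩

theorem step_zero : S.step 0 = 0 := by
  rw [step]
  refine Finset.sum_eq_zero fun v _ => if_neg ?_
  rintro ⟨⟨ν, hν⟩, -⟩
  exact hν.2 rfl

theorem wall_corr_of_le {σ : X.Chain (k - 1)} {n m : ℕ} (hnm : n ≤ m) (h : S.wall σ n = 0) :
    S.wall σ m = 0 ∧ S.corr σ m = S.corr σ n := by
  induction m, hnm using Nat.le_induction with
  | base => exact ⟨h, rfl⟩
  | succ m _ ih =>
    rw [wall, corr, ih.1, ih.2, step_zero, map_zero, add_zero, add_zero]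
    exact ⟨rfl, rfl⟩

/-- With `n` rounds left at step `j`, the loop tests the walls `j, …, j + n - 1`; here `i` is the
first of them that vanishes. -/
theorem loop_eq (σ : X.Chain (k - 1)) {T : ℕ} (hT : S.wall σ T = 0) (j n : ℕ) (hj : j ≤ T)
    (hjn : T < j + n) :
    ∃ i, S.wall σ i = 0 ∧ S.loop n (S.wall σ j) (S.corr σ j) = some (S.corr σ i) := by
  induction n generalizing j with
  | zero => omega
  | succ n ih =>
    by_cases h : S.wall σ j = 0
    · exact ⟨j, h, by rw [loop, if_pos h]⟩
    · rw [loop, if_neg h]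
      refine ih (j + 1) (Nat.lt_of_le_of_ne hj ?_) (by omega)
      rintro rfl
      exact h hT

end SweepRule

/-- A local set of vertices with its infimum and supremum, small compared with the torus. -/
structure Region (X : TorusLattice d) (t : Euc d) (θ cD : ℝ) where
  V : Finset (Euc d)
  bot : Euc d
  top : Euc d
  isLocal : X.IsLocal θ V
  isInf : X.IsInf t V bot
  isSup : X.IsSup t V top
  lt_size : cD * X.diam V + 2 < X.linearSize
  le_size : cD * X.diam V ≤ θ * X.linearSize

namespace Region

variable (Z : Region X t θ cD)

/-- The vertices of the causal diamond. -/
def hull : Set (Euc d) := {y | X.Prec t Z.bot y ∧ X.Prec t y Z.top}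

theorem mem_vertices {y : Euc d} (hy : y ∈ Z.hull) : y ∈ X.cover.vertices := by
  obtain ⟨⟨n, hn⟩, -⟩ := hy
  exact hn.right_mem

theorem subset_hull {y : Euc d} (hy : y ∈ Z.V) : y ∈ Z.hull :=
  ⟨Z.isInf.2.1 y hy, Z.isSup.2.1 y hy⟩

theorem bot_mem : Z.bot ∈ Z.hull := by
  obtain ⟨y, hy⟩ := Z.isLocal.1
  exact ⟨Prec.refl Z.isInf.1, (Z.subset_hull hy).1.trans (Z.subset_hull hy).2⟩

theorem vdist_le (h : X.IsCausal t k θ cB cD cP) {y z : Euc d} (hy : y ∈ Z.hull)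
    (hz : z ∈ Z.hull) : (X.vdist y z : ℝ) ≤ cD * X.diam Z.V := by
  have hd : ∀ y ∈ Z.hull, {y} ∈ X.diamond t (Z.V : Set (Euc d)) := fun y hy =>
    ⟨Z.bot, Z.top, Z.isInf, Z.isSup, ⟨Z.mem_vertices hy, fun z hz => by
      rw [Finset.mem_singleton.1 hz]; exact hy.1⟩, Z.mem_vertices hy, fun z hz => by
      rw [Finset.mem_singleton.1 hz]; exact hy.2⟩
  exact h.diam_diamond Z.V Z.isLocal {y} (hd y hy) {z} (hd z hz) y (by simp) z (by simp)

/-- Two translates by periods of points close to the diamond coincide if the points do. -/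
theorem period_eq (h : X.IsCausal t k θ cB cD cP) {y y' z z' a : Euc d} (hy : y ∈ Z.hull)
    (hz : z ∈ Z.hull) (hy' : y' ∈ X.cover.vertices)
    (hyy : X.vdist y' y ≤ 1) (hzz : X.vdist z z' ≤ 1) (ha : a ∈ X.period) (he : z' = y' + a) :
    a = 0 := by
  refine X.eq_zero_of_vdist_lt hy' ha ?_
  rw [← he]
  have h1 := X.vdist_triangle hy' (Z.mem_vertices hy) z'
  have h2 := X.vdist_triangle (Z.mem_vertices hy) (Z.mem_vertices hz) z'
  have h3 := Z.vdist_le h hy hz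
  have h4 := Z.lt_size
  -- The `2` in `lt_size` pays for the two possible edges outside the diamond.
  have h5 : (X.vdist y' z' : ℝ) ≤ X.vdist y z + 2 := by
    have : X.vdist y' z' ≤ X.vdist y z + 2 := by omega
    exact_mod_cast this
  have h6 : (X.vdist y' z' : ℝ) < X.linearSize := by linarith
  exact_mod_cast h6

theorem period_eq_of_sub_mem (h : X.IsCausal t k θ cB cD cP) {x a b : Euc d}
    (ha : a ∈ X.period) (hb : b ∈ X.period) (hxa : x - a ∈ Z.hull) (hxb : x - b ∈ Z.hull) :
    a = b := by
  have := Z.period_eq h hxa hxb (Z.mem_vertices hxa)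
    (by rw [vdist_self]; exact zero_le_one) (by rw [vdist_self]; exact zero_le_one)
    (X.period.sub_mem ha hb) (by abel)
  exact sub_eq_zero.1 this

/-- The invariant of the evolution of the domain wall of the error `K` in the region `Z`: after `n`
steps, every simplex is in a translate of the diamond, its vertices are the end points of causal
paths of length at least `n` from the infimum, and they are within distance `n` of `K`. -/
def Confined (K : Finset (X.Cell k)) (σ : X.Chain (k - 1)) (n : ℕ) : Prop :=
  ∀ ν : X.CoverCell (k - 1), σ (X.proj ν) ≠ 0 →
    (∃ a ∈ X.period, ∀ y ∈ ν.1, y - a ∈ Z.hull ∧ ∃ m, n ≤ m ∧ X.CausalPath t Z.bot (y - a) m) ∧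
    ∀ y ∈ ν.1, ∃ κ : X.CoverCell k, X.proj κ ∈ K ∧ ∃ z ∈ κ.1, X.vdist y z ≤ n

variable {Z} {K : Finset (X.Cell k)} {S : X.SweepRule t k}

theorem Confined.next {σ : X.Chain (k - 1)} {n : ℕ} (hc : Z.Confined K σ n)
    (h : X.IsCausal t k θ cB cD cP) (h2 : 2 ≤ θ * X.linearSize)
    (hσ : σ ∈ LinearMap.range (X.bdry k (k - 1))) :
    Z.Confined K (σ + X.bdry k (k - 1) (S.step σ)) (n + 1) := by
  intro ν hν
  have hin : ∃ a ∈ X.period, ∀ y ∈ ν.1, y - a ∈ Z.hull := by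
    rcases S.mem_or_mem_coverBdry hν with hold | ⟨v, hv, b, hb, hmem⟩
    · obtain ⟨⟨a, ha, h'⟩, -⟩ := hc ν hold
      exact ⟨a, ha, fun y hy => (h' y hy).1⟩
    · obtain ⟨ν₀, hν₀⟩ := hv.1
      obtain ⟨⟨a, ha, ha'⟩, -⟩ := hc ν₀ hν₀.2
      refine ⟨a - b, X.period.sub_mem ha hb, fun y hy => ?_⟩
      have hall : ∀ ν' ∈ X.restr σ (X.rep v), ∀ y ∈ ν'.1,
          X.Prec t (Z.bot + a) y ∧ X.Prec t y (Z.top + a) := by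
        intro ν' hν' y hy
        obtain ⟨⟨a', hap, ha''⟩, -⟩ := hc ν' hν'.2
        obtain rfl : a = a' := Z.period_eq_of_sub_mem h ha hap (ha' _ hν₀.1).1 (ha'' _ hν'.1).1
        have := (ha'' y hy).1
        exact ⟨by simpa using this.1.add ha, by simpa using this.2.add ha⟩
      have := S.between h h2 hσ hv (X.vertices_add ha Z.isInf.1) (X.vertices_add ha Z.isSup.1) hall
        hmem (add_mem_translate hy)
      rw [show y - (a - b) = y + b - a by abel]
      exact ⟨by simpa using this.1.sub ha, by simpa using this.2.sub ha⟩
  obtain ⟨a, ha, hin⟩ := hin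
  refine ⟨⟨a, ha, fun y hy => ⟨hin y hy, ?_⟩⟩, fun y hy => ?_⟩
  · rcases S.vertex_cases hσ hν hy with ⟨⟨ν₀, hν₀⟩, hnt⟩ | ⟨v, hv, b, hb, κ, hκ, hyκ, hne⟩
    · have : ∃ ν₁ ∈ X.restr σ y, ν₁.1 ∉ X.future t y := by
        by_contra! hcon
        exact hnt ⟨⟨ν₀, hν₀⟩, hcon⟩
      obtain ⟨ν₁, hν₁, hnf⟩ := this
      obtain ⟨u, hu, hyu⟩ : ∃ u ∈ ν₁.1, ¬ X.Prec t y u := by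
        by_contra! hcon
        exact hnf ⟨ν₁.2.1, hcon⟩
      have hyu' : y ≠ u := by
        rintro rfl
        exact hyu (Prec.refl (mem_vertices_of_mem_cell ν₁ hu))
      have hpath : X.CausalPath t u y 1 :=
        (h.sweep.edge_total (X.adj_of_mem ν₁.2.1 hν₁.1 hu hyu')).resolve_left
          fun hp => hyu ⟨1, hp⟩
      obtain ⟨⟨a', hap, ha'⟩, -⟩ := hc ν₁ hν₁.2
      obtain rfl : a = a' := Z.period_eq_of_sub_mem h ha hap (hin y hy) (ha' y hν₁.1).1
      obtain ⟨m, hm, hp⟩ := (ha' u hu).2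
      exact ⟨m + 1, by omega, hp.trans (hpath.sub ha)⟩
    · obtain ⟨ν₀, hν₀⟩ := hv.1
      obtain ⟨⟨a', hap, ha'⟩, -⟩ := hc ν₀ hν₀.2
      obtain ⟨hx, m, hm, hp⟩ := ha' _ hν₀.1
      have hst := S.star σ hσ v hv κ hκ
      obtain ⟨m', hm', hp'⟩ := (hst.2.2 _ hyκ).exists_pos hne.symm
      have hyb := mem_vertices_of_mem_cell κ hyκ
      have hyv := mem_vertices_of_mem_cell ν hy
      have h0 : a - (a' - b) = 0 := by
        refine Z.period_eq (z' := y + b - a') h (hin y hy) hx (X.vertices_sub ha hyv)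
          (by rw [vdist_self]; exact zero_le_one) ?_
          (X.period.sub_mem ha (X.period.sub_mem hap hb)) (by abel)
        rw [X.vdist_sub hap (X.rep_mem v) hyb]
        exact X.vdist_le_one κ.2.1 hst.1 hyκ
      refine ⟨m + m', by omega, ?_⟩
      have := hp.trans (hp'.sub hap)
      rwa [show y + b - a' = y - a by rw [sub_eq_zero.1 h0]; abel] at this
  · rcases S.vertex_cases hσ hν hy with ⟨⟨ν₀, hν₀⟩, -⟩ | ⟨v, hv, b, hb, κ, hκ, hyκ, -⟩
    · obtain ⟨κ, hκ, z, hz, hd⟩ := (hc ν₀ hν₀.2).2 y hν₀.1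
      exact ⟨κ, hκ, z, hz, by omega⟩
    · obtain ⟨ν₀, hν₀⟩ := hv.1
      obtain ⟨κ', hκ', z, hz, hd⟩ := (hc ν₀ hν₀.2).2 _ hν₀.1
      have hst := S.star σ hσ v hv κ hκ
      have hyb := mem_vertices_of_mem_cell κ hyκ
      have hzv := mem_vertices_of_mem_cell κ' hz
      refine ⟨X.shift (-b) (X.period.neg_mem hb) κ', by rwa [proj_shift], z + -b,
        add_mem_translate hz, ?_⟩
      have h1 := X.vdist_le_one κ.2.1 hyκ hst.1
      have h3 := X.vdist_triangle hyb (X.rep_mem v) z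
      have h4 := X.vdist_sub hb hyb hzv
      rw [add_sub_cancel_right] at h4
      rw [← sub_eq_add_neg, h4]
      have h1' : X.vdist (y + b) (X.rep v) ≤ 1 := h1
      have hd' : X.vdist (X.rep v) z ≤ n := hd
      omega

theorem Confined.wall {σ : X.Chain (k - 1)} (hc : Z.Confined K σ 0)
    (h : X.IsCausal t k θ cB cD cP) (h2 : 2 ≤ θ * X.linearSize)
    (hσ : σ ∈ LinearMap.range (X.bdry k (k - 1))) (n : ℕ) : Z.Confined K (S.wall σ n) n := by
  induction n with
  | zero => exact hc
  | succ n ih => exact ih.next h h2 (S.wall_mem hσ n)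

/-- A confined domain wall disappears after the time given by the size of the diamond. -/
theorem Confined.time_le {σ : X.Chain (k - 1)} {n : ℕ} (hc : Z.Confined K σ n)
    (h : X.IsCausal t k θ cB cD cP) (hcP : 0 ≤ cP) (hk : 2 ≤ k) (hne : σ ≠ 0) :
    (n + 1 : ℝ) ≤ cP * (cD * X.diam Z.V) := by
  obtain ⟨q, hq⟩ := Finsupp.ne_iff.1 hne
  rw [← X.proj_lift q] at hq
  obtain ⟨⟨a, ha, h'⟩, -⟩ := hc _ hq
  obtain ⟨u, hu, w, hw, huw⟩ := Finset.one_lt_card.1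
    (show 1 < (X.lift q).1.card by rw [(X.lift q).2.2]; omega)
  obtain ⟨u, hu, w, hw, hp⟩ : ∃ u ∈ (X.lift q).1, ∃ w ∈ (X.lift q).1, X.CausalPath t u w 1 := by
    rcases h.sweep.edge_total (X.adj_of_mem (X.lift q).2.1 hu hw huw) with hp | hp
    · exact ⟨u, hu, w, hw, hp⟩
    · exact ⟨w, hw, u, hu, hp⟩
  obtain ⟨-, m, hm, hpm⟩ := h' u hu
  have hd := Z.vdist_le h Z.bot_mem (h' w hw).1
  have := h.path_length _ _ (hd.trans Z.le_size) _ (hpm.trans (hp.sub ha))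
  have hm' : (n : ℝ) ≤ m := by exact_mod_cast hm
  push_cast at this
  nlinarith

/-- The initial domain wall of an error in the region. -/
theorem confined_bdry (hK : ∀ q ∈ K, ∃ κ : X.CoverCell k, X.proj κ = q ∧ κ.1 ⊆ Z.V) :
    Z.Confined K (X.bdry k (k - 1) (X.chainOf K)) 0 := by
  intro ν hν
  rw [chainOf, map_sum, Finsupp.finsetSum_apply] at hν
  obtain ⟨q, hq, hne⟩ := Finset.exists_ne_zero_of_sum_ne_zero hν
  obtain ⟨κ, rfl, hκ⟩ := hK q hq
  rw [bdry_single] at hne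
  obtain ⟨ν', hν', hne'⟩ := projChain_apply_ne_zero hne
  rw [bdryCover_single_apply] at hne'
  have hsub : ν'.1 ⊆ κ.1 := by
    by_contra hcon
    exact hne' (if_neg hcon)
  obtain ⟨a, ha, rfl⟩ := X.exists_shift_of_proj_eq hν'
  have hmem : ∀ y ∈ (X.shift a ha ν').1, y - a ∈ κ.1 := fun y hy => hsub (mem_translate.1 hy)
  refine ⟨⟨a, ha, fun y hy => ?_⟩, fun y hy => ⟨X.shift a ha κ, by rwa [proj_shift], y, ?_, ?_⟩⟩
  · have := Z.subset_hull (hκ (hmem y hy))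
    obtain ⟨m, hm⟩ := this.1
    exact ⟨this, m, Nat.zero_le _, hm⟩
  · exact mem_translate.2 (hmem y hy)
  · rw [vdist_self]

theorem corr_mem {σ : X.Chain (k - 1)} (hc : Z.Confined K σ 0)
    (h : X.IsCausal t k θ cB cD cP) (h2 : 2 ≤ θ * X.linearSize)
    (hσ : σ ∈ LinearMap.range (X.bdry k (k - 1))) (n : ℕ) (κ : X.CoverCell k)
    (hκ : S.corr σ n (X.proj κ) ≠ 0) :
    ∃ a ∈ X.period, ∀ y ∈ κ.1, ∃ w ∈ Z.hull, X.vdist (y - a) w ≤ 1 := by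
  classical
  induction n with
  | zero => exact absurd rfl hκ
  | succ n ih =>
    rw [SweepRule.corr, Finsupp.add_apply] at hκ
    by_cases h0 : S.corr σ n (X.proj κ) = 0
    swap
    · exact ih h0
    rw [h0, zero_add, SweepRule.step, Finsupp.finsetSum_apply] at hκ
    obtain ⟨v, -, hne⟩ := Finset.exists_ne_zero_of_sum_ne_zero hκ
    split_ifs at hne with hv
    swap
    · exact absurd rfl hne
    rw [Finsupp.finsetSum_apply] at hne
    obtain ⟨κ', hκ', hne'⟩ := Finset.exists_ne_zero_of_sum_ne_zero hne
    have hpr : X.proj κ = X.proj κ' := by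
      by_contra hcon
      exact hne' (Finsupp.single_eq_of_ne hcon)
    obtain ⟨b, hb, rfl⟩ := X.exists_shift_of_proj_eq hpr
    have hst := S.star _ (S.wall_mem hσ n) v hv _ hκ'
    obtain ⟨ν₀, hν₀⟩ := hv.1
    obtain ⟨⟨a, ha, h'⟩, -⟩ := hc.wall (S := S) h h2 hσ n ν₀ hν₀.2
    refine ⟨a - b, X.period.sub_mem ha hb, fun y hy => ⟨_, (h' _ hν₀.1).1, ?_⟩⟩
    have hyb : y + b ∈ (X.shift b hb κ).1 := add_mem_translate hy
    rw [show y - (a - b) = y + b - a by abel]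
    exact (X.vdist_sub ha (mem_vertices_of_mem_cell _ hyb) (X.rep_mem v)).le.trans
      (X.vdist_le_one (X.shift b hb κ).2.1 hyb hst.1)

/-- The correction of a confined error is equivalent to the error. -/
theorem corr_add_mem_range (hk : 2 ≤ k)
    (hK : ∀ q ∈ K, ∃ κ : X.CoverCell k, X.proj κ = q ∧ κ.1 ⊆ Z.V)
    (h : X.IsCausal t k θ cB cD cP) (h2 : 2 ≤ θ * X.linearSize) {n : ℕ}
    (h0 : S.wall (X.bdry k (k - 1) (X.chainOf K)) n = 0) :
    S.corr (X.bdry k (k - 1) (X.chainOf K)) n + X.chainOf K ∈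
      LinearMap.range (X.bdry (k + 1) k) := by
  classical
  have hσ : X.bdry k (k - 1) (X.chainOf K) ∈ LinearMap.range (X.bdry k (k - 1)) := ⟨_, rfl⟩
  refine X.mem_range_bdry_of_local (l := k - 1) (by omega)
    (W := {y | y ∈ X.cover.vertices ∧ ∃ w ∈ Z.hull, X.vdist y w ≤ 1}) ?_ ?_ ?_
  · rw [map_add, add_comm, ← S.wall_eq, h0]
  · rintro x ⟨hx, w, hw, hxw⟩ a ha ⟨-, w', hw', hxw'⟩
    exact Z.period_eq h hw hw' hx hxw (by rwa [vdist_comm]) ha rfl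
  · intro κ hκ
    suffices hs : ∃ a ∈ X.period, ∀ y ∈ κ.1, ∃ w ∈ Z.hull, X.vdist (y - a) w ≤ 1 by
      obtain ⟨a, ha, h'⟩ := hs
      exact ⟨a, ha, fun y hy => ⟨X.vertices_sub ha (mem_vertices_of_mem_cell κ hy), h' y hy⟩⟩
    by_cases hc : S.corr (X.bdry k (k - 1) (X.chainOf K)) n (X.proj κ) = 0
    swap
    · exact corr_mem (confined_bdry hK) h h2 hσ n κ hc
    rw [Finsupp.add_apply, hc, zero_add, chainOf, Finsupp.finsetSum_apply] at hκ
    obtain ⟨q, hq, hne⟩ := Finset.exists_ne_zero_of_sum_ne_zero hκ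
    have hqκ : X.proj κ = q := by
      by_contra hcon
      exact hne (Finsupp.single_eq_of_ne hcon)
    obtain ⟨κ', hκ', hV⟩ := hK q hq
    obtain ⟨a, ha, rfl⟩ := X.exists_shift_of_proj_eq (hκ'.trans hqκ.symm)
    refine ⟨a, ha, fun y hy => ⟨y - a, Z.subset_hull (hV (mem_translate.1 hy)), ?_⟩⟩
    rw [vdist_self]; exact zero_le_one

end Region

end TorusLattice

namespace TorusLattice

variable {d : ℕ} {X : TorusLattice d} {t : Euc d} {k : ℕ} {θ cB cD cP : ℝ}

/-! ### Superposition of non-interacting domain walls -/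

namespace SweepRule

variable (S : X.SweepRule t k)

open scoped Classical in
/-- The contribution of the vertex `v` to a step. -/
def stepAt (σ : X.Chain (k - 1)) (v : X.Cell 0) : X.Chain k :=
  if X.Trailing t σ (X.rep v) then ∑ κ ∈ S.push σ v, Finsupp.single (X.proj κ) 1 else 0

theorem step_eq (σ : X.Chain (k - 1)) : S.step σ = ∑ v, S.stepAt σ v := rfl

theorem stepAt_congr {σ σ' : X.Chain (k - 1)} {v : X.Cell 0}
    (h : X.restr σ (X.rep v) = X.restr σ' (X.rep v)) : S.stepAt σ v = S.stepAt σ' v := by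
  classical
  have hT : X.Trailing t σ (X.rep v) ↔ X.Trailing t σ' (X.rep v) := by simp only [Trailing, h]
  exact if_congr hT (by rw [push, push, h]) rfl

theorem stepAt_eq_zero {σ : X.Chain (k - 1)} {v : X.Cell 0}
    (h : ¬ (X.restr σ (X.rep v)).Nonempty) : S.stepAt σ v = 0 :=
  if_neg fun h' => h h'.1

/-- Domain walls that do not meet are moved independently. -/
theorem step_sum {ι : Type*} [Fintype ι] {f : ι → X.Chain (k - 1)}
    (h : ∀ i j, i ≠ j → ∀ x, ¬ ((X.restr (f i) x).Nonempty ∧ (X.restr (f j) x).Nonempty)) :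
    S.step (∑ i, f i) = ∑ i, S.step (f i) := by
  classical
  simp only [step_eq]
  rw [Finset.sum_comm]
  refine Finset.sum_congr rfl fun v _ => ?_
  by_cases hex : ∃ i, (X.restr (f i) (X.rep v)).Nonempty
  · obtain ⟨i, hi⟩ := hex
    have hj : ∀ j, j ≠ i → ¬ (X.restr (f j) (X.rep v)).Nonempty := fun j hji hj =>
      h j i hji _ ⟨hj, hi⟩
    rw [Finset.sum_eq_single i (fun j _ hji => S.stepAt_eq_zero (hj j hji))
      (fun h' => absurd (Finset.mem_univ _) h')]
    refine S.stepAt_congr (Set.ext fun ν => and_congr_right fun hν => ?_)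
    rw [Finsupp.finsetSum_apply, Finset.sum_eq_single i _
      (fun h' => absurd (Finset.mem_univ _) h')]
    intro j _ hji
    by_contra hne
    exact hj j hji ⟨ν, hν, hne⟩
  · rw [Finset.sum_eq_zero fun i _ => S.stepAt_eq_zero fun hi => hex ⟨i, hi⟩]
    refine S.stepAt_eq_zero ?_
    rintro ⟨ν, hν, hne⟩
    rw [Finsupp.finsetSum_apply] at hne
    obtain ⟨i, -, hi⟩ := Finset.exists_ne_zero_of_sum_ne_zero hne
    exact hex ⟨i, ν, hν, hi⟩

theorem wall_corr_sum {ι : Type*} [Fintype ι] {f : ι → X.Chain (k - 1)}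
    (h : ∀ n i j, i ≠ j → ∀ x,
      ¬ ((X.restr (S.wall (f i) n) x).Nonempty ∧ (X.restr (S.wall (f j) n) x).Nonempty)) (n : ℕ) :
    S.wall (∑ i, f i) n = ∑ i, S.wall (f i) n ∧ S.corr (∑ i, f i) n = ∑ i, S.corr (f i) n := by
  induction n with
  | zero => exact ⟨rfl, by simp [corr]⟩
  | succ n ih =>
    simp only [wall, corr, Finset.sum_add_distrib, ih.1, ih.2, S.step_sum (h n), map_sum]
    exact ⟨trivial, trivial⟩

end SweepRule

/-- Confined domain walls that meet belong to errors that are close to each other, compared with the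
size of the region of the first one. -/
theorem Region.Confined.exists_near {Z Z' : Region X t θ cD} {K K' : Finset (X.Cell k)}
    {σ σ' : X.Chain (k - 1)} {n : ℕ} (hc : Z.Confined K σ n) (hc' : Z'.Confined K' σ' n)
    (hK : ∀ q ∈ K, ∃ κ : X.CoverCell k, X.proj κ = q ∧ κ.1 ⊆ Z.V)
    (h : X.IsCausal t k θ cB cD cP) (hcP : 0 ≤ cP) (hk : 2 ≤ k) {x : Euc d}
    (hx : (X.restr σ x).Nonempty) (hx' : (X.restr σ' x).Nonempty) :
    ∃ q ∈ K, ∃ q' ∈ K', X.Near (cD * X.diam Z.V + cP * (cD * X.diam Z.V)) q q' := by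
  obtain ⟨ν, hν⟩ := hx
  obtain ⟨ν', hν'⟩ := hx'
  have hne : σ ≠ 0 := by rintro rfl; exact hν.2 rfl
  have htime := hc.time_le h hcP hk hne
  obtain ⟨⟨a, ha, hin⟩, hdist⟩ := hc ν hν.2
  obtain ⟨-, hdist'⟩ := hc' ν' hν'.2
  obtain ⟨κ₀, hκ₀, -⟩ := hdist x hν.1
  obtain ⟨κ, hκ, hV⟩ := hK _ hκ₀
  obtain ⟨z, hz⟩ := X.cover.nonempty_of_mem_faces κ.2.1
  obtain ⟨κ', hκ', y, hy, hxy⟩ := hdist' x hν'.1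
  refine ⟨_, hκ ▸ hκ₀, _, hκ', ?_⟩
  have hzv := mem_vertices_of_mem_cell κ hz
  have hxv := mem_vertices_of_mem_cell ν hν.1
  have h1 := Z.vdist_le h (Z.subset_hull (hV hz)) (hin x hν.1).1
  have h2 := X.vdist_sub ha (X.vertices_add ha hzv) hxv
  rw [add_sub_cancel_right] at h2
  rw [h2] at h1
  have h3 : (X.vdist (z + a) y : ℝ) ≤ X.vdist (z + a) x + X.vdist x y := by
    exact_mod_cast X.vdist_triangle (X.vertices_add ha hzv) hxv y
  have h4 : (X.vdist x y : ℝ) ≤ n := by exact_mod_cast hxy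
  rw [← X.proj_shift a ha κ]
  exact (near_of_vdist_le (κ := X.shift a ha κ) (add_mem_translate hz) hy
    (h3.trans (add_le_add h1 h4))).mono (by linarith)

/-- The decoder corrects errors that consist of clusters that are far apart compared with the size
of the smaller one. -/
theorem SweepRule.succeeds_of_clusters (S : X.SweepRule t k) (h : X.IsCausal t k θ cB cD cP)
    (hk : 2 ≤ k) (h2 : 2 ≤ θ * X.linearSize) (hcP : 0 ≤ cP) {ε : Finset (X.Cell k)} {ι : Type*}
    [Fintype ι] (K : ι → Finset (X.Cell k)) (hε : X.chainOf ε = ∑ i, X.chainOf (K i))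
    (Z : ι → Region X t θ cD)
    (hK : ∀ i, ∀ q ∈ K i, ∃ κ : X.CoverCell k, X.proj κ = q ∧ κ.1 ⊆ (Z i).V)
    (hsep : ∀ i j, i ≠ j →
      (∀ q ∈ K i, ∀ q' ∈ K j,
        ¬ X.Near (cD * X.diam (Z i).V + cP * (cD * X.diam (Z i).V)) q q') ∨
      (∀ q ∈ K j, ∀ q' ∈ K i,
        ¬ X.Near (cD * X.diam (Z j).V + cP * (cD * X.diam (Z j).V)) q q'))
    {N Tmax : ℕ} (hN : ∀ i, cP * (cD * X.diam (Z i).V) < N + 1) (hT : N < Tmax) :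
    S.Succeeds Tmax ε := by
  have hσ : ∀ i, X.bdry k (k - 1) (X.chainOf (K i)) ∈ LinearMap.range (X.bdry k (k - 1)) :=
    fun i => ⟨_, rfl⟩
  have hconf : ∀ n i, (Z i).Confined (K i) (S.wall (X.bdry k (k - 1) (X.chainOf (K i))) n) n :=
    fun n i => (Region.confined_bdry (hK i)).wall h h2 (hσ i) n
  have hdisj : ∀ n i j, i ≠ j → ∀ x,
      ¬ ((X.restr (S.wall (X.bdry k (k - 1) (X.chainOf (K i))) n) x).Nonempty ∧
        (X.restr (S.wall (X.bdry k (k - 1) (X.chainOf (K j))) n) x).Nonempty) := by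
    rintro n i j hij x ⟨hi, hj⟩
    rcases hsep i j hij with hs | hs
    · obtain ⟨q, hq, q', hq', hn⟩ := (hconf n i).exists_near (hconf n j) (hK i) h hcP hk hi hj
      exact hs q hq q' hq' hn
    · obtain ⟨q, hq, q', hq', hn⟩ := (hconf n j).exists_near (hconf n i) (hK j) h hcP hk hj hi
      exact hs q hq q' hq' hn
  have hzero : ∀ i, S.wall (X.bdry k (k - 1) (X.chainOf (K i))) N = 0 := by
    intro i
    by_contra hne
    exact absurd ((hconf N i).time_le h hcP hk hne) (not_le.2 (hN i))
  have hsum := S.wall_corr_sum hdisj N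
  have hεb : X.bdry k (k - 1) (X.chainOf ε) = ∑ i, X.bdry k (k - 1) (X.chainOf (K i)) := by
    rw [hε, map_sum]
  rw [← hεb] at hsum
  have hwN : S.wall (X.bdry k (k - 1) (X.chainOf ε)) N = 0 := by
    rw [hsum.1]; exact Finset.sum_eq_zero fun i _ => hzero i
  obtain ⟨i, hi, hloop⟩ := S.loop_eq _ hwN 0 Tmax (Nat.zero_le _) (by omega)
  refine ⟨_, hloop, ?_⟩
  have hcorr : S.corr (X.bdry k (k - 1) (X.chainOf ε)) i =
      S.corr (X.bdry k (k - 1) (X.chainOf ε)) N := by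
    rcases le_total i N with hle | hle
    · exact (S.wall_corr_of_le hle hi).2.symm
    · exact (S.wall_corr_of_le hle hwN).2
  rw [hcorr, hsum.2, hε, ← Finset.sum_add_distrib]
  exact Submodule.sum_mem _ fun i _ => Region.corr_add_mem_range hk (hK i) h h2 (hzero i)

end TorusLattice

/-! ### Clusters and chunks -/

section Chunks

variable {α : Type*}

/-- A family of relations that behaves like `dist q q' ≤ D`. -/
structure IsNearness (near : ℝ → α → α → Prop) : Prop where
  refl : ∀ D, 0 ≤ D → ∀ q, near D q q
  symm : ∀ D q q', near D q q' → near D q' q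
  trans : ∀ D D' q q' q'', near D q q' → near D' q' q'' → near (D + D') q q''
  mono : ∀ D D', D ≤ D' → ∀ q q', near D q q' → near D' q q'

/-- A chunk of level `0` is a single point, a chunk of level `n + 1` is the union of two disjoint
chunks of level `n`, with diameter at most `D (n + 1)`. -/
def IsChunk (near : ℝ → α → α → Prop) (D : ℕ → ℝ) : ℕ → Finset α → Prop
  | 0, e => ∃ q, e = {q}
  | n + 1, e => ∃ c c', IsChunk near D n c ∧ IsChunk near D n c' ∧ Disjoint c c' ∧
      (∀ q, q ∈ e ↔ q ∈ c ∨ q ∈ c') ∧ ∀ q ∈ e, ∀ q' ∈ e, near (D (n + 1)) q q'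

theorem IsChunk.card {near : ℝ → α → α → Prop} {D : ℕ → ℝ} {n : ℕ} {e : Finset α}
    (h : IsChunk near D n e) : e.card = 2 ^ n := by
  classical
  induction n generalizing e with
  | zero => obtain ⟨q, rfl⟩ := h; simp
  | succ n ih =>
    obtain ⟨c, c', hc, hc', hd, he, -⟩ := h
    have : e = c ∪ c' := by ext q; rw [he, Finset.mem_union]
    rw [this, Finset.card_union_of_disjoint hd, ih hc, ih hc', pow_succ]; ring

theorem IsChunk.nonempty {near : ℝ → α → α → Prop} {D : ℕ → ℝ} {n : ℕ} {e : Finset α}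
    (h : IsChunk near D n e) : e.Nonempty := by
  rw [← Finset.card_pos, h.card]; positivity

/-- The points of `E` in the ball of radius `r` around `q` form a set of diameter `r` at distance
more than `s` from the other points of `E`. -/
def Isolated (near : ℝ → α → α → Prop) (E : Set α) (r s : ℝ) (q : α) : Prop :=
  (∀ x ∈ E, ∀ y ∈ E, near r q x → near r q y → near r x y) ∧
    ∀ x ∈ E, ∀ y ∈ E, near r q x → near s x y → near r q y

/-- The points that are left after the points isolated at the scales `< n` have been removed. -/
def stage (near : ℝ → α → α → Prop) (R S : ℕ → ℝ) (ε : Finset α) : ℕ → Set α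
  | 0 => ε
  | n + 1 => {q | q ∈ stage near R S ε n ∧ ¬ Isolated near (stage near R S ε n) (2 * R n) (S n) q}

variable {near : ℝ → α → α → Prop} {R S : ℕ → ℝ} {ε : Finset α}

theorem stage_anti {n m : ℕ} (h : n ≤ m) : stage near R S ε m ⊆ stage near R S ε n := by
  induction m, h using Nat.le_induction with
  | base => exact subset_rfl
  | succ m _ ih => exact fun q hq => ih hq.1

theorem Isolated.of_near (hn : IsNearness near) {E : Set α} {r s : ℝ} (hrs : r ≤ s) {q q' : α}
    (h : Isolated near E r s q) (hq' : q' ∈ E) (hqq : near r q q') : Isolated near E r s q' := by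
  have key : ∀ x ∈ E, near r q' x → near r q x := fun x hx hqx =>
    h.2 q' hq' x hx hqq (hn.mono _ _ hrs _ _ hqx)
  refine ⟨fun x hx y hy hqx hqy => h.1 x hx y hy (key x hx hqx) (key y hy hqy),
    fun x hx y hy hqx hxy => ?_⟩
  exact h.1 q' hq' y hy hqq (h.2 x hx y hy (key x hx hqx) hxy)

/-- A point that is not isolated at the scales `< n` is close to a chunk of level `n`. -/
theorem exists_chunk_of_mem_stage (hn : IsNearness near) (hR : ∀ n, 0 ≤ R n)
    (hS : ∀ n, 2 * R n ≤ S n) (hRS : ∀ n, S n + 3 * R n ≤ R (n + 1)) {n : ℕ} {q : α}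
    (hq : q ∈ stage near R S ε n) :
    ∃ c ⊆ ε, IsChunk near (fun n => 2 * R n) n c ∧ ∀ x ∈ c, near (R n) q x := by
  classical
  induction n generalizing q with
  | zero =>
    refine ⟨{q}, Finset.singleton_subset_iff.2 hq, ⟨q, rfl⟩, fun x hx => ?_⟩
    rw [Finset.mem_singleton.1 hx]
    exact hn.refl _ (hR 0) q
  | succ n ih =>
    have hR0 := hR n
    have hS0 := hS n
    have hRS0 := hRS n
    have hdisj : ∀ (x y : α) (cx cy : Finset α), ¬ near (2 * R n) x y → (∀ z ∈ cx, near (R n) x z) →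
        (∀ z ∈ cy, near (R n) y z) → Disjoint cx cy := by
      intro x y cx cy hxy hx hy
      refine Finset.disjoint_left.2 fun z hzx hzy => hxy ?_
      rw [two_mul]
      exact hn.trans _ _ _ z _ (hx z hzx) (hn.symm _ _ _ (hy z hzy))
    have hunion : ∀ c c', c ⊆ ε → c' ⊆ ε → IsChunk near (fun n => 2 * R n) n c →
        IsChunk near (fun n => 2 * R n) n c' → Disjoint c c' →
        (∀ z ∈ c, near (R (n + 1)) q z) → (∀ z ∈ c', near (R (n + 1)) q z) →
        ∃ c ⊆ ε, IsChunk near (fun n => 2 * R n) (n + 1) c ∧ ∀ x ∈ c, near (R (n + 1)) q x := by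
      intro c c' hcε hcε' hc hc' hd hz hz'
      have hall : ∀ z ∈ c ∪ c', near (R (n + 1)) q z := fun z h =>
        (Finset.mem_union.1 h).elim (hz z) (hz' z)
      refine ⟨c ∪ c', Finset.union_subset hcε hcε', ⟨c, c', hc, hc', hd,
        fun _ => Finset.mem_union, fun x hx y hy => ?_⟩, hall⟩
      show near (2 * R (n + 1)) x y
      rw [two_mul]
      exact hn.trans _ _ _ q _ (hn.symm _ _ _ (hall x hx)) (hall y hy)
    obtain ⟨hqn, hiso⟩ := hq
    rw [Isolated, not_and_or] at hiso
    rcases hiso with hiso | hiso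
    · push Not at hiso
      obtain ⟨x, hx, y, hy, hqx, hqy, hxy⟩ := hiso
      obtain ⟨cx, hcx, hchx, hnx⟩ := ih hx
      obtain ⟨cy, hcy, hchy, hny⟩ := ih hy
      exact hunion cx cy hcx hcy hchx hchy (hdisj x y cx cy hxy hnx hny)
        (fun z hz => hn.mono _ _ (by linarith) _ _ (hn.trans _ _ _ _ _ hqx (hnx z hz)))
        (fun z hz => hn.mono _ _ (by linarith) _ _ (hn.trans _ _ _ _ _ hqy (hny z hz)))
    · push Not at hiso
      obtain ⟨x, hx, y, hy, hqx, hxy, hqy⟩ := hiso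
      obtain ⟨cq, hcq, hchq, hnq⟩ := ih hqn
      obtain ⟨cy, hcy, hchy, hny⟩ := ih hy
      exact hunion cq cy hcq hcy hchq hchy (hdisj q y cq cy hqy hnq hny)
        (fun z hz => hn.mono _ _ (by linarith) _ _ (hnq z hz))
        (fun z hz => hn.mono _ _ (by linarith) _ _
          (hn.trans _ _ _ _ _ (hn.trans _ _ _ _ _ hqx hxy) (hny z hz)))

open scoped Classical in
/-- A set without chunks of level `m` is a disjoint union of clusters of levels less than `m`, which
are far from the clusters of the same or a higher level. -/
theorem exists_clusters (hn : IsNearness near) (hR : ∀ n, 0 ≤ R n)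
    (hS : ∀ n, 2 * R n ≤ S n) (hRS : ∀ n, S n + 3 * R n ≤ R (n + 1)) {m : ℕ}
    (hm : ∀ c ⊆ ε, ¬ IsChunk near (fun n => 2 * R n) m c) :
    ∃ (P : Finset (Finset α)) (ℓ : Finset α → ℕ), P.biUnion id = ε ∧
      (P : Set (Finset α)).PairwiseDisjoint id ∧ ∀ K ∈ P, K.Nonempty ∧ ℓ K < m ∧
        (∀ q ∈ K, ∀ q' ∈ K, near (2 * R (ℓ K)) q q') ∧
        ∀ K' ∈ P, K ≠ K' → ℓ K ≤ ℓ K' → ∀ q ∈ K, ∀ q' ∈ K', ¬ near (S (ℓ K)) q q' := by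
  set E := stage near R S ε with hE
  have hex : ∀ q ∈ ε, ∃ n, q ∉ E (n + 1) := by
    intro q hq
    refine ⟨m, fun hqm => ?_⟩
    obtain ⟨c, hc, hch, -⟩ := exists_chunk_of_mem_stage hn hR hS hRS (stage_anti (Nat.le_succ m) hqm)
    exact hm c hc hch
  have hlev : ∀ q, ∃ n, q ∈ ε → n < m ∧ q ∈ E n ∧ Isolated near (E n) (2 * R n) (S n) q := by
    intro q
    by_cases hq : q ∈ ε
    swap
    · exact ⟨0, fun h => absurd h hq⟩
    have hspec := Nat.find_spec (hex q hq)
    have hmin := fun k => Nat.find_min (hex q hq) (m := k)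
    set n := Nat.find (hex q hq)
    have hqn : q ∈ E n := by
      rcases Nat.eq_zero_or_pos n with h0 | h0
      · rw [h0]; exact hq
      · have := hmin (n - 1) (by omega)
        rw [not_not, Nat.sub_add_cancel h0] at this
        exact this
    refine ⟨n, fun _ => ⟨?_, hqn, ?_⟩⟩
    · by_contra hge
      obtain ⟨c, hc, hch, -⟩ := exists_chunk_of_mem_stage hn hR hS hRS
        (stage_anti (not_lt.1 hge) hqn)
      exact hm c hc hch
    · by_contra hni
      exact hspec ⟨hqn, hni⟩
  choose lev hlev using hlev
  let rel : α → α → Prop := fun q q' => lev q = lev q' ∧ near (2 * R (lev q)) q q'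
  have hR2 : ∀ n, 0 ≤ 2 * R n := fun n => by have := hR n; linarith
  have hrefl : ∀ q, rel q q := fun q => ⟨rfl, hn.refl _ (hR2 _) q⟩
  have hsymm : ∀ q q', rel q q' → rel q' q := fun q q' h =>
    ⟨h.1.symm, by rw [← h.1]; exact hn.symm _ _ _ h.2⟩
  have htrans : ∀ q ∈ ε, ∀ q' ∈ ε, ∀ q'' ∈ ε, rel q q' → rel q' q'' → rel q q'' := by
    intro q hq q' hq' q'' hq'' h h'
    refine ⟨h.1.trans h'.1, ?_⟩
    obtain ⟨-, -, hiso⟩ := hlev q' hq'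
    have h1 := (hlev q hq).2.1
    have h2 := (hlev q'' hq'').2.1
    rw [← h'.1] at h2
    rw [h.1] at h1 ⊢
    exact hiso.1 q h1 q'' h2 ((hsymm _ _ h).2) h'.2
  let cls : α → Finset α := fun q => ε.filter (rel q)
  have hcls : ∀ q q', q' ∈ cls q ↔ q' ∈ ε ∧ rel q q' := fun q q' => Finset.mem_filter
  have hclseq : ∀ q ∈ ε, ∀ q' ∈ cls q, cls q' = cls q := by
    intro q hq q' hq'
    obtain ⟨hq'ε, hr⟩ := (hcls q q').1 hq'
    ext z
    rw [hcls, hcls]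
    exact ⟨fun h => ⟨h.1, htrans q hq q' hq'ε z h.1 hr h.2⟩,
      fun h => ⟨h.1, htrans q' hq'ε q hq z h.1 (hsymm _ _ hr) h.2⟩⟩
  have hself : ∀ q ∈ ε, q ∈ cls q := fun q hq => (hcls q q).2 ⟨hq, hrefl q⟩
  let ℓ : Finset α → ℕ := fun K => if h : K.Nonempty then lev h.choose else 0
  have hℓ : ∀ q ∈ ε, ∀ q' ∈ cls q, ℓ (cls q) = lev q' := by
    intro q hq q' hq'
    have hne : (cls q).Nonempty := ⟨q', hq'⟩
    have h1 := ((hcls _ _).1 hne.choose_spec).2.1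
    have h2 := ((hcls _ _).1 hq').2.1
    simp only [ℓ, dif_pos hne]
    exact h1.symm.trans h2
  refine ⟨ε.image cls, ℓ, ?_, ?_, ?_⟩
  · ext q
    simp only [Finset.mem_biUnion, Finset.mem_image, id]
    constructor
    · rintro ⟨_, ⟨q', _, rfl⟩, hq⟩
      exact ((hcls _ _).1 hq).1
    · intro hq
      exact ⟨_, ⟨q, hq, rfl⟩, hself q hq⟩
  · intro K hK K' hK' hne
    obtain ⟨q, hq, rfl⟩ := Finset.mem_image.1 (Finset.mem_coe.1 hK)
    obtain ⟨q', hq', rfl⟩ := Finset.mem_image.1 (Finset.mem_coe.1 hK')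
    refine Finset.disjoint_left.2 fun z hz hz' => hne ?_
    rw [← hclseq q hq z hz, ← hclseq q' hq' z hz']
  · intro K hK
    obtain ⟨q₀, hq₀, rfl⟩ := Finset.mem_image.1 hK
    have hq₀' := hself q₀ hq₀
    refine ⟨⟨q₀, hq₀'⟩, ?_, ?_, ?_⟩
    · rw [hℓ q₀ hq₀ q₀ hq₀']; exact (hlev q₀ hq₀).1
    · intro q hq q' hq'
      obtain ⟨hqε, -⟩ := (hcls _ _).1 hq
      rw [hℓ q₀ hq₀ q hq]
      rw [← hclseq q₀ hq₀ q hq] at hq'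
      exact ((hcls _ _).1 hq').2.2
    · intro K' hK' hne hle q hq q' hq' hnear
      obtain ⟨q₁, hq₁, rfl⟩ := Finset.mem_image.1 hK'
      rw [hℓ q₀ hq₀ q hq] at hle hnear
      rw [hℓ q₁ hq₁ q' hq'] at hle
      obtain ⟨hqε, -⟩ := (hcls _ _).1 hq
      obtain ⟨hqε', -⟩ := (hcls _ _).1 hq'
      obtain ⟨-, hqE, hiso⟩ := hlev q hqε
      obtain ⟨-, hqE', hiso'⟩ := hlev q' hqε'
      have hq'E : q' ∈ E (lev q) := stage_anti hle hqE'
      have hr : near (2 * R (lev q)) q q' :=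
        hiso.2 q hqE q' hq'E (hn.refl _ (hR2 _) q) hnear
      have hlt : ¬ lev q < lev q' := fun hlt =>
        ((stage_anti (Nat.succ_le_of_lt hlt) hqE' : q' ∈ E (lev q + 1))).2
          (hiso.of_near hn (hS _) hq'E hr)
      have hrel : rel q q' := ⟨by omega, hr⟩
      apply hne
      rw [← hclseq q₀ hq₀ q hq, ← hclseq q₁ hq₁ q' hq']
      exact (hclseq q hqε q' ((hcls _ _).2 ⟨hqε', hrel⟩)).symm

open scoped Classical in
/-- The probability that a random set contains a given set. -/
theorem sum_superset_weight [Fintype α] (p : ℝ) (c : Finset α) :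
    ∑ e : Finset α, (if c ⊆ e then p ^ e.card * (1 - p) ^ (Fintype.card α - e.card) else 0) =
      p ^ c.card := by
  rw [← Finset.sum_filter]
  have h1 : (Finset.univ.filter fun e : Finset α => c ⊆ e) =
      (Finset.univ \ c).powerset.image (c ∪ ·) := by
    rw [← Finset.Icc_eq_image_powerset (Finset.subset_univ c)]
    ext e; simp
  rw [h1, Finset.sum_image]
  · have h2 : ∀ η ∈ (Finset.univ \ c).powerset,
        p ^ (c ∪ η).card * (1 - p) ^ (Fintype.card α - (c ∪ η).card) =
          p ^ c.card * (p ^ η.card * (1 - p) ^ ((Finset.univ \ c).card - η.card)) := by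
      intro η hη
      have hd : Disjoint c η := by
        rw [Finset.mem_powerset] at hη
        exact Finset.disjoint_of_subset_right hη Finset.disjoint_sdiff
      rw [Finset.card_union_of_disjoint hd, Finset.card_sdiff_of_subset (Finset.subset_univ c),
        Finset.card_univ, Nat.sub_sub, pow_add, mul_assoc]
    rw [Finset.sum_congr rfl h2, ← Finset.mul_sum, Finset.sum_pow_mul_eq_add_pow]
    simp
  · intro η hη η' hη' h
    have hη := Finset.mem_powerset.1 hη
    have hη' := Finset.mem_powerset.1 hη'
    ext x
    have hx : x ∈ c ∪ η ↔ x ∈ c ∪ η' := by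
      have h : c ∪ η = c ∪ η' := h
      rw [h]
    simp only [Finset.mem_union] at hx
    constructor
    · intro hxη
      exact (hx.1 (Or.inr hxη)).resolve_left (Finset.mem_sdiff.1 (hη hxη)).2
    · intro hxη
      exact (hx.2 (Or.inr hxη)).resolve_left (Finset.mem_sdiff.1 (hη' hxη)).2

end Chunks

namespace TorusLattice

variable {d : ℕ} {X : TorusLattice d} {t : Euc d} {k : ℕ} {θ cB cD cP : ℝ}

theorem isNearness_near : IsNearness (X.Near (k := k)) :=
  ⟨fun _ hD q => Near.refl hD q, fun _ _ _ h => h.symm, fun _ _ _ _ _ h h' => h.trans h',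
    fun _ _ hD _ _ h => h.mono hD⟩

/-! ### Counting chunks -/

/-- The bound on the number of chunks of level `n` that meet a ball. -/
def chunkBound (l s : ℝ) : ℕ → ℝ
  | 0 => s
  | n + 1 => (l * chunkBound l s n) ^ 2

theorem chunkBound_eq {l s : ℝ} (hl : l ≠ 0) (n : ℕ) :
    chunkBound l s n = (l ^ 2)⁻¹ * (l ^ 2 * s) ^ 2 ^ n := by
  induction n with
  | zero => rw [chunkBound, pow_zero, pow_one]; field_simp
  | succ n ih => rw [chunkBound, ih, pow_succ 2 n, pow_mul]; field_simp

theorem chunkBound_nonneg {l s : ℝ} (hs : 0 ≤ s) (n : ℕ) : 0 ≤ chunkBound l s n := by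
  cases n with
  | zero => exact hs
  | succ n => exact sq_nonneg _

variable (X) in
/-- The chunk `c` meets the ball of radius `r` around `v`. -/
def Meets (v : Euc d) (r : ℝ) (c : Finset (X.Cell k)) : Prop :=
  ∃ κ : X.CoverCell k, X.proj κ ∈ c ∧ ∃ y ∈ κ.1, (X.vdist v y : ℝ) < r

open scoped Classical in
theorem card_chunks_meeting_le (h : X.IsCausal t k θ cB cD cP) {s : ℕ}
    (hs : ∀ x ∈ X.cover.vertices, {κ : X.CoverCell k | x ∈ κ.1}.encard ≤ s) {q : ℝ} (hq : 1 ≤ q)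
    {D : ℕ → ℝ} (hD : ∀ n, D n ≤ q ^ n) {m : ℕ} (hm : m = 0 ∨ 2 * q ^ m ≤ θ * X.linearSize)
    {n : ℕ}
    (hn : n ≤ m) {v : Euc d} (hv : v ∈ X.cover.vertices) :
    (((Finset.univ.filter fun c : Finset (X.Cell k) =>
      IsChunk X.Near D n c ∧ X.Meets v (q ^ n) c).card : ℕ) : ℝ) ≤
        chunkBound ((2 * q) ^ d * cB) s n := by
  induction n generalizing v with
  | zero =>
    have hfin := finite_cells_of_mem (X := X) (l := k) v
    have hcard : hfin.toFinset.card ≤ s := by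
      have := hs v hv
      rw [hfin.encard_eq_coe_toFinset_card] at this
      exact_mod_cast this
    have hsub : (Finset.univ.filter fun c : Finset (X.Cell k) =>
        IsChunk X.Near D 0 c ∧ X.Meets v (q ^ 0) c) ⊆
          hfin.toFinset.image fun κ => {X.proj κ} := by
      intro c hc
      obtain ⟨⟨q', rfl⟩, κ, hκ, y, hy, hd⟩ := (Finset.mem_filter.1 hc).2
      rw [pow_zero, Nat.cast_lt_one] at hd
      have hvy : v = y :=
        ((X.reachable hv (mem_vertices_of_mem_cell κ hy)).dist_eq_zero_iff).1 hd
      refine Finset.mem_image.2 ⟨κ, hfin.mem_toFinset.2 ?_, ?_⟩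
      · rw [hvy]; exact hy
      · rw [Finset.mem_singleton.1 hκ]
    have := (Finset.card_le_card hsub).trans (Finset.card_image_le.trans hcard)
    rw [chunkBound]
    exact_mod_cast this
  | succ n ih =>
    have hm := hm.resolve_left (by omega)
    have hq0 : 0 < q := by linarith
    have hqn : 0 < q ^ n := by positivity
    have hle : q ^ (n + 1) ≤ q ^ m := pow_le_pow_right₀ hq hn
    obtain ⟨U, hU, hUc, hcov⟩ := h.ball_cover v hv (q ^ n) (2 * q ^ (n + 1)) hqn
      (by rw [pow_succ]; nlinarith) (by linarith)
    rw [show 2 * q ^ (n + 1) / q ^ n = 2 * q by rw [pow_succ]; field_simp] at hUc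
    let T : Finset (Finset (X.Cell k)) := U.biUnion fun u =>
      Finset.univ.filter fun c : Finset (X.Cell k) => IsChunk X.Near D n c ∧ X.Meets u (q ^ n) c
    have hB := chunkBound_nonneg (l := (2 * q) ^ d * cB) (s := s) (Nat.cast_nonneg s) n
    have hT : (T.card : ℝ) ≤ (2 * q) ^ d * cB * chunkBound ((2 * q) ^ d * cB) s n := by
      have h1 : (T.card : ℝ) ≤ ∑ u ∈ U, (((Finset.univ.filter fun c : Finset (X.Cell k) =>
          IsChunk X.Near D n c ∧ X.Meets u (q ^ n) c).card : ℕ) : ℝ) := by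
        exact_mod_cast Finset.card_biUnion_le
      refine h1.trans ((Finset.sum_le_sum fun u hu => ih (by omega) (hU hu)).trans ?_)
      rw [Finset.sum_const, nsmul_eq_mul]
      rw [mul_comm cB] at hUc
      exact mul_le_mul_of_nonneg_right hUc hB
    have hsub : (Finset.univ.filter fun c : Finset (X.Cell k) =>
        IsChunk X.Near D (n + 1) c ∧ X.Meets v (q ^ (n + 1)) c) ⊆
          (T ×ˢ T).image fun e => e.1 ∪ e.2 := by
      intro c hc
      obtain ⟨⟨c₁, c₂, h₁, h₂, -, hu, hnear⟩, κ, hκ, y, hy, hd⟩ := (Finset.mem_filter.1 hc).2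
      have hmem : ∀ c', IsChunk X.Near D n c' → (∀ q' ∈ c', q' ∈ c) → c' ∈ T := by
        intro c' hc' hsub
        obtain ⟨q', hq'⟩ := hc'.nonempty
        obtain ⟨κ', hκ', y', hy', hd'⟩ := (hnear _ hκ q' (hsub q' hq')).1 κ rfl y hy
        have h3 : (X.vdist v y' : ℝ) ≤ X.vdist v y + X.vdist y y' := by
          exact_mod_cast X.vdist_triangle hv (mem_vertices_of_mem_cell κ hy) y'
        have h4 := hD (n + 1)
        obtain ⟨u, hu, z, hz, hdz⟩ := hcov κ'.1 κ'.2.1 ⟨y', hy', by linarith⟩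
        exact Finset.mem_biUnion.2 ⟨u, hu, Finset.mem_filter.2 ⟨Finset.mem_univ _, hc', κ',
          hκ' ▸ hq', z, hz, hdz⟩⟩
      refine Finset.mem_image.2 ⟨(c₁, c₂), Finset.mem_product.2
        ⟨hmem c₁ h₁ fun q' hq' => (hu q').2 (Or.inl hq'),
          hmem c₂ h₂ fun q' hq' => (hu q').2 (Or.inr hq')⟩, ?_⟩
      ext q'
      rw [hu, Finset.mem_union]
    have hcard := (Finset.card_le_card hsub).trans Finset.card_image_le
    rw [Finset.card_product] at hcard
    have hcard' : (((Finset.univ.filter fun c : Finset (X.Cell k) =>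
        IsChunk X.Near D (n + 1) c ∧ X.Meets v (q ^ (n + 1)) c).card : ℕ) : ℝ) ≤
          T.card * T.card := by exact_mod_cast hcard
    refine hcard'.trans ?_
    rw [chunkBound, sq]
    exact mul_self_le_mul_self (Nat.cast_nonneg _) hT

open scoped Classical in
theorem card_chunks_le (h : X.IsCausal t k θ cB cD cP) {s : ℕ}
    (hs : ∀ x ∈ X.cover.vertices, {κ : X.CoverCell k | x ∈ κ.1}.encard ≤ s) {q : ℝ} (hq : 1 ≤ q)
    {D : ℕ → ℝ} (hD : ∀ n, D n ≤ q ^ n) {m : ℕ} (hm : m = 0 ∨ 2 * q ^ m ≤ θ * X.linearSize) :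
    (((Finset.univ.filter fun c : Finset (X.Cell k) => IsChunk X.Near D m c).card : ℕ) : ℝ) ≤
      Fintype.card (X.Cell 0) * chunkBound ((2 * q) ^ d * cB) s m := by
  have hsub : (Finset.univ.filter fun c : Finset (X.Cell k) => IsChunk X.Near D m c) ⊆
      Finset.univ.biUnion fun v : X.Cell 0 => Finset.univ.filter fun c : Finset (X.Cell k) =>
        IsChunk X.Near D m c ∧ X.Meets (X.rep v) (q ^ m) c := by
    intro c hc
    have hc := (Finset.mem_filter.1 hc).2
    obtain ⟨q', hq'⟩ := hc.nonempty
    obtain ⟨y, hy⟩ := X.cover.nonempty_of_mem_faces (X.lift q').2.1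
    have hyv := mem_vertices_of_mem_cell _ hy
    obtain ⟨a, ha, hrep⟩ := exists_rep_vertexCell hyv
    refine Finset.mem_biUnion.2 ⟨X.vertexCell y hyv, Finset.mem_univ _, Finset.mem_filter.2
      ⟨Finset.mem_univ _, hc, X.shift a ha (X.lift q'), ?_, y + a, add_mem_translate hy, ?_⟩⟩
    · rwa [proj_shift, proj_lift]
    · rw [hrep, vdist_self, Nat.cast_zero]; positivity
  have h1 : (((Finset.univ.filter fun c : Finset (X.Cell k) => IsChunk X.Near D m c).card : ℕ) : ℝ)
      ≤ ∑ v : X.Cell 0, (((Finset.univ.filter fun c : Finset (X.Cell k) =>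
        IsChunk X.Near D m c ∧ X.Meets (X.rep v) (q ^ m) c).card : ℕ) : ℝ) := by
    exact_mod_cast (Finset.card_le_card hsub).trans Finset.card_biUnion_le
  refine h1.trans ((Finset.sum_le_sum fun v _ =>
    card_chunks_meeting_le h hs hq hD hm le_rfl (X.rep_mem v)).trans ?_)
  rw [Finset.sum_const, nsmul_eq_mul, Finset.card_univ]

end TorusLattice

namespace TorusLattice

variable {d : ℕ} {X : TorusLattice d} {t : Euc d} {k : ℕ} {θ cB cD cP : ℝ}

/-- A cluster that is small compared with the torus lies in a region of the cover. -/
theorem exists_region (h : X.IsCausal t k θ cB cD cP) {K : Finset (X.Cell k)} (hne : K.Nonempty)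
    {δ : ℝ} (hcD : 0 ≤ cD) (hK : ∀ q ∈ K, ∀ q' ∈ K, X.Near (δ - 1) q q')
    (h1 : 3 * δ ≤ X.linearSize) (h2 : cD * δ + 2 < X.linearSize) (h3 : δ ≤ θ * X.linearSize)
    (h4 : cD * δ ≤ θ * X.linearSize) :
    ∃ Z : Region X t θ cD, (∀ q ∈ K, ∃ κ : X.CoverCell k, X.proj κ = q ∧ κ.1 ⊆ Z.V) ∧
      (X.diam Z.V : ℝ) ≤ δ := by
  classical
  obtain ⟨q₀, hq₀⟩ := hne
  obtain ⟨x₀, hx₀⟩ := X.cover.nonempty_of_mem_faces (X.lift q₀).2.1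
  have hx₀v := mem_vertices_of_mem_cell _ hx₀
  have hex : ∀ q, ∃ κ : X.CoverCell k, q ∈ K →
      X.proj κ = q ∧ ∃ x ∈ κ.1, (X.vdist x₀ x : ℝ) ≤ δ - 1 := by
    intro q
    by_cases hq : q ∈ K
    · obtain ⟨κ, hκ, x, hx, hd⟩ := (hK q₀ hq₀ q hq).1 _ (X.proj_lift q₀) x₀ hx₀
      exact ⟨κ, fun _ => ⟨hκ, x, hx, hd⟩⟩
    · exact ⟨X.lift q, fun h => absurd h hq⟩
  choose f hf using hex
  have htri : ∀ {x y z : Euc d}, x ∈ X.cover.vertices → y ∈ X.cover.vertices →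
      (X.vdist x z : ℝ) ≤ X.vdist x y + X.vdist y z := fun hx hy => by
    exact_mod_cast X.vdist_triangle hx hy _
  have hone : ∀ (κ : X.CoverCell k) {x y : Euc d}, x ∈ κ.1 → y ∈ κ.1 →
      (X.vdist x y : ℝ) ≤ 1 := fun κ _ _ hx hy => by
    exact_mod_cast X.vdist_le_one κ.2.1 hx hy
  have hdiam : ∀ q ∈ K, ∀ q' ∈ K, ∀ x ∈ (f q).1, ∀ y ∈ (f q').1, (X.vdist x y : ℝ) ≤ δ := by
    intro q hq q' hq' x hx y hy
    obtain ⟨hpq, z, hz, hdz⟩ := hf q hq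
    obtain ⟨hpq', z', hz', hdz'⟩ := hf q' hq'
    obtain ⟨κ, hκ, x', hx', hd⟩ := (hK q hq q' hq').1 _ hpq x hx
    obtain ⟨a, ha, rfl⟩ := X.exists_shift_of_proj_eq (hpq'.trans hκ.symm)
    have hxv := mem_vertices_of_mem_cell _ hx
    have hzv := mem_vertices_of_mem_cell _ hz
    have hzv' := mem_vertices_of_mem_cell _ hz'
    have hxv' := mem_vertices_of_mem_cell _ hx'
    have ha0 : a = 0 := by
      refine X.eq_zero_of_vdist_lt hzv' ha ?_
      have e1 := htri (z := z' + a) hzv' hx₀v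
      have e2 := htri (z := z' + a) hx₀v hzv
      have e3 := htri (z := z' + a) hzv hxv
      have e4 := htri (z := z' + a) hxv hxv'
      have e5 := hone _ hx' (add_mem_translate (a := a) hz')
      have e6 := hone _ hz hx
      rw [vdist_comm] at hdz'
      have : (X.vdist z' (z' + a) : ℝ) < X.linearSize := by linarith
      exact_mod_cast this
    subst ha0
    have hy' : y ∈ (X.shift 0 ha (f q')).1 := by
      have := add_mem_translate (a := 0) hy
      rwa [add_zero] at this
    have e1 := htri (z := y) hxv hxv'
    have e2 := hone _ hx' hy'
    linarith
  set V : Finset (Euc d) := K.biUnion fun q => (f q).1 with hV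
  have hdV : (X.diam V : ℝ) ≤ δ := by
    have hδ0 : 0 ≤ δ := le_trans (Nat.cast_nonneg _) (hdiam q₀ hq₀ q₀ hq₀
      _ (X.cover.nonempty_of_mem_faces (f q₀).2.1).choose_spec _
      (X.cover.nonempty_of_mem_faces (f q₀).2.1).choose_spec)
    have : X.diam V ≤ ⌊δ⌋₊ := by
      refine X.diam_le fun x hx y hy => ?_
      obtain ⟨q, hq, hxq⟩ := Finset.mem_biUnion.1 hx
      obtain ⟨q', hq', hyq⟩ := Finset.mem_biUnion.1 hy
      exact Nat.le_floor (hdiam q hq q' hq' x hxq y hyq)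
    exact (Nat.cast_le.2 this).trans (Nat.floor_le hδ0)
  have hloc : X.IsLocal θ V := by
    refine ⟨?_, fun x hx => ?_, hdV.trans h3⟩
    · obtain ⟨x, hx⟩ := X.cover.nonempty_of_mem_faces (f q₀).2.1
      exact ⟨x, Finset.mem_biUnion.2 ⟨q₀, hq₀, hx⟩⟩
    · obtain ⟨q, hq, hxq⟩ := Finset.mem_biUnion.1 (Finset.mem_coe.1 hx)
      exact mem_vertices_of_mem_cell _ hxq
  obtain ⟨⟨a, ha⟩, b, hb⟩ := h.exists_diamond V hloc
  have hcd : cD * X.diam V ≤ cD * δ := mul_le_mul_of_nonneg_left hdV hcD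
  exact ⟨⟨V, a, b, hloc, ha, hb, by linarith, hcd.trans h4⟩,
    fun q hq => ⟨f q, (hf q hq).1, Finset.subset_biUnion_of_mem (fun q => (f q).1) hq⟩, hdV⟩

theorem runTime_ge {L : ℕ} {m : ℕ} (hcD : 0 < cD) (hcP : 0 ≤ cP) (hQ : 1 < Q cD cP)
    (hm : Q cD cP ^ m * cD ≤ L) : cD * cP * Q cD cP ^ (m - 1 : ℤ) + 1 ≤ runTime cD cP L := by
  have hL : (0 : ℝ) < L / cD := by
    have : 0 < Q cD cP ^ m * cD := by positivity
    exact div_pos (this.trans_le hm) hcD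
  have h1 : (m : ℝ) ≤ Real.logb (Q cD cP) (L / cD) := by
    rw [Real.le_logb_iff_rpow_le hQ hL, Real.rpow_natCast, le_div_iff₀ hcD]
    exact hm
  have h2 : (m : ℤ) ≤ ⌈Real.logb (Q cD cP) (L / cD)⌉ := by
    have := h1.trans (Int.le_ceil _)
    exact_mod_cast this
  rw [runTime]
  have h3 : Q cD cP ^ (m - 1 : ℤ) ≤ Q cD cP ^ (⌈Real.logb (Q cD cP) (L / cD)⌉ - 1) :=
    zpow_le_zpow_right₀ hQ.le (by omega)
  have := mul_le_mul_of_nonneg_left h3 (mul_nonneg hcD.le hcP)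
  linarith

/-- The diameter of the chunks of level `n`. -/
def chunkDiam (q : ℝ) (n : ℕ) : ℝ := 2 * ((q ^ n - 1) / 2)

/-- The decoder corrects all errors without chunks of a level that is small compared with the size
of the torus. -/
theorem SweepRule.succeeds_of_no_chunk (S : X.SweepRule t k) (h : X.IsCausal t k θ cB cD cP)
    (hk : 2 ≤ k) (hcD : 1 ≤ cD) (hcP : 2 ≤ cP) {m Tmax : ℕ}
    (hm : m = 0 ∨ 4 * cD * Q cD cP ^ m ≤ X.linearSize ∧
      4 * cD * Q cD cP ^ m ≤ θ * X.linearSize)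
    (hT : runTime cD cP X.linearSize ≤ Tmax) {ε : Finset (X.Cell k)}
    (hε : ∀ c ⊆ ε, ¬ IsChunk X.Near (chunkDiam (Q cD cP)) m c) : S.Succeeds Tmax ε := by
  classical
  have hQ : 12 ≤ Q cD cP := by rw [Q]; nlinarith
  have hT1 : 1 ≤ Tmax := by
    have : (1 : ℝ) ≤ Tmax := by
      refine le_trans ?_ hT
      rw [runTime]
      have : 0 ≤ cD * cP * Q cD cP ^ (⌈Real.logb (Q cD cP) (X.linearSize / cD)⌉ - 1) := by
        positivity
      linarith
    exact_mod_cast this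
  rcases Nat.eq_zero_or_pos m with rfl | hm0
  · have : ε = ∅ := by
      by_contra hne
      obtain ⟨q, hq⟩ := Finset.nonempty_iff_ne_empty.2 hne
      exact hε {q} (Finset.singleton_subset_iff.2 hq) ⟨q, rfl⟩
    subst this
    have h0 : X.chainOf (∅ : Finset (X.Cell k)) = 0 := rfl
    obtain ⟨n, rfl⟩ : ∃ n, Tmax = n + 1 := ⟨Tmax - 1, by omega⟩
    refine ⟨0, ?_, ?_⟩
    · rw [h0, map_zero, decode, loop, if_pos rfl]
    · rw [h0, add_zero]; exact Submodule.zero_mem _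
  obtain ⟨hm1, hm2⟩ := hm.resolve_left hm0.ne'
  set q := Q cD cP with hq
  have hpow : ∀ n, 1 ≤ q ^ n := fun n => one_le_pow₀ (by linarith)
  obtain ⟨P, ℓ, hP, hdisj, hcl⟩ := exists_clusters (R := fun n => (q ^ n - 1) / 2)
    (S := fun n => q / 3 * q ^ n) isNearness_near
    (fun n => by have := hpow n; linarith)
    (fun n => by have := hpow n; nlinarith)
    (fun n => by have := hpow n; rw [pow_succ]; nlinarith) hε
  have hlev : ∀ K ∈ P, q ^ ℓ K ≤ q ^ (m - 1) := fun K hK =>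
    pow_le_pow_right₀ (by linarith) (by have := (hcl K hK).2.1; omega)
  have hqm : q ^ m = q ^ (m - 1) * q := by
    rw [← pow_succ, Nat.sub_add_cancel hm0]
  have hreg : ∀ K : {K // K ∈ P}, ∃ Z : Region X t θ cD,
      (∀ q ∈ K.1, ∃ κ : X.CoverCell k, X.proj κ = q ∧ κ.1 ⊆ Z.V) ∧
        (X.diam Z.V : ℝ) ≤ q ^ ℓ K.1 := by
    rintro ⟨K, hK⟩
    have e1 := hlev K hK
    have e2 := hpow (ℓ K)
    have e3 := hpow (m - 1)
    have e4 : q ^ (m - 1) * 12 ≤ q ^ m := by rw [hqm]; nlinarith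
    have e5 : cD * q ^ ℓ K ≤ cD * q ^ m := by nlinarith
    have e6 : q ^ m ≤ cD * q ^ m := by nlinarith
    refine exists_region h (hcl K hK).1 (by linarith) (fun a ha b hb => ?_) (by nlinarith)
      (by nlinarith) (by nlinarith) (by nlinarith)
    exact ((hcl K hK).2.2.1 a ha b hb).mono (by dsimp only; linarith)
  choose Z hZK hZd using hreg
  have hsepR : ∀ K : {K // K ∈ P},
      cD * X.diam (Z K).V + cP * (cD * X.diam (Z K).V) ≤ q / 3 * q ^ ℓ K.1 := by
    intro K
    have e1 := mul_le_mul_of_nonneg_left (hZd K) (show 0 ≤ cD * (1 + cP) by positivity)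
    have e2 := hpow (ℓ K.1)
    have e3 : cD * (1 + cP) * q ^ ℓ K.1 ≤ q / 3 * q ^ ℓ K.1 :=
      mul_le_mul_of_nonneg_right (by rw [hq, Q]; nlinarith) (by linarith)
    linarith
  refine S.succeeds_of_clusters h hk (by nlinarith [hpow m]) (by linarith)
    (fun K : {K // K ∈ P} => K.1) ?_ Z hZK ?_ (N := ⌊cD * cP * q ^ (m - 1)⌋₊) ?_ ?_
  · rw [Finset.sum_coe_sort P fun K => X.chainOf K, chainOf, ← hP, Finset.sum_biUnion hdisj]
    rfl
  · intro K K' hne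
    have hne' : K.1 ≠ K'.1 := fun h' => hne (Subtype.ext h')
    rcases le_total (ℓ K.1) (ℓ K'.1) with hle | hle
    · exact Or.inl fun a ha b hb hn =>
        (hcl K.1 K.2).2.2.2 K'.1 K'.2 hne' hle a ha b hb (hn.mono (hsepR K))
    · exact Or.inr fun a ha b hb hn =>
        (hcl K'.1 K'.2).2.2.2 K.1 K.2 hne'.symm hle a ha b hb (hn.mono (hsepR K'))
  · intro K
    refine lt_of_le_of_lt ?_ (Nat.lt_floor_add_one _)
    have e1 := (hZd K).trans (hlev K.1 K.2)
    have := mul_le_mul_of_nonneg_left e1 (show 0 ≤ cD * cP by positivity)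
    linarith
  · have h1 := (runTime_ge (by linarith) (by linarith) (by linarith)
      (show q ^ m * cD ≤ X.linearSize by nlinarith [hpow m])).trans hT
    rw [← hq, show q ^ (m - 1 : ℤ) = q ^ (m - 1) by
      rw [← zpow_natCast, Nat.cast_sub hm0, Nat.cast_one]] at h1
    have h2 : (⌊cD * cP * q ^ (m - 1)⌋₊ : ℝ) ≤ cD * cP * q ^ (m - 1) :=
      Nat.floor_le (by have := hpow (m - 1); positivity)
    have h3 : ((⌊cD * cP * q ^ (m - 1)⌋₊ + 1 : ℕ) : ℝ) ≤ Tmax := by push_cast; linarith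
    exact_mod_cast h3

open scoped Classical in
theorem SweepRule.failProb_le (S : X.SweepRule t k) {Tmax : ℕ} {C : Finset (X.Cell k) → Prop}
    {w : ℕ} (hw : ∀ c, C c → c.card = w)
    (hC : ∀ ε, (∀ c ⊆ ε, ¬ C c) → S.Succeeds Tmax ε) {p : ℝ} (hp0 : 0 ≤ p) (hp1 : p ≤ 1) :
    S.failProb Tmax p ≤ ((Finset.univ.filter C).card : ℝ) * p ^ w := by
  have hnn : ∀ ε : Finset (X.Cell k),
      0 ≤ p ^ ε.card * (1 - p) ^ (Fintype.card (X.Cell k) - ε.card) := fun ε =>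
    mul_nonneg (pow_nonneg hp0 _) (pow_nonneg (by linarith) _)
  have h1 : S.failProb Tmax p ≤ ∑ ε : Finset (X.Cell k), ∑ c ∈ Finset.univ.filter C,
      if c ⊆ ε then p ^ ε.card * (1 - p) ^ (Fintype.card (X.Cell k) - ε.card) else 0 := by
    rw [failProb]
    refine Finset.sum_le_sum fun ε _ => ?_
    have hnn' : ∀ c ∈ Finset.univ.filter C, 0 ≤ if c ⊆ ε then
        p ^ ε.card * (1 - p) ^ (Fintype.card (X.Cell k) - ε.card) else 0 := fun c _ => by
      split_ifs
      · exact hnn ε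
      · exact le_rfl
    split_ifs with hs
    · exact Finset.sum_nonneg hnn'
    · have : ∃ c ⊆ ε, C c := by
        by_contra! hcon
        exact hs (hC ε hcon)
      obtain ⟨c, hc, hCc⟩ := this
      refine le_trans ?_ (Finset.single_le_sum hnn'
        (Finset.mem_filter.2 ⟨Finset.mem_univ c, hCc⟩))
      rw [if_pos hc]
  refine h1.trans ?_
  rw [Finset.sum_comm]
  simp only [sum_superset_weight]
  rw [Finset.sum_congr rfl fun c hc => by rw [hw c (Finset.mem_filter.1 hc).2], Finset.sum_const,
    nsmul_eq_mul]

theorem SweepRule.failProb_nonneg (S : X.SweepRule t k) (Tmax : ℕ) {p : ℝ} (hp0 : 0 ≤ p)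
    (hp1 : p ≤ 1) : 0 ≤ S.failProb Tmax p := by
  classical
  refine Finset.sum_nonneg fun ε _ => ?_
  split_ifs
  · exact le_rfl
  · exact mul_nonneg (pow_nonneg hp0 _) (pow_nonneg (by linarith) _)

/-- The exponent in the bound on the failure probability, relative to `L ^ β`. -/
def rate (θ cD cP : ℝ) : ℝ := ((4 * cD + 4 * cD / θ) * Q cD cP) ^ (-beta cD cP)

theorem exists_level (hθ : 0 < θ) (hcD : 1 ≤ cD) (hQ : 1 < Q cD cP) (L : ℕ) :
    ∃ m : ℕ, (m = 0 ∨ 4 * cD * Q cD cP ^ m ≤ L ∧ 4 * cD * Q cD cP ^ m ≤ θ * L) ∧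
      rate θ cD cP * (L : ℝ) ^ beta cD cP ≤ 2 ^ m := by
  set q := Q cD cP with hq
  set A := 4 * cD + 4 * cD / θ with hA
  have hA0 : 0 < A := by positivity
  have hq0 : 0 < q := by linarith
  have hβ : 0 < beta cD cP := Real.logb_pos hQ one_lt_two
  obtain ⟨m, hm, hlt⟩ : ∃ m : ℕ, (m = 0 ∨ A * q ^ m ≤ L) ∧ (L : ℝ) ≤ A * q * q ^ m := by
    rcases lt_or_ge (L : ℝ) A with hlt | hge
    · exact ⟨0, Or.inl rfl, by rw [pow_zero]; nlinarith⟩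
    · obtain ⟨m, h1, h2⟩ := exists_nat_pow_near ((one_le_div hA0).2 hge) hQ
      refine ⟨m, Or.inr ?_, ?_⟩
      · rw [le_div_iff₀ hA0] at h1; linarith
      · rw [div_lt_iff₀ hA0, pow_succ] at h2; linarith
  refine ⟨m, hm.imp_right fun h => ⟨?_, ?_⟩, ?_⟩
  · have : 0 ≤ 4 * cD / θ * q ^ m := by positivity
    linarith
  · have h1 : 4 * cD / θ * q ^ m ≤ L := by
      have : 0 ≤ 4 * cD * q ^ m := by positivity
      linarith
    have h2 := mul_le_mul_of_nonneg_left h1 hθ.le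
    have h3 : θ * (4 * cD / θ * q ^ m) = 4 * cD * q ^ m := by field_simp
    linarith
  · have h1 : (L : ℝ) ^ beta cD cP ≤ (A * q * q ^ m) ^ beta cD cP :=
      Real.rpow_le_rpow (Nat.cast_nonneg _) hlt hβ.le
    have h2 : (q ^ m) ^ beta cD cP = 2 ^ m := by
      rw [← Real.rpow_natCast, ← Real.rpow_mul hq0.le, mul_comm, Real.rpow_mul hq0.le, beta, ← hq,
        Real.rpow_logb hq0 (by linarith) two_pos, Real.rpow_natCast]
    rw [Real.mul_rpow (by positivity) (by positivity), h2] at h1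
    have h3 : 0 < (A * q) ^ beta cD cP := by positivity
    rw [rate, ← hA, ← hq, Real.rpow_neg (by positivity), inv_mul_le_iff₀ h3]
    exact h1

/-- The bound on the failure probability for a single lattice. -/
theorem SweepRule.failProb_le_rate (S : X.SweepRule t k) (h : X.IsCausal t k θ cB cD cP)
    (hk : 2 ≤ k) (hθ : 0 < θ) (hcD : 1 ≤ cD) (hcP : 2 ≤ cP) (hcB : 0 < cB) {s : ℕ} (hs0 : 0 < s)
    (hs : ∀ x ∈ X.cover.vertices, {κ : X.CoverCell k | x ∈ κ.1}.encard ≤ s) {M : ℝ}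
    (hM : (Fintype.card (X.Cell 0) : ℝ) ≤ M) {Tmax : ℕ}
    (hT : runTime cD cP X.linearSize ≤ Tmax) {p : ℝ} (hp0 : 0 ≤ p) (hp1 : p ≤ 1)
    (hp : p < pth d cB cD cP s) :
    S.failProb Tmax p ≤ (lam d cB cD cP ^ 2)⁻¹ * M *
      (p / pth d cB cD cP s) ^ (rate θ cD cP * (X.linearSize : ℝ) ^ beta cD cP) := by
  classical
  have hQ : 12 ≤ Q cD cP := by rw [Q]; nlinarith
  have hQ0 : 0 < Q cD cP := by linarith
  have hl : 0 < lam d cB cD cP := by rw [lam]; positivity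
  have hpth : 0 < pth d cB cD cP s := by rw [pth]; positivity
  have hrate : 0 ≤ rate θ cD cP * (X.linearSize : ℝ) ^ beta cD cP := by rw [rate]; positivity
  obtain ⟨m, hm, hrm⟩ := exists_level hθ hcD (by linarith) X.linearSize
  have h1 := S.failProb_le (C := IsChunk X.Near (chunkDiam (Q cD cP)) m)
    (fun c hc => hc.card) (fun ε hε => S.succeeds_of_no_chunk h hk hcD hcP hm hT hε) hp0 hp1
  have h2 := card_chunks_le h hs (q := Q cD cP) (by linarith) (D := chunkDiam (Q cD cP))
    (fun n => by rw [chunkDiam]; linarith) (m := m)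
    (hm.imp_right fun h => by have := pow_pos hQ0 m; nlinarith [h.2])
  rw [← lam, chunkBound_eq hl.ne'] at h2
  have h3 : (lam d cB cD cP ^ 2 * s) ^ 2 ^ m * p ^ 2 ^ m = (p / pth d cB cD cP s) ^ 2 ^ m := by
    rw [← mul_pow, pth, div_inv_eq_mul, mul_comm p]
  have hr0 : 0 ≤ p / pth d cB cD cP s := by positivity
  have hr1 : p / pth d cB cD cP s ≤ 1 := (div_le_one hpth).2 hp.le
  have h4 : (p / pth d cB cD cP s) ^ 2 ^ m ≤
      (p / pth d cB cD cP s) ^ (rate θ cD cP * (X.linearSize : ℝ) ^ beta cD cP) := by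
    rw [← Real.rpow_natCast]
    refine Real.rpow_le_rpow_of_exponent_ge' hr0 hr1 hrate ?_
    push_cast
    exact hrm
  calc S.failProb Tmax p
      ≤ Fintype.card (X.Cell 0) * ((lam d cB cD cP ^ 2)⁻¹ * (lam d cB cD cP ^ 2 * s) ^ 2 ^ m) *
        p ^ 2 ^ m := h1.trans (mul_le_mul_of_nonneg_right h2 (by positivity))
    _ = (lam d cB cD cP ^ 2)⁻¹ * Fintype.card (X.Cell 0) *
        ((lam d cB cD cP ^ 2 * s) ^ 2 ^ m * p ^ 2 ^ m) := by ring
    _ ≤ _ := by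
      rw [h3]
      have hM0 := (Nat.cast_nonneg (α := ℝ) (Fintype.card (X.Cell 0))).trans hM
      gcongr

/-- A stretched exponential decays faster than any power grows. -/
theorem tendsto_pow_mul_rpow_rpow {r α β : ℝ} (hr0 : 0 ≤ r) (hr1 : r < 1) (hα : 0 < α)
    (hβ : 0 < β) (a : ℕ) :
    Filter.Tendsto (fun x : ℝ => x ^ a * r ^ (α * x ^ β)) Filter.atTop (𝓝 0) := by
  set r' := max r (1 / 2) with hr'
  have hr'0 : 0 < r' := lt_max_of_lt_right (by norm_num)
  have hr'1 : r' < 1 := max_lt hr1 (by norm_num)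
  have hlog : 0 < -Real.log r' := neg_pos.2 (Real.log_neg hr'0 hr'1)
  have h1 := (tendsto_rpow_mul_exp_neg_mul_atTop_nhds_zero (a / β) (-Real.log r' * α)
    (by positivity)).comp (tendsto_rpow_atTop hβ)
  refine squeeze_zero' ?_ ?_ h1
  · filter_upwards [Filter.eventually_ge_atTop 0] with x hx
    positivity
  · filter_upwards [Filter.eventually_ge_atTop 0] with x hx
    simp only [Function.comp]
    rw [← Real.rpow_mul hx, mul_div_cancel₀ _ hβ.ne', Real.rpow_natCast]
    refine mul_le_mul_of_nonneg_left ?_ (by positivity)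
    refine (Real.rpow_le_rpow hr0 (le_max_left r (1 / 2)) (by positivity)).trans ?_
    rw [← hr', Real.rpow_def_of_pos hr'0]
    apply le_of_eq
    congr 1
    ring

theorem one_le_of_encard_le (hkd : k ≤ d) {s : ℕ}
    (hs : ∀ x ∈ X.cover.vertices, {κ : X.CoverCell k | x ∈ κ.1}.encard ≤ s) : 0 < s := by
  obtain ⟨σ, hσ, hc⟩ := X.exists_face
  obtain ⟨κ, hκ, hcκ⟩ := Finset.exists_subset_card_eq (show k + 1 ≤ σ.card by omega)
  have hne : κ.Nonempty := Finset.card_pos.1 (by omega)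
  have hκf := X.cover.down_closed hσ hκ hne
  obtain ⟨x, hx⟩ := hne
  have h1 := hs x (X.mem_vertices_of_mem hκf hx)
  by_contra h0
  rw [Nat.eq_zero_of_not_pos h0, Nat.cast_zero, nonpos_iff_eq_zero, Set.encard_eq_zero] at h1
  have : (⟨κ, hκf, hcκ⟩ : X.CoverCell k) ∈ {κ : X.CoverCell k | x ∈ κ.1} := hx
  rw [h1] at this
  exact this

end TorusLattice

end Sweep

end

theorem theorem1 (d k : ℕ) (hk : 2 ≤ k) (hkd : k < d) (θ cB cD cP : ℝ) (hθ : 0 < θ) (s : ℕ) :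
    ∃ α : ℝ, 0 < α ∧
      ∀ (X : ℕ → Sweep.TorusLattice d) (t : ℕ → Sweep.Euc d),
        (∀ n, (X n).IsCausal (t n) k θ cB cD cP) →
        (∀ n, ∀ x ∈ (X n).cover.vertices, {κ : (X n).CoverCell k | x ∈ κ.1}.encard ≤ s) →
        Filter.Tendsto (fun n => (X n).linearSize) Filter.atTop Filter.atTop →
        0 < Sweep.pth d cB cD cP s ∧ 0 < Sweep.beta cD cP ∧
        ∀ (C : ℝ) (a : ℕ),
          (∀ n, (Fintype.card ((X n).Cell 0) : ℝ) ≤ C * ((X n).linearSize : ℝ) ^ a) →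
        ∀ (S : ∀ n, (X n).SweepRule (t n) k) (Tmax : ℕ → ℕ),
          (∀ n, Sweep.runTime cD cP (X n).linearSize ≤ Tmax n) →
        ∀ p : ℝ, 0 ≤ p → p < Sweep.pth d cB cD cP s →
          (∀ n, (S n).failProb (Tmax n) p ≤
            (Sweep.lam d cB cD cP ^ 2)⁻¹ * (C * ((X n).linearSize : ℝ) ^ a) *
              (p / Sweep.pth d cB cD cP s) ^ (α * ((X n).linearSize : ℝ) ^ Sweep.beta cD cP)) ∧
          Filter.Tendsto (fun n => (S n).failProb (Tmax n) p) Filter.atTop (𝓝 0) := by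
  by_cases hc : 1 ≤ cD ∧ 2 ≤ cP
  swap
  · refine ⟨1, one_pos, fun X t hX _ hL => absurd ?_ hc⟩
    have hLr := (tendsto_natCast_atTop_atTop (R := ℝ)).comp hL
    obtain ⟨n, hn⟩ := ((hLr.const_mul_atTop hθ).eventually_ge_atTop 1).exists
    exact ⟨(hX n).one_le_cD (by omega) hn, (hX n).two_le_cP (by omega) hn⟩
  obtain ⟨hcD, hcP⟩ := hc
  have hQ : 12 ≤ Sweep.Q cD cP := by rw [Sweep.Q]; nlinarith
  have hrate : 0 < Sweep.TorusLattice.rate θ cD cP := by rw [Sweep.TorusLattice.rate]; positivity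
  refine ⟨Sweep.TorusLattice.rate θ cD cP, hrate, fun X t hX hs hL => ?_⟩
  have hLr := (tendsto_natCast_atTop_atTop (R := ℝ)).comp hL
  obtain ⟨n, hn⟩ := ((hLr.const_mul_atTop hθ).eventually_ge_atTop 1).exists
  have hcB := (hX n).one_le_cB hn
  have hcB0 : 0 < cB := by
    by_contra h
    have : cB * 2 ^ d ≤ 0 := mul_nonpos_of_nonpos_of_nonneg (not_lt.1 h) (by positivity)
    linarith
  have hs0 : 0 < s := Sweep.TorusLattice.one_le_of_encard_le hkd.le (hs n)
  have hlam : 1 ≤ Sweep.lam d cB cD cP := by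
    rw [Sweep.lam, mul_pow, show 2 ^ d * Sweep.Q cD cP ^ d * cB = Sweep.Q cD cP ^ d * (cB * 2 ^ d) by
      ring]
    exact one_le_mul_of_one_le_of_one_le (one_le_pow₀ (by linarith)) hcB
  have hpth : 0 < Sweep.pth d cB cD cP s := by rw [Sweep.pth]; positivity
  have hpth1 : Sweep.pth d cB cD cP s ≤ 1 := by
    rw [Sweep.pth]
    refine inv_le_one_of_one_le₀ (one_le_mul_of_one_le_of_one_le (one_le_pow₀ hlam) ?_)
    exact_mod_cast hs0
  have hβ : 0 < Sweep.beta cD cP := Real.logb_pos (by linarith) one_lt_two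
  refine ⟨hpth, hβ, fun C a hC S Tmax hT p hp0 hp => ?_⟩
  have hp1 : p ≤ 1 := hp.le.trans hpth1
  have hbound := fun n => (S n).failProb_le_rate (hX n) hk hθ hcD hcP hcB0 hs0 (hs n) (hC n) (hT n)
    hp0 hp1 hp
  refine ⟨hbound, squeeze_zero (fun n => (S n).failProb_nonneg (Tmax n) hp0 hp1) hbound ?_⟩
  have h1 := ((Sweep.TorusLattice.tendsto_pow_mul_rpow_rpow (div_nonneg hp0 hpth.le)
    ((div_lt_one hpth).2 hp) hrate hβ a).comp hLr).const_mul
      ((Sweep.lam d cB cD cP ^ 2)⁻¹ * C)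
  rw [mul_zero] at h1
  refine h1.congr fun n => ?_
  simp only [Function.comp]
  ring
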